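/- Let $G=\mathrm{SO}_n(\mathbb C)$, or $G=\mathrm{Sp}_n(\mathbb C)$ with $n$ even, with Lie algebra $\mathfrak g$. Let $P\subset G$ be a parabolic subgroup (the normalizer in $G$ of a subalgebra $\mathfrak p$ of $\mathfrak g$ that contains a Borel subalgebra), let $\mathfrak n$ be the Lie algebra of its unipotent radical $R_u(P)$, let $L\subset P$ be a Levi subgroup ($P=L\ltimes R_u(P)$) with Lie algebra $\mathfrak l$, and let $P^-$ be the opposite parabolic subgroup ($P\cap P^-=L$), with Lie algebra $\mathfrak p^-$. Let $Z$ be the identity component of the center of $L$. For a character $\chi$ of $Z$ put $\mathfrak g_\chi=\{x\in\mathfrak g:\mathrm{Ad}(z)x=\chi(z)x\ \text{for all } z\in Z\}$. Write characters additively and write $\chi>0$ if $0\ne\mathfrak g_\chi\subset\mathfrak n$; thus $\mathfrak n=\bigoplus_{\chi>0}\mathfrak g_\chi\cong\mathfrak g/\mathfrak p^-$ as $L$-modules. Fix a compact real form $\mathfrak k$ of $\mathfrak l$, that is, the Lie algebra of a compact real form of the group $L$. An element $e$ of $\mathfrak n$ or of $\mathfrak g/\mathfrak p^-$, with components $e_\chi\in\mathfrak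 g_\chi$ $(\chi>0)$, is said to admit a Hermitian multiple characteristic if for every $\chi>0$ there are $f_\chi\in\mathfrak g_{-\chi}$ and $h_\chi\in\mathfrak l\cap i\mathfrak k$ with $[e_\chi,f_\chi]=h_\chi$, $[h_\chi,e_\chi]=2e_\chi$, $[h_\chi,f_\chi]=-2f_\chi$ (zero vectors are allowed). Theorem. Every such $P$ is weakly ample: for every choice of $L$ and $\mathfrak k$, for every $e\in\mathfrak n$ there is $g\in L$ such that $\mathrm{Ad}(g)e$ admits a Hermitian multiple characteristic, and likewise for every $e\in\mathfrak g/\mathfrak p^-$ there is $g\in L$ such that $\mathrm{Ad}(g)e$ admits a Hermitian multiple characteristic. -/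

import Mathlib

namespace HermChar

open Matrix

attribute [local instance] LieRing.ofAssociativeRing

/-- The special orthogonal group `SO_n(ℂ)`, i.e. the matrices with `A * Aᵀ = 1` and
`det A = 1`, as a subgroup of `GL_n(ℂ)`. -/
def SO (n : ℕ) : Subgroup (GL (Fin n) ℂ) where
  carrier := {g | (g : Matrix (Fin n) (Fin n) ℂ) ∈ Matrix.specialOrthogonalGroup (Fin n) ℂ}
  mul_mem' := by
    intro a b ha hb
    simpa using mul_mem ha hb
  one_mem' := by simp
  inv_mem' := by
    intro a ha
    rw [Set.mem_ofPred_eq, mem_specialOrthogonalGroup_iff, mem_orthogonalGroup_iff] at ha ⊢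
    have h1 : (a : Matrix (Fin n) (Fin n) ℂ)⁻¹ = (a : Matrix (Fin n) (Fin n) ℂ)ᵀ :=
      Matrix.inv_eq_right_inv ha.1
    rw [Matrix.coe_units_inv, h1, Matrix.det_transpose, Matrix.transpose_transpose]
    exact ⟨mul_eq_one_comm.mp ha.1, ha.2⟩

/-- The symplectic group `Sp_{2m}(ℂ)` as a subgroup of `GL_{2m}(ℂ)`. -/
def Sp (m : ℕ) : Subgroup (GL (Fin m ⊕ Fin m) ℂ) where
  carrier := {g | (g : Matrix (Fin m ⊕ Fin m) (Fin m ⊕ Fin m) ℂ) ∈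
    Matrix.symplecticGroup (Fin m) ℂ}
  mul_mem' := by
    intro a b ha hb
    simpa using mul_mem ha hb
  one_mem' := by simp
  inv_mem' := by
    intro a ha
    have h : ((⟨a, ha⟩ : Matrix.symplecticGroup (Fin m) ℂ)⁻¹ : Matrix.symplecticGroup (Fin m) ℂ)
        * (⟨a, ha⟩ : Matrix.symplecticGroup (Fin m) ℂ) = 1 := inv_mul_cancel _
    have h2 := congrArg Subtype.val h
    have h3 : (a : Matrix (Fin m ⊕ Fin m) (Fin m ⊕ Fin m) ℂ)⁻¹ =
        ((⟨a, ha⟩ : Matrix.symplecticGroup (Fin m) ℂ)⁻¹ : Matrix.symplecticGroup (Fin m) ℂ) :=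
      Matrix.inv_eq_left_inv h2
    rw [Set.mem_ofPred_eq, Matrix.coe_units_inv, h3]
    exact Subtype.property _

section Groups

variable {ι : Type} [Fintype ι] [DecidableEq ι]

/-- `H` is an algebraic, i.e. Zariski closed, subgroup of `GL_ι(ℂ)`: the set of invertible
matrices at which all members of some set of polynomials in the matrix entries vanish. -/
def IsAlgebraic (H : Subgroup (GL ι ℂ)) : Prop :=
  ∃ S : Set (MvPolynomial (ι × ι) ℂ), ∀ g : GL ι ℂ,
    g ∈ H ↔ ∀ p ∈ S, MvPolynomial.eval (fun ij : ι × ι => (g : Matrix ι ι ℂ) ij.1 ij.2) p = 0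

/-- The Lie algebra of a closed subgroup `H` of `GL_ι(ℂ)`, as a set of matrices: all `X` with
`exp (t X) ∈ H` for every real `t`. -/
def lieAlg (H : Subgroup (GL ι ℂ)) : Set (Matrix ι ι ℂ) :=
  {X | ∀ t : ℝ, ∃ g ∈ H, (g : Matrix ι ι ℂ) = NormedSpace.exp (t • X)}

/-- The adjoint action `Ad(g) X = g X g⁻¹`. -/
def Ad (g : GL ι ℂ) (X : Matrix ι ι ℂ) : Matrix ι ι ℂ :=
  (g : Matrix ι ι ℂ) * X * ((g⁻¹ : GL ι ℂ) : Matrix ι ι ℂ)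

/-- A Borel subalgebra of the Lie algebra of `G`: a maximal solvable Lie subalgebra. -/
def IsBorelSubalgebra (G : Subgroup (GL ι ℂ)) (𝔟 : LieSubalgebra ℂ (Matrix ι ι ℂ)) : Prop :=
  Maximal (fun 𝔞 : LieSubalgebra ℂ (Matrix ι ι ℂ) =>
    (𝔞 : Set (Matrix ι ι ℂ)) ⊆ lieAlg G ∧ LieAlgebra.IsSolvable 𝔞) 𝔟

/-- A parabolic subalgebra of the Lie algebra of `G`: a Lie subalgebra that contains a Borel
subalgebra. -/
def IsParabolicSubalgebra (G : Subgroup (GL ι ℂ)) (𝔭 : LieSubalgebra ℂ (Matrix ι ι ℂ)) : Prop :=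
  (𝔭 : Set (Matrix ι ι ℂ)) ⊆ lieAlg G ∧ ∃ 𝔟, IsBorelSubalgebra G 𝔟 ∧ 𝔟 ≤ 𝔭

/-- A parabolic subgroup of a connected reductive group `G`: the normalizer in `G` of a parabolic
subalgebra of its Lie algebra. -/
def IsParabolic (G P : Subgroup (GL ι ℂ)) : Prop :=
  ∃ 𝔭 : LieSubalgebra ℂ (Matrix ι ι ℂ), IsParabolicSubalgebra G 𝔭 ∧
    ∀ g : GL ι ℂ, g ∈ P ↔ g ∈ G ∧ ∀ X ∈ 𝔭, Ad g X ∈ 𝔭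

/-- The unipotent radical of `P`: the subgroup generated by all connected algebraic normal
subgroups of `P` that consist of unipotent matrices.  (An algebraic subgroup of `GL_ι(ℂ)` is
connected for the usual topology if and only if it is so for the Zariski topology.) -/
def unipotentRadical (P : Subgroup (GL ι ℂ)) : Subgroup (GL ι ℂ) :=
  sSup {U | U ≤ P ∧ IsAlgebraic U ∧ IsConnected (U : Set (GL ι ℂ)) ∧
    (∀ p ∈ P, ∀ u ∈ U, p * u * p⁻¹ ∈ U) ∧
    ∀ u ∈ U, IsNilpotent ((u : Matrix ι ι ℂ) - 1)}

/-- `L` is a Levi subgroup of `P`: an algebraic subgroup such that `P` is the semidirect product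
of `L` and the unipotent radical of `P`. -/
def IsLevi (P L : Subgroup (GL ι ℂ)) : Prop :=
  L ≤ P ∧ IsAlgebraic L ∧ L ⊓ unipotentRadical P = ⊥ ∧ L ⊔ unipotentRadical P = P

/-- The center of `L`, as a subgroup of `GL_ι(ℂ)`. -/
def centerOf (L : Subgroup (GL ι ℂ)) : Subgroup (GL ι ℂ) :=
  L ⊓ Subgroup.centralizer (L : Set (GL ι ℂ))

/-- The identity component of the center of `L`. -/
noncomputable def Z (L : Subgroup (GL ι ℂ)) : Subgroup (GL ι ℂ) :=
  (Subgroup.connectedComponentOfOne (centerOf L)).map (centerOf L).subtype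

/-- The weight space `𝔤_χ` of the Lie algebra of `G` for the adjoint action of `Z(L)°`.  A
homomorphism `χ` whose weight space is non-zero is automatically algebraic. -/
def weightSpace (G L : Subgroup (GL ι ℂ)) (χ : Z L →* ℂˣ) : Set (Matrix ι ι ℂ) :=
  {X | X ∈ lieAlg G ∧ ∀ z : Z L, Ad (z : GL ι ℂ) X = ((χ z : ℂˣ) : ℂ) • X}

/-- The positive weights: the weights of `Z(L)°` on the Lie algebra `𝔫` of the unipotent radical
of `P`, i.e. the `χ` with `0 ≠ 𝔤_χ ⊆ 𝔫`. -/
def PosWeight (G P L : Subgroup (GL ι ℂ)) : Type :=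
  {χ : Z L →* ℂˣ // (∃ X ∈ weightSpace G L χ, X ≠ 0) ∧
    weightSpace G L χ ⊆ lieAlg (unipotentRadical P)}

/-- `K` is a compact real form of the connected complex algebraic group `L`: a compact subgroup
whose Lie algebra `𝔨` satisfies `𝔩 = 𝔨 ⊕ i𝔨`. -/
def IsCompactRealForm (L K : Subgroup (GL ι ℂ)) : Prop :=
  K ≤ L ∧ IsCompact (K : Set (GL ι ℂ)) ∧
    ∀ X ∈ lieAlg L, ∃! Y : Matrix ι ι ℂ × Matrix ι ι ℂ,
      Y.1 ∈ lieAlg K ∧ Y.2 ∈ lieAlg K ∧ X = Y.1 + Complex.I • Y.2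

/-- `𝔰𝔩₂`-triples `⟨e, h, f⟩` of possibly zero matrices. -/
def IsSl2 (e h f : Matrix ι ι ℂ) : Prop :=
  e * f - f * e = h ∧ h * e - e * h = (2 : ℂ) • e ∧ h * f - f * h = (-2 : ℂ) • f

/-- The collection `c` of homogeneous components `c χ ∈ 𝔤_χ`, `χ > 0`, admits a Hermitian multiple
characteristic: each `c χ` lies in a homogeneous `𝔰𝔩₂`-triple `⟨c χ, h χ, f χ⟩` with
`f χ ∈ 𝔤_{-χ}` and `h χ ∈ 𝔩 ∩ i𝔨`. -/
def HasHermitianMultipleCharacteristic (G P L K : Subgroup (GL ι ℂ))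
    (c : PosWeight G P L →₀ Matrix ι ι ℂ) : Prop :=
  ∃ h f : PosWeight G P L → Matrix ι ι ℂ, ∀ χ,
    IsSl2 (c χ) (h χ) (f χ) ∧ f χ ∈ weightSpace G L χ.1⁻¹ ∧ h χ ∈ lieAlg L ∧
      ∃ Y ∈ lieAlg K, h χ = Complex.I • Y

/-- The coadjoint case for a Levi subgroup `L` of `P` and a compact real form `K` of `L`: every
`e ∈ 𝔫` has an `L`-conjugate `∑_{χ > 0} c χ`, `c χ ∈ 𝔤_χ`, that admits a Hermitian multiple
characteristic. -/
def CoadjointCase (G P L K : Subgroup (GL ι ℂ)) : Prop :=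
  ∀ e ∈ lieAlg (unipotentRadical P), ∃ g ∈ L, ∃ c : PosWeight G P L →₀ Matrix ι ι ℂ,
    (∀ χ, c χ ∈ weightSpace G L χ.1) ∧
    Ad g e = c.sum (fun _ x => x) ∧
    HasHermitianMultipleCharacteristic G P L K c

/-- The adjoint case: here `Q` is the opposite parabolic subgroup `P⁻` and an element of `𝔤/𝔭⁻` is
given by a representative `x ∈ 𝔤`; under the identification `𝔤/𝔭⁻ = ⨁_{χ > 0} 𝔤_χ` the components
of the class of `x` are the `c χ ∈ 𝔤_χ` with `x ≡ ∑_{χ > 0} c χ` modulo `𝔭⁻`. -/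
def AdjointCase (G P Q L K : Subgroup (GL ι ℂ)) : Prop :=
  ∀ x ∈ lieAlg G, ∃ g ∈ L, ∃ c : PosWeight G P L →₀ Matrix ι ι ℂ,
    (∀ χ, c χ ∈ weightSpace G L χ.1) ∧
    Ad g x - c.sum (fun _ x => x) ∈ lieAlg Q ∧
    HasHermitianMultipleCharacteristic G P L K c

/-- The parabolic subgroup `P` of `G` is weakly ample: for every Levi subgroup `L` of `P` and
every compact real form `K` of `L`, each `e ∈ 𝔫` and each `e ∈ 𝔤/𝔭⁻`, where `P⁻` is the parabolic
subgroup opposite to `P` with `P ∩ P⁻ = L`, can be conjugated by an element of `L` to one that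
admits a Hermitian multiple characteristic. -/
def IsWeaklyAmple (G P : Subgroup (GL ι ℂ)) : Prop :=
  ∀ L K : Subgroup (GL ι ℂ), IsLevi P L → IsCompactRealForm L K →
    CoadjointCase G P L K ∧
    ∀ Q : Subgroup (GL ι ℂ), IsParabolic G Q → P ⊓ Q = L → AdjointCase G P Q L K

end Groups

end HermChar

namespace HermChar

open Matrix

attribute [local instance] LieRing.ofAssociativeRing

/-! Both groups are the determinant one isometries of a non-degenerate form with Gram matrix `S`,
symmetric or alternating, and their Lie algebra is `skew S`. Given L and its compact form K,
averaging over K followed by a correction produces a Hermitian inner product for which K is unitary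
and whose adjoint `dag R` (written x†) commutes with the adjoint `adj S` of the bilinear form
(`exists_isCompatible`). An element of 𝔩 then lies in i𝔨 as soon as it is self-adjoint, so the task
is to find homogeneous triples with self-adjoint neutral element.

Structure of P. By Lie's theorem a Borel subalgebra is the stabilizer of an isotropic flag, so its
orthogonal complement for the trace form lies inside it and is nilpotent
(`mem_and_isNilpotent_of_orthogonal`). This passes to 𝔭, with complement 𝔫. The functional x ↦ tr(ad
x | 𝔫) is represented by a self-adjoint H, which is positive on 𝔫 and central in 𝔭 ∩ 𝔭†
(`exists_rho`, `exists_isGrading`). Let V_c be the eigenspaces of H. Then 𝔭 consists of the skew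
matrices that do not lower the eigenvalue, 𝔫 of those that strictly raise it, the unipotent radical
of the block unitriangular isometries (`unipotentRadical_eq`), and L is the centralizer of H
(`eq_leviGroup`). If H is chosen with the smallest possible kernel (`exists_generic`), then Z acts
trivially on V_0; on every other V_c it acts by a character ζ c, with ζ (-c) = (ζ c)⁻¹. The weights
have the form ζ a / ζ b, and a vector of such a weight has only the blocks V_b → V_a and V_{-a} →
V_{-b} (`characters_injective`).

Triples. If a and b are non-zero, the homogeneous element squares to zero. Its Moore–Penrose inverse
completes it to a triple, and the neutral element is a difference of two orthogonal projections. The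
other weights give chains V_{-c} → V_0 → V_c, whose square can be non-zero. Here the freedom to
conjugate by L is used: the groups GL(V_c) for distinct c > 0 act independently, so by polar
decomposition all blocks V_0 → V_c of e become partial isometries at once
(`exists_partial_isometry`). For such chains an explicit formula gives a triple with self-adjoint
neutral element (`StringRelations.sl2_identities`).

The adjoint case reduces to the coadjoint one, because 𝔤 is the sum of 𝔫 and the Lie algebra of the
opposite parabolic (`mem_nilrad_sup_opposite`). -/

section General

variable {ι : Type} [Fintype ι] [DecidableEq ι]

/-! ### Adjoints for a Hermitian inner product -/

/-- The adjoint of a matrix for the Hermitian inner product `⟨R v, R w⟩`. -/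
noncomputable def dag (R : (Matrix ι ι ℂ)ˣ) : Matrix ι ι ℂ →ₛₗ[starRingEnd ℂ] Matrix ι ι ℂ where
  toFun x := (↑R⁻¹ : Matrix ι ι ℂ) * ((R : Matrix ι ι ℂ) * x * (↑R⁻¹ : Matrix ι ι ℂ))ᴴ * R
  map_add' x y := by simp [mul_add, add_mul]
  map_smul' c x := by simp

theorem dag_def (R : (Matrix ι ι ℂ)ˣ) (x : Matrix ι ι ℂ) :
    dag R x = (↑R⁻¹ : Matrix ι ι ℂ) * ((R : Matrix ι ι ℂ) * x * (↑R⁻¹ : Matrix ι ι ℂ))ᴴ * R := rfl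

theorem conj_dag (R : (Matrix ι ι ℂ)ˣ) (x : Matrix ι ι ℂ) :
    (R : Matrix ι ι ℂ) * dag R x * (↑R⁻¹ : Matrix ι ι ℂ) =
      ((R : Matrix ι ι ℂ) * x * (↑R⁻¹ : Matrix ι ι ℂ))ᴴ := by
  simp only [dag_def, Matrix.mul_assoc, Units.mul_inv, Matrix.mul_one]
  simp only [← Matrix.mul_assoc, Units.mul_inv, Matrix.one_mul]

theorem dag_mul (R : (Matrix ι ι ℂ)ˣ) (x y : Matrix ι ι ℂ) :
    dag R (x * y) = dag R y * dag R x := by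
  have : (R : Matrix ι ι ℂ) * (x * y) * (↑R⁻¹ : Matrix ι ι ℂ) =
      ((R : Matrix ι ι ℂ) * x * (↑R⁻¹ : Matrix ι ι ℂ)) *
        ((R : Matrix ι ι ℂ) * y * (↑R⁻¹ : Matrix ι ι ℂ)) := by
    simp [Matrix.mul_assoc]
  rw [dag_def, this, conjTranspose_mul, dag_def, dag_def]
  simp [Matrix.mul_assoc]

@[simp] theorem dag_dag (R : (Matrix ι ι ℂ)ˣ) (x : Matrix ι ι ℂ) : dag R (dag R x) = x := by
  rw [dag_def, conj_dag, conjTranspose_conjTranspose]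
  simp [Matrix.mul_assoc]

@[simp] theorem dag_one (R : (Matrix ι ι ℂ)ˣ) : dag R 1 = 1 := by
  simp [dag_def]

theorem trace_dag (R : (Matrix ι ι ℂ)ˣ) (x : Matrix ι ι ℂ) :
    (dag R x).trace = star x.trace := by
  rw [dag_def, Matrix.trace_mul_comm, ← Matrix.mul_assoc, Units.mul_inv, Matrix.one_mul,
    trace_conjTranspose, Matrix.trace_mul_comm, ← Matrix.mul_assoc, Units.inv_mul, Matrix.one_mul]

/-- The trace is the squared Frobenius norm of R x R⁻¹. Thus x ↦ x† is a positive involution, and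
this positivity underlies the vanishing arguments below. -/
theorem trace_dag_mul_self (R : (Matrix ι ι ℂ)ˣ) (x : Matrix ι ι ℂ) :
    (dag R x * x).trace =
      ((∑ i, ∑ j, ‖((R : Matrix ι ι ℂ) * x * (↑R⁻¹ : Matrix ι ι ℂ)) i j‖ ^ 2 : ℝ) : ℂ) := by
  have h : (dag R x * x).trace = (((R : Matrix ι ι ℂ) * x * (↑R⁻¹ : Matrix ι ι ℂ))ᴴ *
      ((R : Matrix ι ι ℂ) * x * (↑R⁻¹ : Matrix ι ι ℂ))).trace := by
    rw [dag_def, Matrix.mul_assoc, Matrix.mul_assoc, Matrix.trace_mul_comm]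
    simp only [Matrix.mul_assoc]
  rw [h, Matrix.trace]
  simp only [Matrix.diag_apply, Matrix.mul_apply (M := _ᴴ), conjTranspose_apply]
  rw [Finset.sum_comm]
  push_cast
  refine Finset.sum_congr rfl fun i _ => Finset.sum_congr rfl fun j _ => ?_
  rw [mul_comm, Complex.star_def, Complex.mul_conj, Complex.normSq_eq_norm_sq]
  push_cast
  rfl

theorem trace_dag_mul_self_re_nonneg (R : (Matrix ι ι ℂ)ˣ) (x : Matrix ι ι ℂ) :
    0 ≤ (dag R x * x).trace.re := by
  rw [trace_dag_mul_self, Complex.ofReal_re]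
  positivity

theorem eq_zero_of_trace_dag_mul_self_re (R : (Matrix ι ι ℂ)ˣ) {x : Matrix ι ι ℂ}
    (h : (dag R x * x).trace.re = 0) : x = 0 := by
  rw [trace_dag_mul_self, Complex.ofReal_re] at h
  have h2 : (R : Matrix ι ι ℂ) * x * (↑R⁻¹ : Matrix ι ι ℂ) = 0 := by
    ext i j
    have h3 := (Finset.sum_eq_zero_iff_of_nonneg (fun i _ => by positivity)).1 h i (by simp)
    have h4 := (Finset.sum_eq_zero_iff_of_nonneg (fun i _ => by positivity)).1 h3 j (by simp)
    simpa using h4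
  calc x = (↑R⁻¹ : Matrix ι ι ℂ) * ((R : Matrix ι ι ℂ) * x * (↑R⁻¹ : Matrix ι ι ℂ)) * R := by
        simp [Matrix.mul_assoc]
    _ = 0 := by rw [h2]; simp

theorem trace_dag_mul_self_re_pos (R : (Matrix ι ι ℂ)ˣ) {x : Matrix ι ι ℂ} (hx : x ≠ 0) :
    0 < (dag R x * x).trace.re :=
  lt_of_le_of_ne (trace_dag_mul_self_re_nonneg R x)
    fun h => hx (eq_zero_of_trace_dag_mul_self_re R h.symm)

theorem eq_zero_of_dag_mul_self (R : (Matrix ι ι ℂ)ˣ) {x : Matrix ι ι ℂ}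
    (h : dag R x * x = 0) : x = 0 :=
  eq_zero_of_trace_dag_mul_self_re R (by simp [h])

theorem eq_zero_of_mul_dag_mul_self (R : (Matrix ι ι ℂ)ˣ) {x y : Matrix ι ι ℂ}
    (h : dag R x * x * y = 0) : x * y = 0 := by
  apply eq_zero_of_dag_mul_self R
  rw [dag_mul, Matrix.mul_assoc, ← Matrix.mul_assoc (dag R x), h, Matrix.mul_zero]

/-- A self-adjoint x satisfies x^(k+2) = x† x · x^k, so `eq_zero_of_mul_dag_mul_self` lowers the
vanishing exponent step by step. -/
theorem eq_zero_of_isNilpotent_of_dag_eq (R : (Matrix ι ι ℂ)ˣ) {x : Matrix ι ι ℂ}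
    (h : IsNilpotent x) (hx : dag R x = x) : x = 0 := by
  have step : ∀ k : ℕ, x ^ (k + 2) = 0 → x ^ (k + 1) = 0 := by
    intro k hk
    have := eq_zero_of_mul_dag_mul_self R (x := x) (y := x ^ k) (by
      rw [hx, ← hk, pow_succ', pow_succ', Matrix.mul_assoc])
    rw [pow_succ', this]
  obtain ⟨n, hn⟩ := h
  have : ∀ n : ℕ, x ^ (n + 1) = 0 → x = 0 := by
    intro n
    induction n with
    | zero => intro h; simpa using h
    | succ k ih => intro h; exact ih (step k h)
  exact this n (by rw [pow_succ, hn, Matrix.zero_mul])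

/-- A matrix that is self-adjoint for `dag R` is diagonalizable in an orthonormal basis. -/
theorem exists_diagonalization (R : (Matrix ι ι ℂ)ˣ) {x : Matrix ι ι ℂ} (hx : dag R x = x) :
    ∃ (W : (Matrix ι ι ℂ)ˣ) (μ : ι → ℝ),
      x = (W : Matrix ι ι ℂ) * diagonal (fun i => (μ i : ℂ)) * (↑W⁻¹ : Matrix ι ι ℂ) ∧
      ∀ ν : ι → ℂ, dag R ((W : Matrix ι ι ℂ) * diagonal ν * (↑W⁻¹ : Matrix ι ι ℂ)) =
        (W : Matrix ι ι ℂ) * diagonal (star ν) * (↑W⁻¹ : Matrix ι ι ℂ) := by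
  have hH : ((R : Matrix ι ι ℂ) * x * (↑R⁻¹ : Matrix ι ι ℂ)).IsHermitian := by
    rw [Matrix.IsHermitian, ← conj_dag, hx]
  let U : (Matrix ι ι ℂ)ˣ := Unitary.toUnits hH.eigenvectorUnitary
  have hU : (↑U⁻¹ : Matrix ι ι ℂ) = (U : Matrix ι ι ℂ)ᴴ := rfl
  have hs : (R : Matrix ι ι ℂ) * x * (↑R⁻¹ : Matrix ι ι ℂ) =
      (U : Matrix ι ι ℂ) * diagonal (fun i => (hH.eigenvalues i : ℂ)) * (↑U⁻¹ : Matrix ι ι ℂ) := by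
    have := hH.spectral_theorem
    rw [Unitary.conjStarAlgAut_apply] at this
    exact this
  obtain ⟨μ, hs⟩ : ∃ μ : ι → ℝ, (R : Matrix ι ι ℂ) * x * (↑R⁻¹ : Matrix ι ι ℂ) =
      (U : Matrix ι ι ℂ) * diagonal (fun i => (μ i : ℂ)) * (↑U⁻¹ : Matrix ι ι ℂ) := ⟨_, hs⟩
  -- Conjugation by R turns `dag R` into the conjugate transpose; the unitary eigenbasis found there
  -- is pulled back by R⁻¹.
  refine ⟨R⁻¹ * U, μ, ?_, fun ν => ?_⟩
  · calc x = (↑R⁻¹ : Matrix ι ι ℂ) * ((R : Matrix ι ι ℂ) * x * (↑R⁻¹ : Matrix ι ι ℂ)) * R := by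
          simp [Matrix.mul_assoc]
      _ = _ := by rw [hs]; simp [Matrix.mul_assoc]
  · have : (R : Matrix ι ι ℂ) * (((R⁻¹ * U : (Matrix ι ι ℂ)ˣ) : Matrix ι ι ℂ) * diagonal ν *
        (↑(R⁻¹ * U)⁻¹ : Matrix ι ι ℂ)) * (↑R⁻¹ : Matrix ι ι ℂ) =
        (U : Matrix ι ι ℂ) * diagonal ν * (↑U⁻¹ : Matrix ι ι ℂ) := by
      simp [Matrix.mul_assoc]
    rw [dag_def, this, hU]
    simp only [conjTranspose_mul, conjTranspose_conjTranspose, diagonal_conjTranspose,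
      _root_.mul_inv_rev, inv_inv, Units.val_mul, hU, Matrix.mul_assoc]

theorem conj_diagonal_mul (W : (Matrix ι ι ℂ)ˣ) (μ ν : ι → ℂ) :
    ((W : Matrix ι ι ℂ) * diagonal μ * (↑W⁻¹ : Matrix ι ι ℂ)) *
      ((W : Matrix ι ι ℂ) * diagonal ν * (↑W⁻¹ : Matrix ι ι ℂ)) =
      (W : Matrix ι ι ℂ) * diagonal (fun i => μ i * ν i) * (↑W⁻¹ : Matrix ι ι ℂ) := by
  rw [← diagonal_mul_diagonal]
  simp only [Matrix.mul_assoc, Units.inv_mul_cancel_left]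

/-! ### Moore–Penrose inverses and elements of square zero -/

/-- `y` is the Moore–Penrose inverse of `x`. -/
def IsMoorePenrose (R : (Matrix ι ι ℂ)ˣ) (x y : Matrix ι ι ℂ) : Prop :=
  x * y * x = x ∧ y * x * y = y ∧ dag R (x * y) = x * y ∧ dag R (y * x) = y * x

theorem exists_isMoorePenrose (R : (Matrix ι ι ℂ)ˣ) (x : Matrix ι ι ℂ) :
    ∃ y, IsMoorePenrose R x y := by
  have hA : dag R (dag R x * x) = dag R x * x := by rw [dag_mul, dag_dag]
  obtain ⟨W, μ, hW, hν⟩ := exists_diagonalization R hA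
  -- This is the pseudo-inverse of x† x: non-zero eigenvalues are inverted, and the convention `0⁻¹
  -- = 0` preserves the kernel. The Moore–Penrose inverse of x is then B x†.
  set B : Matrix ι ι ℂ := W * diagonal (fun i => ((μ i : ℂ))⁻¹) * (↑W⁻¹ : Matrix ι ι ℂ) with hB
  have hBd : dag R B = B := by
    rw [hB, hν]
    congr 3
    ext i
    simp
  have h1 : dag R x * x * (1 - B * (dag R x * x)) = 0 := by
    rw [mul_sub, Matrix.mul_one, hW, hB, ← Matrix.mul_assoc, conj_diagonal_mul, conj_diagonal_mul,
      ← Matrix.sub_mul, ← Matrix.mul_sub, diagonal_sub]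
    simp
  have h1' : B * (dag R x * x) * B = B := by
    rw [hW, hB, conj_diagonal_mul, conj_diagonal_mul]
    congr 3
    ext i
    by_cases h : (μ i : ℂ) = 0 <;> simp [h]
  have h2 : x * B * (dag R x * x) = x := by
    have := eq_zero_of_mul_dag_mul_self R h1
    rw [mul_sub, Matrix.mul_one, sub_eq_zero] at this
    rw [Matrix.mul_assoc]
    exact this.symm
  have h3 : B * (dag R x * x) = (dag R x * x) * B := by
    rw [hW, hB, conj_diagonal_mul, conj_diagonal_mul]
    simp only [mul_comm]
  refine ⟨B * dag R x, ?_, ?_, ?_, ?_⟩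
  · simpa only [Matrix.mul_assoc] using h2
  · calc B * dag R x * x * (B * dag R x) = B * (dag R x * x) * B * dag R x := by
          simp only [Matrix.mul_assoc]
      _ = _ := by rw [h1']
  · simp only [dag_mul, dag_dag, hBd, Matrix.mul_assoc]
  · rw [Matrix.mul_assoc, dag_mul, hA, hBd, h3]

/-- Uniqueness transfers symmetries from a matrix to its Moore–Penrose inverse; in particular the
inverse of a skew matrix is skew. -/
theorem IsMoorePenrose.unique {R : (Matrix ι ι ℂ)ˣ} {x y z : Matrix ι ι ℂ}
    (hy : IsMoorePenrose R x y) (hz : IsMoorePenrose R x z) : y = z := by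
  obtain ⟨h1, h2, h3, h4⟩ := hy
  obtain ⟨k1, k2, k3, k4⟩ := hz
  have e1 : x * y = x * z := by
    calc x * y = dag R (x * y) := h3.symm
      _ = dag R (x * z * (x * y)) := by rw [← Matrix.mul_assoc, k1]
      _ = x * y * (x * z) := by rw [dag_mul, h3, k3]
      _ = x * z := by rw [← Matrix.mul_assoc, h1]
  have e2 : y * x = z * x := by
    calc y * x = dag R (y * x) := h4.symm
      _ = dag R (y * x * (z * x)) := by rw [Matrix.mul_assoc, ← Matrix.mul_assoc x, k1]
      _ = z * x * (y * x) := by rw [dag_mul, h4, k4]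
      _ = z * x := by rw [Matrix.mul_assoc, ← Matrix.mul_assoc x, h1]
  calc y = y * x * y := h2.symm
    _ = z * (x * y) := by rw [e2, Matrix.mul_assoc]
    _ = z := by rw [e1, ← Matrix.mul_assoc, k2]

/-- Since yx and xy are self-adjoint, y = (yx)† y = y (xy)†. Having x† as a left and as a right
factor, y inherits the supporting blocks and the vanishing square of x†. -/
theorem IsMoorePenrose.factor_dag {R : (Matrix ι ι ℂ)ˣ} {x y : Matrix ι ι ℂ}
    (h : IsMoorePenrose R x y) :
    y = dag R x * (dag R y * y) ∧ y = y * dag R y * dag R x := by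
  obtain ⟨h1, h2, h3, h4⟩ := h
  constructor
  · rw [← Matrix.mul_assoc, ← dag_mul, h4, h2]
  · rw [Matrix.mul_assoc, ← dag_mul, h3, ← Matrix.mul_assoc, h2]

/-- A finite orthonormal basis, for `tr (x† y)`, of a space of matrices. -/
theorem exists_orthonormal_family (R : (Matrix ι ι ℂ)ˣ) (N : Submodule ℂ (Matrix ι ι ℂ)) :
    ∃ (d : ℕ) (b : Module.Basis (Fin d) ℂ N), ∀ i j,
      (dag R (b i : Matrix ι ι ℂ) * (b j : Matrix ι ι ℂ)).trace = if i = j then 1 else 0 := by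
  -- Conjugation by R carries tr(x† y) to the standard inner product of matrix entries.
  let e : Matrix ι ι ℂ ≃ₗ[ℂ] EuclideanSpace ℂ (ι × ι) :=
    { toFun := fun x => WithLp.toLp 2 fun ij =>
        ((R : Matrix ι ι ℂ) * x * (↑R⁻¹ : Matrix ι ι ℂ)) ij.1 ij.2
      map_add' := fun x y => by ext; simp [mul_add, add_mul]
      map_smul' := fun c x => by ext; simp
      invFun := fun v => (↑R⁻¹ : Matrix ι ι ℂ) * Matrix.of (fun i j => v (i, j)) * R
      left_inv := fun x => by
        change (↑R⁻¹ : Matrix ι ι ℂ) * ((R : Matrix ι ι ℂ) * x * (↑R⁻¹ : Matrix ι ι ℂ)) * R = x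
        simp [Matrix.mul_assoc]
      right_inv := fun v => by
        ext ⟨i, j⟩
        change ((R : Matrix ι ι ℂ) * ((↑R⁻¹ : Matrix ι ι ℂ) *
          Matrix.of (fun i j => v (i, j)) * R) * (↑R⁻¹ : Matrix ι ι ℂ)) i j = _
        have : (R : Matrix ι ι ℂ) * ((↑R⁻¹ : Matrix ι ι ℂ) *
          Matrix.of (fun i j => v (i, j)) * R) * (↑R⁻¹ : Matrix ι ι ℂ) =
          Matrix.of (fun i j => v (i, j)) := by
            simp only [← Matrix.mul_assoc, Units.mul_inv, Matrix.one_mul]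
            simp [Matrix.mul_assoc]
        rw [this]
        rfl }
  have hin : ∀ x y, inner ℂ (e x) (e y) = (dag R x * y).trace := by
    intro x y
    have h : (dag R x * y).trace = (((R : Matrix ι ι ℂ) * x * (↑R⁻¹ : Matrix ι ι ℂ))ᴴ *
        ((R : Matrix ι ι ℂ) * y * (↑R⁻¹ : Matrix ι ι ℂ))).trace := by
      rw [dag_def, Matrix.mul_assoc, Matrix.mul_assoc, Matrix.trace_mul_comm]
      simp only [Matrix.mul_assoc]
    rw [h, PiLp.inner_apply, Fintype.sum_prod_type, Finset.sum_comm, Matrix.trace]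
    refine Finset.sum_congr rfl fun j _ => ?_
    rw [Matrix.diag_apply, Matrix.mul_apply]
    refine Finset.sum_congr rfl fun i _ => ?_
    rw [conjTranspose_apply, RCLike.inner_apply, mul_comm]
    rfl
  let N' := N.map (e : Matrix ι ι ℂ →ₗ[ℂ] EuclideanSpace ℂ (ι × ι))
  let b' := stdOrthonormalBasis ℂ N'
  let f : N ≃ₗ[ℂ] N' := e.submoduleMap N
  refine ⟨_, b'.toBasis.map f.symm, fun i j => ?_⟩
  rw [← hin]
  have hb : ∀ i, e ((b'.toBasis.map f.symm i : N) : Matrix ι ι ℂ) = (b' i : EuclideanSpace ℂ _) := by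
    intro i
    have : f (b'.toBasis.map f.symm i) = b' i := by simp
    rw [← this]
    rfl
  rw [hb, hb]
  have := orthonormal_iff_ite.1 b'.orthonormal i j
  simpa using this

theorem IsMoorePenrose.mul_self_eq_zero {R : (Matrix ι ι ℂ)ˣ} {x y : Matrix ι ι ℂ}
    (h : IsMoorePenrose R x y) (hx : x * x = 0) : y * y = 0 := by
  obtain ⟨h1, h2⟩ := h.factor_dag
  have h3 : dag R x * dag R x = 0 := by rw [← dag_mul, hx, map_zero]
  have : y * y = y * dag R y * (dag R x * dag R x) * (dag R y * y) := by
    calc y * y = (y * dag R y * dag R x) * (dag R x * (dag R y * y)) := by rw [← h1, ← h2]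
      _ = _ := by simp only [Matrix.mul_assoc]
  rw [this, h3, Matrix.mul_zero, Matrix.zero_mul]

/-- When x² = 0 also y² = 0, so xy and yx are orthogonal projections annihilating each other. Their
difference is 1 on the image of x and -1 on the image of y. -/
theorem IsMoorePenrose.isSl2 {R : (Matrix ι ι ℂ)ˣ} {x y : Matrix ι ι ℂ}
    (h : IsMoorePenrose R x y) (hx : x * x = 0) :
    IsSl2 x (x * y - y * x) y ∧ dag R (x * y - y * x) = x * y - y * x := by
  have hy := h.mul_self_eq_zero hx
  obtain ⟨h1, h2, h3, h4⟩ := h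
  refine ⟨⟨rfl, ?_, ?_⟩, by rw [map_sub, h3, h4]⟩
  · have e1 : x * (x * y - y * x) = - x := by
      rw [mul_sub, ← Matrix.mul_assoc, hx, ← Matrix.mul_assoc, h1]; simp
    have e2 : (x * y - y * x) * x = x := by
      rw [sub_mul, h1, Matrix.mul_assoc, hx]; simp
    rw [e1, e2, two_smul, sub_neg_eq_add]
  · have e1 : y * (x * y - y * x) = y := by
      rw [mul_sub, ← Matrix.mul_assoc, h2, ← Matrix.mul_assoc, hy]; simp
    have e2 : (x * y - y * x) * y = - y := by
      rw [sub_mul, h2, Matrix.mul_assoc, hy]; simp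
    rw [e1, e2, neg_smul, two_smul]
    abel

/-! ### Triples for chains of two partial isometries -/

/-- The relations between the blocks `a : V₀ → V₁`, `b : V₋₁ → V₀`, their adjoints `a'`, `b'` and
the Moore–Penrose inverse `w` of `a * b`, for partial isometries `a` and `b`. -/
structure StringRelations {A : Type*} [Ring A] (a b a' b' w : A) : Prop where
  aa : a * a = 0
  bb : b * b = 0
  ba : b * a = 0
  ab' : a * b' = 0
  ba' : b * a' = 0
  a'b' : a' * b' = 0
  a'b : a' * b = 0
  b'a : b' * a = 0
  a'a' : a' * a' = 0
  b'b' : b' * b' = 0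
  ww : w * w = 0
  aw : a * w = 0
  wb : w * b = 0
  wa' : w * a' = 0
  wb' : w * b' = 0
  a'w : a' * w = 0
  b'w : b' * w = 0
  aa'a : a * a' * a = a
  a'aa' : a' * a * a' = a'
  bb'b : b * b' * b = b
  b'bb' : b' * b * b' = b'
  abwab : a * b * w * a * b = a * b
  wabw : w * a * b * w = w
  b'bw : b' * b * w = w
  waa' : w * a * a' = w
  wabb'a' : w * a * b * b' * a' = b' * a'
  b'a'abw : b' * a' * a * b * w = b' * a'

/-- The chain V₋₁ → V₀ → V₁ splits into strings. On those with ab ≠ 0 the neutral element has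
eigenvalues 2, 0, -2, and the lowering maps are 2bw and 2wa. On strings of length two, seen by a
alone or b alone, the eigenvalues are 1, -1 and the lowering map is a' or b'. The corrections a' a b
w and w a b b' remove the long strings from a' and b'. -/
theorem StringRelations.sl2_identities {A : Type*} [Ring A] {a b a' b' w : A}
    (r : StringRelations a b a' b' w) (f h : A)
    (hf : f = b' - w * a * b * b' + (w * a + w * a) + (a' - a' * a * b * w) + (b * w + b * w))
    (hh : h = a * a' + a * b * w - (b' * b + w * a * b) + b * b' - b * w * a * b * b' -
      a' * a + a' * a * b * w * a) :
    (a + b) * f - f * (a + b) = h ∧ h * (a + b) - (a + b) * h = (a + b) + (a + b) ∧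
      h * f - f * h = -(f + f) := by
  obtain ⟨aa, bb, ba, ab', ba', a'b', a'b, b'a, a'a', b'b', ww, aw, wb, wa', wb', a'w, b'w, aa'a,
    a'aa', bb'b, b'bb', abwab, wabw, b'bw, waa', wabb'a', b'a'abw⟩ := r
  -- Each relation is put in right-associated form, both alone and followed by an arbitrary factor
  -- z, so that rewriting applies anywhere inside a word.
  have t0 : ∀ {p q : A}, p * q = 0 → ∀ z, p * (q * z) = 0 := fun {p q} h z => by
    rw [← mul_assoc, h, zero_mul]
  have t3 : ∀ {p q s u : A}, p * q * s = u → ∀ z, p * (q * (s * z)) = u * z :=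
    fun {p q s u} h z => by rw [← h]; simp only [mul_assoc]
  have s3 : ∀ {p q s u : A}, p * q * s = u → p * (q * s) = u :=
    fun {p q s u} h => by rw [← h]; simp only [mul_assoc]
  have s4 : ∀ {p q s v u : A}, p * q * s * v = u → p * (q * (s * v)) = u :=
    fun {p q s v u} h => by rw [← h]; simp only [mul_assoc]
  have t4 : ∀ {p q s v u : A}, p * q * s * v = u → ∀ z, p * (q * (s * (v * z))) = u * z :=
    fun {p q s v u} h z => by rw [← h]; simp only [mul_assoc]
  have s5 : ∀ {p q s v v' u : A}, p * q * s * v * v' = u → p * (q * (s * (v * v'))) = u :=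
    fun {p q s v v' u} h => by rw [← h]; simp only [mul_assoc]
  have t5 : ∀ {p q s v v' u : A}, p * q * s * v * v' = u →
      ∀ z, p * (q * (s * (v * (v' * z)))) = u * z :=
    fun {p q s v v' u} h z => by rw [← h]; simp only [mul_assoc]
  subst hf hh
  refine ⟨?_, ?_, ?_⟩ <;>
  simp only [mul_add, add_mul, mul_sub, sub_mul, mul_assoc, aa, bb, ba, ab', ba', a'b', a'b, b'a,
    a'a', b'b', wb, wa', wb', t0 aa, t0 bb, t0 ba, t0 ab', t0 ba', t0 a'b',
    t0 a'b, t0 b'a, t0 a'a', t0 b'b', t0 ww, t0 aw, t0 wb, t0 wa', t0 wb', t0 a'w, t0 b'w,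
    s3 aa'a, s3 a'aa', s3 bb'b, s3 b'bb', s3 b'bw, s3 waa', t3 aa'a, t3 b'bw, s4 wabw, t4 wabw, s5 abwab, t5 abwab, s5 wabb'a', t5 wabb'a', s5 b'a'abw,
    t5 b'a'abw, mul_zero, add_zero, zero_add, sub_zero] <;> abel
/-- The orthogonality relations between idempotents `pc`, `p0`, `pm` that are shared by the
blocks of a homogeneous element of weight `ε_c`. -/
theorem exists_isSl2_of_partial_isometry {R : (Matrix ι ι ℂ)ˣ} {pc p0 pm a b : Matrix ι ι ℂ}
    (hcd : dag R pc = pc) (h0d : dag R p0 = p0) (hmd : dag R pm = pm)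
    (hc0 : pc * p0 = 0) (hcm : pc * pm = 0) (h0c : p0 * pc = 0) (h0m : p0 * pm = 0)
    (hmc : pm * pc = 0) (hm0 : pm * p0 = 0)
    (ha1 : pc * a = a) (ha2 : a * p0 = a) (hb1 : p0 * b = b) (hb2 : b * pm = b)
    (ha : a * dag R a * a = a) (hb : b * dag R b * b = b) :
    ∃ w h f : Matrix ι ι ℂ, IsMoorePenrose R (a * b) w ∧
      f = dag R b - w * a * b * dag R b + (w * a + w * a) +
        (dag R a - dag R a * a * b * w) + (b * w + b * w) ∧
      IsSl2 (a + b) h f ∧ dag R h = h ∧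
      h = a * dag R a + a * b * w - (dag R b * b + w * a * b) + b * dag R b -
        b * w * a * b * dag R b - dag R a * a + dag R a * a * b * w * a ∧
      pm * w = w ∧ w * pc = w := by
  obtain ⟨w, hw⟩ := exists_isMoorePenrose R (a * b)
  obtain ⟨w1, w2⟩ := hw.factor_dag
  obtain ⟨m1, m2, m3, m4⟩ := hw
  have ha1' : dag R a * pc = dag R a := by rw [← hcd, ← dag_mul, ha1]
  have ha2' : p0 * dag R a = dag R a := by rw [← h0d, ← dag_mul, ha2]
  have hb1' : dag R b * p0 = dag R b := by rw [← h0d, ← dag_mul, hb1]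
  have hb2' : pm * dag R b = dag R b := by rw [← hmd, ← dag_mul, hb2]
  have hw1 : pm * w = w := by
    rw [w1, dag_mul, Matrix.mul_assoc, ← Matrix.mul_assoc, hb2']
  have hw2 : w * pc = w := by
    rw [w2, dag_mul, Matrix.mul_assoc, Matrix.mul_assoc (dag R b), ha1']
  have zero : ∀ {x p q y : Matrix ι ι ℂ}, x * p = x → q * y = y → p * q = 0 → x * y = 0 := by
    intro x p q y h1 h2 h3
    rw [← h1, ← h2, Matrix.mul_assoc, ← Matrix.mul_assoc p, h3, Matrix.zero_mul, Matrix.mul_zero]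
  have hda : dag R a * a * dag R a = dag R a := by
    have := congrArg (dag R) ha
    simpa only [dag_mul, dag_dag, ← Matrix.mul_assoc] using this
  have hdb : dag R b * b * dag R b = dag R b := by
    have := congrArg (dag R) hb
    simpa only [dag_mul, dag_dag, ← Matrix.mul_assoc] using this
  -- Relations with b† b on the left come from those with b† b on the right by taking adjoints,
  -- because w a b is self-adjoint; likewise for a b w below.
  have e1 : dag R b * b * (w * (a * b)) = w * (a * b) := by
    have : w * (a * b) * (dag R b * b) = w * (a * b) := by
      simp only [mul_assoc] at hb ⊢
      rw [hb]
    have := congrArg (dag R) this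
    rwa [dag_mul, m4, dag_mul, dag_dag] at this
  have e2 : a * b * w * (a * dag R a) = a * b * w := by
    have : a * dag R a * (a * b * w) = a * b * w := by
      simp only [← Matrix.mul_assoc]
      rw [ha]
    have := congrArg (dag R) this
    rwa [dag_mul, m3, dag_mul, dag_dag] at this
  have hb'bw : dag R b * b * w = w := by
    calc dag R b * b * w = dag R b * b * (w * (a * b)) * w := by
          rw [Matrix.mul_assoc (_ * _) (w * _), m2]
      _ = w := by rw [e1, m2]
  have hwaa' : w * a * dag R a = w := by
    calc w * a * dag R a = w * (a * b * w * (a * dag R a)) := by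
          rw [← Matrix.mul_assoc w, ← Matrix.mul_assoc w, m2, Matrix.mul_assoc]
      _ = w := by rw [e2, ← Matrix.mul_assoc, m2]
  have e3 : w * (a * b) * (dag R b * dag R a) = dag R b * dag R a := by
    have := congrArg (dag R) m1
    rw [Matrix.mul_assoc, dag_mul, m4, dag_mul] at this
    exact this
  have e4 : dag R b * dag R a * (a * b * w) = dag R b * dag R a := by
    have := congrArg (dag R) m1
    rw [dag_mul, m3, dag_mul] at this
    exact this
  have r : StringRelations a b (dag R a) (dag R b) w :=
    { aa := zero ha2 ha1 h0c
      bb := zero hb2 hb1 hm0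
      ba := zero hb2 ha1 hmc
      ab' := zero ha2 hb2' h0m
      ba' := zero hb2 ha2' hm0
      a'b' := zero ha1' hb2' hcm
      a'b := zero ha1' hb1 hc0
      b'a := zero hb1' ha1 h0c
      a'a' := zero ha1' ha2' hc0
      b'b' := zero hb1' hb2' h0m
      ww := zero hw2 hw1 hcm
      aw := zero ha2 hw1 h0m
      wb := zero hw2 hb1 hc0
      wa' := zero hw2 ha2' hc0
      wb' := zero hw2 hb2' hcm
      a'w := zero ha1' hw1 hcm
      b'w := zero hb1' hw1 h0m
      aa'a := ha
      a'aa' := hda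
      bb'b := hb
      b'bb' := hdb
      abwab := by simpa only [mul_assoc] using m1
      wabw := by simpa only [mul_assoc] using m2
      b'bw := hb'bw
      waa' := hwaa'
      wabb'a' := by simpa only [mul_assoc] using e3
      b'a'abw := by simpa only [mul_assoc] using e4 }
  obtain ⟨s1, s2, s3⟩ := r.sl2_identities _ _ rfl rfl
  refine ⟨w, _, _, ⟨m1, m2, m3, m4⟩, rfl, ⟨s1, ?_, ?_⟩, ?_, rfl, hw1, hw2⟩
  · rw [s2, two_smul]
  · rw [s3, neg_smul, two_smul]
  -- Here the partial isometries matter: the pseudo-inverses in h are the adjoints a† and b†, so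
  -- these words are b (wab) b† and a† (abw) a, conjugates of orthogonal projections.
  · have d1 : dag R (b * w * a * b * dag R b) = b * w * a * b * dag R b := by
      have : b * w * a * b * dag R b = b * (w * (a * b)) * dag R b := by
        simp only [Matrix.mul_assoc]
      rw [this, dag_mul, dag_mul, m4, dag_dag]
      simp only [Matrix.mul_assoc]
    have d2 : dag R (dag R a * a * b * w * a) = dag R a * a * b * w * a := by
      have : dag R a * a * b * w * a = dag R a * (a * b * w) * a := by
        simp only [Matrix.mul_assoc]
      rw [this, dag_mul, dag_mul, m3, dag_dag]
      simp only [Matrix.mul_assoc]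
    have d3 : dag R (w * a * b) = w * a * b := by rw [Matrix.mul_assoc, m4]
    have d4 : dag R (a * b * w) = a * b * w := m3
    rw [map_add, map_sub, map_sub, map_add, map_sub, map_add, map_add, d1, d2, d3, d4]
    simp only [dag_mul, dag_dag]

/-! ### The bilinear form and its skew-adjoint matrices -/

/-- `S` is the Gram matrix of a non-degenerate symmetric or alternating bilinear form in an
orthonormal basis of the real span: a real orthogonal matrix with `Sᵀ = ± S`. -/
structure IsFormMatrix (S : Matrix ι ι ℂ) (ε : ℂ) : Prop where
  mul_transpose : S * Sᵀ = 1
  transpose_eq : Sᵀ = ε • S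
  sign_mul_self : ε * ε = 1
  conjTranspose_eq : Sᴴ = Sᵀ

/-- The adjoint of a matrix for the bilinear form `(v, w) ↦ vᵀ S w`. -/
def adj (S : Matrix ι ι ℂ) : Matrix ι ι ℂ →ₗ[ℂ] Matrix ι ι ℂ where
  toFun x := Sᵀ * xᵀ * S
  map_add' x y := by simp [mul_add, add_mul]
  map_smul' c x := by simp

theorem adj_def (S x : Matrix ι ι ℂ) : adj S x = Sᵀ * xᵀ * S := rfl

namespace IsFormMatrix

variable {S : Matrix ι ι ℂ} {ε : ℂ}

theorem transpose_mul (hS : IsFormMatrix S ε) : Sᵀ * S = 1 :=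
  mul_eq_one_comm.1 hS.mul_transpose

theorem adj_mul (hS : IsFormMatrix S ε) (x y : Matrix ι ι ℂ) :
    adj S (x * y) = adj S y * adj S x := by
  simp only [adj_def, Matrix.transpose_mul, Matrix.mul_assoc]
  rw [← Matrix.mul_assoc S Sᵀ, hS.mul_transpose, Matrix.one_mul]

theorem adj_adj (hS : IsFormMatrix S ε) (x : Matrix ι ι ℂ) : adj S (adj S x) = x := by
  have h : Sᵀ * Sᵀ * x * S * S = ε • (Sᵀ * S) * x * (Sᵀ * S) * (ε • 1) := by
    have h1 : Sᵀ * Sᵀ = ε • (Sᵀ * S) := by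
      conv_lhs => rw [hS.transpose_eq]
      rw [hS.transpose_eq]; simp
    have h2 : S * S = (Sᵀ * S) * (ε • 1) := by
      rw [hS.transpose_eq]; simp [smul_smul, hS.sign_mul_self]
    rw [Matrix.mul_assoc, h2, h1]
    simp only [Matrix.mul_assoc]
  simp only [adj_def, Matrix.transpose_mul, transpose_transpose]
  calc Sᵀ * (Sᵀ * (x * S)) * S = Sᵀ * Sᵀ * x * S * S := by simp only [Matrix.mul_assoc]
    _ = x := by rw [h, hS.transpose_mul]; simp [smul_smul, hS.sign_mul_self]

theorem adj_one (hS : IsFormMatrix S ε) : adj S 1 = 1 := by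
  simp [adj_def, hS.transpose_mul]

theorem det_adj (hS : IsFormMatrix S ε) (x : Matrix ι ι ℂ) : (adj S x).det = x.det := by
  have : (Sᵀ).det * S.det = 1 := by rw [← Matrix.det_mul, hS.transpose_mul, Matrix.det_one]
  rw [adj_def, Matrix.det_mul, Matrix.det_mul, Matrix.det_transpose x, mul_right_comm, this,
    one_mul]

end IsFormMatrix

/-- The Lie algebra of all matrices that are skew-adjoint for the bilinear form `S`. -/
def skew (S : Matrix ι ι ℂ) : Submodule ℂ (Matrix ι ι ℂ) :=
  LinearMap.ker (adj S + LinearMap.id)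

theorem mem_skew {S x : Matrix ι ι ℂ} : x ∈ skew S ↔ adj S x = -x := by
  simp [skew, add_eq_zero_iff_eq_neg]

theorem IsFormMatrix.lie_mem_skew {S : Matrix ι ι ℂ} {ε : ℂ} (hS : IsFormMatrix S ε)
    {x y : Matrix ι ι ℂ} (hx : x ∈ skew S) (hy : y ∈ skew S) : x * y - y * x ∈ skew S := by
  rw [mem_skew] at *
  rw [map_sub, hS.adj_mul, hS.adj_mul, hx, hy]
  simp

/-! ### Stable isotropic flags of a solvable algebra -/

/-- **Lie's theorem** in a subquotient of the standard representation. -/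
theorem exists_eigenvector_mod (𝔟 : LieSubalgebra ℂ (Matrix ι ι ℂ)) [LieAlgebra.IsSolvable 𝔟]
    {F W : Submodule ℂ (ι → ℂ)} (hF : ∀ x ∈ 𝔟, ∀ v ∈ F, x *ᵥ v ∈ F)
    (hW : ∀ x ∈ 𝔟, ∀ v ∈ W, x *ᵥ v ∈ W) (hlt : F < W) :
    ∃ v ∈ W, v ∉ F ∧ ∀ x ∈ 𝔟, ∃ c : ℂ, x *ᵥ v - c • v ∈ F := by
  let F' : Submodule ℂ W := F.comap W.subtype
  let r : 𝔟 → (W →ₗ[ℂ] W) := fun x => (Matrix.toLin' (x : Matrix ι ι ℂ)).restrict (hW x x.2)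
  have hr : ∀ x, F' ≤ F'.comap (r x) := fun x v hv => hF x x.2 _ hv
  let φ : 𝔟 →ₗ⁅ℂ⁆ Module.End ℂ (W ⧸ F') :=
    { toFun := fun x => F'.mapQ F' (r x) (hr x)
      map_add' := fun x y => by
        ext v
        simp [r, LinearMap.restrict_apply]
        rw [← Submodule.Quotient.mk_add]
        congr 1
      map_smul' := fun c x => by
        ext v
        simp [r, LinearMap.restrict_apply]
        rw [← Submodule.Quotient.mk_smul]
        congr 1
      map_lie' := fun {x y} => by
        ext v
        rw [LieRing.of_associative_ring_bracket]
        simp [r, LinearMap.restrict_apply, Module.End.mul_apply]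
        rw [← Submodule.Quotient.mk_sub]
        congr 1
        ext1
        simp only [LieSubalgebra.coe_bracket, LieRing.of_associative_ring_bracket,
          Matrix.sub_mulVec, ← Matrix.mulVec_mulVec, Submodule.coe_sub]
        rfl }
  have : Nontrivial (W ⧸ F') := by
    rw [Submodule.Quotient.nontrivial_iff]
    intro h
    apply hlt.not_ge
    intro v hv
    have : (⟨v, hv⟩ : W) ∈ F' := by rw [h]; trivial
    exact this
  letI := LieRingModule.compLieHom (W ⧸ F') φ
  haveI : LieModule ℂ 𝔟 (W ⧸ F') := LieModule.compLieHom (W ⧸ F') φ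
  -- A weight vector of the non-zero module W / F, lifted to W, is a common eigenvector modulo F.
  obtain ⟨χ, hχ⟩ := LieModule.exists_nontrivial_weightSpace_of_isSolvable ℂ 𝔟 (W ⧸ F')
  obtain ⟨⟨q, hq⟩, hq0⟩ := exists_ne (0 : LieModule.weightSpace (W ⧸ F') χ)
  rw [LieModule.mem_weightSpace] at hq
  obtain ⟨v, rfl⟩ := Submodule.Quotient.mk_surjective F' q
  refine ⟨v, v.2, fun hv => hq0 ?_, fun x hx => ⟨χ ⟨x, hx⟩, ?_⟩⟩
  · ext
    simpa using (Submodule.Quotient.mk_eq_zero F').2 hv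
  · have h := hq ⟨x, hx⟩
    have h2 : (Submodule.Quotient.mk (r ⟨x, hx⟩ v) : W ⧸ F') =
      χ ⟨x, hx⟩ • Submodule.Quotient.mk v := h
    rw [← Submodule.Quotient.mk_smul, Submodule.Quotient.eq] at h2
    exact h2

section Flags

variable {S : Matrix ι ι ℂ} {ε : ℂ}

/-- The bilinear form with Gram matrix `S`. -/
def form (S : Matrix ι ι ℂ) (v w : ι → ℂ) : ℂ := v ⬝ᵥ (S *ᵥ w)

theorem form_add_left (u v w : ι → ℂ) : form S (u + v) w = form S u w + form S v w := by
  simp [form, add_dotProduct]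

theorem form_add_right (u v w : ι → ℂ) : form S u (v + w) = form S u v + form S u w := by
  simp [form, mulVec_add]

theorem form_smul_left (c : ℂ) (v w : ι → ℂ) : form S (c • v) w = c * form S v w := by
  simp [form]

theorem form_smul_right (c : ℂ) (v w : ι → ℂ) : form S v (c • w) = c * form S v w := by
  simp [form, mulVec_smul]

theorem form_sub_left (u v w : ι → ℂ) : form S (u - v) w = form S u w - form S v w := by
  simp [form]

theorem form_zero_left (w : ι → ℂ) : form S 0 w = 0 := by simp [form]

theorem form_eq (v w : ι → ℂ) : form S v w = Matrix.toBilin' S v w := by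
  rw [Matrix.toBilin'_apply']; rfl

theorem IsFormMatrix.form_comm (hS : IsFormMatrix S ε) (v w : ι → ℂ) :
    form S v w = ε * form S w v := by
  rw [form, Matrix.dotProduct_mulVec, ← Matrix.mulVec_transpose, hS.transpose_eq,
    Matrix.smul_mulVec, smul_dotProduct, dotProduct_comm, form, smul_eq_mul]

theorem IsFormMatrix.form_mulVec (hS : IsFormMatrix S ε) (x : Matrix ι ι ℂ) (v w : ι → ℂ) :
    form S (x *ᵥ v) w = form S v (adj S x *ᵥ w) := by
  have : S * adj S x = xᵀ * S := by
    rw [adj_def, ← Matrix.mul_assoc, ← Matrix.mul_assoc, hS.mul_transpose, Matrix.one_mul]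
  rw [form, form, Matrix.mulVec_mulVec, this, ← Matrix.mulVec_mulVec, Matrix.dotProduct_mulVec v,
    Matrix.vecMul_transpose]

theorem IsFormMatrix.form_skew (hS : IsFormMatrix S ε) {x : Matrix ι ι ℂ} (hx : x ∈ skew S)
    (v w : ι → ℂ) : form S (x *ᵥ v) w = - form S v (x *ᵥ w) := by
  rw [hS.form_mulVec, mem_skew.1 hx, Matrix.neg_mulVec, form, form, Matrix.mulVec_neg,
    dotProduct_neg]

/-- The orthogonal complement of a subspace for the form `S`. -/
def perp (S : Matrix ι ι ℂ) (F : Submodule ℂ (ι → ℂ)) : Submodule ℂ (ι → ℂ) :=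
  (Matrix.toBilin' S).orthogonal F

theorem mem_perp {F : Submodule ℂ (ι → ℂ)} {v : ι → ℂ} :
    v ∈ perp S F ↔ ∀ w ∈ F, form S w v = 0 := by
  simp only [form_eq]
  rfl

theorem IsFormMatrix.perp_perp (hS : IsFormMatrix S ε) (F : Submodule ℂ (ι → ℂ)) :
    perp S (perp S F) = F := by
  refine LinearMap.BilinForm.orthogonal_orthogonal ?_ ?_ F
  · apply LinearMap.BilinForm.nondegenerate_toBilin'_of_det_ne_zero'
    intro h
    have := congrArg Matrix.det hS.mul_transpose
    rw [Matrix.det_mul, h] at this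
    simp at this
  · intro v w h
    rw [← form_eq] at h ⊢
    rw [hS.form_comm, h, mul_zero]

/-- The `i`-th step of the flag spanned by the sequence `v`. -/
def flag (v : ℕ → ι → ℂ) (i : ℕ) : Submodule ℂ (ι → ℂ) := Submodule.span ℂ (v '' Set.Iio i)

theorem flag_succ (v : ℕ → ι → ℂ) (i : ℕ) : flag v (i + 1) = flag v i ⊔ Submodule.span ℂ {v i} := by
  have : Set.Iio (i + 1) = Set.Iio i ∪ {i} := by ext; simp
  rw [flag, this, Set.image_union, Submodule.span_union, Set.image_singleton, flag]

theorem flag_mono (v : ℕ → ι → ℂ) {i j : ℕ} (h : i ≤ j) : flag v i ≤ flag v j :=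
  Submodule.span_mono (Set.image_mono (Set.Iio_subset_Iio h))

theorem mem_flag (v : ℕ → ι → ℂ) {i j : ℕ} (h : i < j) : v i ∈ flag v j :=
  Submodule.subset_span ⟨i, h, rfl⟩

theorem mem_flag_succ {v : ℕ → ι → ℂ} {i : ℕ} {w : ι → ℂ} (h : w ∈ flag v (i + 1)) :
    ∃ c : ℂ, w - c • v i ∈ flag v i := by
  rw [flag_succ, Submodule.mem_sup] at h
  obtain ⟨y, hy, z, hz, rfl⟩ := h
  obtain ⟨c, rfl⟩ := Submodule.mem_span_singleton.1 hz
  exact ⟨c, by simpa using hy⟩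

theorem flag_induction {v : ℕ → ι → ℂ} {i : ℕ} {p : (ι → ℂ) → Prop}
    (h0 : p 0) (hadd : ∀ x y, p x → p y → p (x + y)) (hsmul : ∀ (c : ℂ) x, p x → p (c • x))
    (hv : ∀ j < i, p (v j)) {w : ι → ℂ} (hw : w ∈ flag v i) : p w := by
  refine Submodule.span_induction (p := fun w _ => p w) ?_ h0 (fun x y _ _ => hadd x y)
    (fun c x _ => hsmul c x) hw
  rintro _ ⟨j, hj, rfl⟩
  exact hv j hj

/-- The sequence `v` spans, up to step `m`, an isotropic flag stable under `𝔟`. -/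
structure IsStableFlag (S : Matrix ι ι ℂ) (𝔟 : LieSubalgebra ℂ (Matrix ι ι ℂ)) (m : ℕ)
    (v : ℕ → ι → ℂ) : Prop where
  isotropic : ∀ i < m, ∀ j < m, form S (v i) (v j) = 0
  stable : ∀ i < m, ∀ x ∈ 𝔟, x *ᵥ v i ∈ flag v (i + 1)
  notMem : ∀ i < m, v i ∉ flag v i

/-- The steps of the flag increase strictly, so the dimension bounds the length; a longest stable
flag therefore exists. -/
theorem IsStableFlag.le_card {𝔟 : LieSubalgebra ℂ (Matrix ι ι ℂ)} {m : ℕ} {v : ℕ → ι → ℂ}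
    (h : IsStableFlag S 𝔟 m v) : m ≤ Fintype.card ι := by
  have : ∀ i ≤ m, i ≤ Module.finrank ℂ (flag v i) := by
    intro i
    induction i with
    | zero => intro _; exact Nat.zero_le _
    | succ k ih =>
      intro hk
      refine lt_of_le_of_lt (ih (by omega)) (Submodule.finrank_lt_finrank_of_lt ?_)
      refine lt_of_le_of_ne (flag_mono v (by omega)) fun heq => h.notMem k hk ?_
      rw [heq]
      exact mem_flag v (by omega)
  calc m ≤ Module.finrank ℂ (flag v m) := this m le_rfl
    _ ≤ Module.finrank ℂ (ι → ℂ) := Submodule.finrank_le _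
    _ = _ := by simp

theorem exists_maximal_flag (S : Matrix ι ι ℂ) (𝔟 : LieSubalgebra ℂ (Matrix ι ι ℂ)) :
    ∃ m v, IsStableFlag S 𝔟 m v ∧ ∀ m' v', IsStableFlag S 𝔟 m' v' → m' ≤ m := by
  classical
  have h0 : ∃ v, IsStableFlag S 𝔟 0 v := ⟨0, by constructor <;> intro i hi <;> omega⟩
  have hP := Nat.findGreatest_spec (P := fun m => ∃ v, IsStableFlag S 𝔟 m v)
    (Nat.zero_le (Fintype.card ι)) h0
  obtain ⟨v, hv⟩ := hP
  exact ⟨_, v, hv, fun m' v' h' => Nat.le_findGreatest h'.le_card ⟨v', h'⟩⟩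

theorem IsStableFlag.flag_isotropic {𝔟 : LieSubalgebra ℂ (Matrix ι ι ℂ)} {m : ℕ} {v : ℕ → ι → ℂ}
    (h : IsStableFlag S 𝔟 m v) : flag v m ≤ perp S (flag v m) := by
  intro z hz
  rw [mem_perp]
  intro w hw
  refine flag_induction (p := fun w => form S w z = 0) (form_zero_left _)
    (fun x y hx hy => by rw [form_add_left, hx, hy, add_zero])
    (fun c x hx => by rw [form_smul_left, hx, mul_zero]) (fun j hj => ?_) hw
  refine flag_induction (p := fun z => form S (v j) z = 0) (by simp [form])
    (fun x y hx hy => by rw [form_add_right, hx, hy, add_zero])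
    (fun c x hx => by rw [form_smul_right, hx, mul_zero]) (fun i hi => ?_) hz
  exact h.isotropic j hj i hi

theorem IsStableFlag.flag_stable {𝔟 : LieSubalgebra ℂ (Matrix ι ι ℂ)} {m : ℕ} {v : ℕ → ι → ℂ}
    (h : IsStableFlag S 𝔟 m v) {i : ℕ} (hi : i ≤ m) {x : Matrix ι ι ℂ} (hx : x ∈ 𝔟) :
    ∀ w ∈ flag v i, x *ᵥ w ∈ flag v i := by
  intro w hw
  refine flag_induction (p := fun w => x *ᵥ w ∈ flag v i) (by simp)
    (fun a b ha hb => by rw [mulVec_add]; exact add_mem ha hb)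
    (fun c a ha => by rw [mulVec_smul]; exact Submodule.smul_mem _ c ha) (fun j hj => ?_) hw
  exact flag_mono v (by omega) (h.stable j (by omega) x hx)

/-- Every contradiction with the maximality of a flag comes from this extension by one isotropic
eigenvector of F^⊥ modulo F. -/
theorem IsStableFlag.extend (hS : IsFormMatrix S ε) {𝔟 : LieSubalgebra ℂ (Matrix ι ι ℂ)} {m : ℕ}
    {v : ℕ → ι → ℂ} (h : IsStableFlag S 𝔟 m v) {w : ι → ℂ} (hw : w ∈ perp S (flag v m))
    (hn : w ∉ flag v m) (hww : form S w w = 0) (hst : ∀ x ∈ 𝔟, ∃ c : ℂ, x *ᵥ w - c • w ∈ flag v m) :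
    ∃ v', IsStableFlag S 𝔟 (m + 1) v' := by
  let v' : ℕ → ι → ℂ := Function.update v m w
  have hv : ∀ i < m, v' i = v i := fun i hi => Function.update_of_ne (by omega) _ _
  have hm : v' m = w := Function.update_self _ _ _
  have hf : ∀ i ≤ m, flag v' i = flag v i := by
    intro i hi
    rw [flag, flag]
    congr 1
    apply Set.image_congr
    intro j hj
    exact hv j (lt_of_lt_of_le hj hi)
  refine ⟨v', ⟨fun i hi j hj => ?_, fun i hi x hx => ?_, fun i hi => ?_⟩⟩
  · rcases Nat.lt_succ_iff_lt_or_eq.1 hi with hi | rfl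
    · rw [hv i hi]
      rcases Nat.lt_succ_iff_lt_or_eq.1 hj with hj | rfl
      · rw [hv j hj]; exact h.isotropic i hi j hj
      · rw [hm]; exact mem_perp.1 hw _ (mem_flag v hi)
    · rw [hm]
      rcases Nat.lt_succ_iff_lt_or_eq.1 hj with hj | rfl
      · rw [hv j hj, hS.form_comm, mem_perp.1 hw _ (mem_flag v hj), mul_zero]
      · rw [hm]; exact hww
  · rcases Nat.lt_succ_iff_lt_or_eq.1 hi with hi | rfl
    · rw [hv i hi, hf _ (by omega)]; exact h.stable i hi x hx
    · rw [hm, flag_succ, hm, hf _ le_rfl]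
      obtain ⟨c, hc⟩ := hst x hx
      have : x *ᵥ w = (x *ᵥ w - c • w) + c • w := by abel
      rw [this]
      exact Submodule.add_mem_sup hc (Submodule.smul_mem _ _ (Submodule.mem_span_singleton_self w))
  · rcases Nat.lt_succ_iff_lt_or_eq.1 hi with hi | rfl
    · rw [hv i hi, hf _ (by omega)]; exact h.notMem i hi
    · rw [hm, hf _ le_rfl]; exact hn

theorem IsFormMatrix.mulVec_mem_perp (hS : IsFormMatrix S ε) {x : Matrix ι ι ℂ} (hx : x ∈ skew S)
    {F E : Submodule ℂ (ι → ℂ)} (h : ∀ v ∈ F, x *ᵥ v ∈ E) :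
    ∀ v ∈ perp S E, x *ᵥ v ∈ perp S F := by
  intro v hv
  rw [mem_perp] at hv ⊢
  intro w hw
  have := hS.form_skew hx w v
  rw [hv _ (h w hw)] at this
  simpa using this.symm

/-- A maximal stable isotropic flag is complete: skew matrices which stabilize its last step `F`
map `F^⊥` to `F`. -/
theorem IsStableFlag.mulVec_mem_of_maximal (hS : IsFormMatrix S ε)
    {𝔟 : LieSubalgebra ℂ (Matrix ι ι ℂ)} [LieAlgebra.IsSolvable 𝔟]
    (hb : ∀ x ∈ 𝔟, x ∈ skew S) {m : ℕ} {v : ℕ → ι → ℂ}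
    (h : IsStableFlag S 𝔟 m v) (hmax : ∀ v', ¬ IsStableFlag S 𝔟 (m + 1) v')
    {x : Matrix ι ι ℂ} (hx : x ∈ skew S) (hxF : ∀ w ∈ flag v m, x *ᵥ w ∈ flag v m) :
    ∀ z ∈ perp S (flag v m), x *ᵥ z ∈ flag v m := by
  set F := flag v m with hF
  have hFs : ∀ x ∈ 𝔟, ∀ w ∈ F, x *ᵥ w ∈ F := fun x hx => h.flag_stable le_rfl hx
  have hPs : ∀ x ∈ 𝔟, ∀ w ∈ perp S F, x *ᵥ w ∈ perp S F := fun x hx =>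
    hS.mulVec_mem_perp (hb x hx) (hFs x hx)
  have hxP := hS.mulVec_mem_perp hx hxF
  intro z hz
  by_cases hlt : F = perp S F
  · rw [hlt]; exact hxP z hz
  -- The remaining case is that F^⊥ / F is a line spanned by w. By maximality, a common eigenvector
  -- of F^⊥ modulo F cannot be isotropic.
  obtain ⟨w, hwP, hwF, hw⟩ := exists_eigenvector_mod 𝔟 hFs hPs (lt_of_le_of_ne h.flag_isotropic hlt)
  have hww : form S w w ≠ 0 := by
    intro h0
    obtain ⟨v', hv'⟩ := h.extend hS hwP hwF h0 hw
    exact hmax v' hv'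
  -- An anisotropic vector forces the form to be symmetric, and then ⟨yw, w⟩ equals its own negative
  -- for skew y.
  have skew0 : ∀ y ∈ skew S, form S (y *ᵥ w) w = 0 := by
    intro y hy
    have h1 := hS.form_skew hy w w
    have h2 := hS.form_comm w (y *ᵥ w)
    have h3 := hS.form_comm w w
    have hε : ε = 1 := by
      have : (1 - ε) * form S w w = 0 := by linear_combination h3
      rcases mul_eq_zero.1 this with h4 | h4
      · linear_combination -h4
      · exact absurd h4 hww
    rw [hε, one_mul] at h2
    rw [h2] at h1
    have : (2 : ℂ) * form S (y *ᵥ w) w = 0 := by linear_combination h1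
    simpa using this
  have weight0 : ∀ w ∈ perp S F, form S w w ≠ 0 → (∀ y ∈ skew S, form S (y *ᵥ w) w = 0) →
      ∀ y ∈ 𝔟, (∃ c : ℂ, y *ᵥ w - c • w ∈ F) → y *ᵥ w ∈ F := by
    rintro w hwP hww hs y hy ⟨c, hc⟩
    have h1 := mem_perp.1 hwP _ hc
    rw [form_sub_left, form_smul_left, hs y (hb y hy), zero_sub, neg_eq_zero] at h1
    have hc0 : c = 0 := (mul_eq_zero.1 h1).resolve_right hww
    simpa [hc0] using hc
  let W : Submodule ℂ (ι → ℂ) := perp S F ⊓ perp S (Submodule.span ℂ {w})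
  have memW : ∀ z, z ∈ W ↔ z ∈ perp S F ∧ form S w z = 0 := by
    intro z
    simp only [W, Submodule.mem_inf]
    refine and_congr_right fun _ => ⟨fun h => mem_perp.1 h w (Submodule.mem_span_singleton_self w),
      fun h => mem_perp.2 fun y hy => ?_⟩
    obtain ⟨c, rfl⟩ := Submodule.mem_span_singleton.1 hy
    rw [form_smul_left, h, mul_zero]
  have hFw : ∀ f ∈ F, form S w f = 0 := fun f hf => by
    rw [hS.form_comm, mem_perp.1 hwP f hf, mul_zero]
  have hFW : F ≤ W := fun f hf => (memW f).2 ⟨h.flag_isotropic hf, hFw f hf⟩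
  have hWs : ∀ y ∈ 𝔟, ∀ z ∈ W, y *ᵥ z ∈ W := by
    intro y hy z hz
    rw [memW] at hz ⊢
    refine ⟨hPs y hy z hz.1, ?_⟩
    have h1 := hS.form_skew (hb y hy) w z
    have h2 := weight0 w hwP hww skew0 y hy (hw y hy)
    rw [mem_perp.1 hz.1 _ h2] at h1
    simpa using h1.symm
  -- If W were larger, it would contain a second anisotropic eigenvector u orthogonal to w. The
  -- algebra maps both u and w into F, and a suitable combination w + αu is isotropic, which
  -- lengthens the flag.
  have hWF : W = F := by
    by_contra hne
    obtain ⟨u, huW, huF, hu⟩ := exists_eigenvector_mod 𝔟 hFs hWs (lt_of_le_of_ne hFW (Ne.symm hne))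
    rw [memW] at huW
    have huu : form S u u ≠ 0 := by
      intro h0
      obtain ⟨v', hv'⟩ := h.extend hS huW.1 huF h0 hu
      exact hmax v' hv'
    have hε : ε = 1 := by
      have h3 := hS.form_comm w w
      have : (1 - ε) * form S w w = 0 := by linear_combination h3
      rcases mul_eq_zero.1 this with h4 | h4
      · linear_combination -h4
      · exact absurd h4 hww
    have skew0u : ∀ y ∈ skew S, form S (y *ᵥ u) u = 0 := by
      intro y hy
      have h1 := hS.form_skew hy u u
      have h2 := hS.form_comm u (y *ᵥ u)
      rw [hε, one_mul] at h2
      rw [h2] at h1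
      have : (2 : ℂ) * form S (y *ᵥ u) u = 0 := by linear_combination h1
      simpa using this
    obtain ⟨α, hα⟩ := IsAlgClosed.exists_pow_nat_eq (- form S w w / form S u u) (n := 2) (by norm_num)
    have huw : form S u w = 0 := by rw [hS.form_comm, huW.2, mul_zero]
    obtain ⟨v', hv'⟩ := h.extend hS (w := w + α • u)
      (add_mem hwP (Submodule.smul_mem _ _ huW.1))
      (fun hmem => hww (by
        have := hFw _ hmem
        rwa [form_add_right, form_smul_right, huW.2, mul_zero, add_zero] at this))
      (by
        rw [form_add_left, form_add_right, form_add_right]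
        simp only [form_smul_left, form_smul_right, huW.2, huw]
        have : α ^ 2 * form S u u = - form S w w := by rw [hα]; field_simp
        linear_combination this)
      (fun y hy => ⟨0, by
        rw [zero_smul, sub_zero, mulVec_add, mulVec_smul]
        exact add_mem (weight0 w hwP hww skew0 y hy (hw y hy))
          (Submodule.smul_mem _ _ (weight0 u huW.1 huu skew0u y hy (hu y hy)))⟩)
    exact hmax v' hv'
  -- The vector z minus its w-component lies in W = F, which x preserves, and xw is orthogonal to w.
  have key : x *ᵥ z ∈ W := by
    rw [memW]
    refine ⟨hxP z hz, ?_⟩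
    have hz' : z - (form S w z / form S w w) • w ∈ W := by
      rw [memW]
      refine ⟨sub_mem hz (Submodule.smul_mem _ _ hwP), ?_⟩
      rw [sub_eq_add_neg, ← neg_smul, form_add_right, form_smul_right]
      field_simp
      ring
    rw [hWF] at hz'
    have h1 := hFw _ (hxF _ hz')
    rw [mulVec_sub, mulVec_smul, sub_eq_add_neg, ← neg_smul, form_add_right, form_smul_right] at h1
    have h2 : form S w (x *ᵥ w) = 0 := by rw [hS.form_comm, skew0 x hx, mul_zero]
    rwa [h2, mul_zero, add_zero] at h1
  rwa [hWF] at key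

end Flags

/-! ### Borel subalgebras and their orthogonal complements -/

section Borel

variable {S : Matrix ι ι ℂ} {ε : ℂ}

/-- The stabilizer in `skew S` of a flag. -/
def flagStabilizer (hS : IsFormMatrix S ε) (m : ℕ) (v : ℕ → ι → ℂ) :
    LieSubalgebra ℂ (Matrix ι ι ℂ) where
  carrier := {x | x ∈ skew S ∧ ∀ i ≤ m, ∀ w ∈ flag v i, x *ᵥ w ∈ flag v i}
  add_mem' := fun {x y} hx hy => ⟨add_mem hx.1 hy.1, fun i hi w hw => by
    rw [add_mulVec]; exact add_mem (hx.2 i hi w hw) (hy.2 i hi w hw)⟩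
  zero_mem' := ⟨zero_mem _, fun i hi w hw => by rw [zero_mulVec]; exact zero_mem _⟩
  smul_mem' := fun c x hx => ⟨Submodule.smul_mem _ c hx.1, fun i hi w hw => by
    rw [smul_mulVec]; exact Submodule.smul_mem _ c (hx.2 i hi w hw)⟩
  lie_mem' := fun {x y} hx hy => by
    rw [LieRing.of_associative_ring_bracket]
    refine ⟨hS.lie_mem_skew hx.1 hy.1, fun i hi w hw => ?_⟩
    rw [sub_mulVec, ← mulVec_mulVec, ← mulVec_mulVec]
    exact sub_mem (hx.2 i hi _ (hy.2 i hi w hw)) (hy.2 i hi _ (hx.2 i hi w hw))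

theorem mem_flagStabilizer (hS : IsFormMatrix S ε) {m : ℕ} {v : ℕ → ι → ℂ} {x : Matrix ι ι ℂ} :
    x ∈ flagStabilizer hS m v ↔
      x ∈ skew S ∧ ∀ i ≤ m, ∀ w ∈ flag v i, x *ᵥ w ∈ flag v i := Iff.rfl

/-- Skewness makes x shift the orthogonal complements of the flag as well: x^m maps the whole space
into F^⊥, one further factor maps F^⊥ into F, and x^m kills F. This explains the exponent m + 1 + m.
-/
theorem isNilpotent_of_flag (hS : IsFormMatrix S ε) {m : ℕ} {v : ℕ → ι → ℂ}
    {x : Matrix ι ι ℂ} (hx : x ∈ skew S)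
    (hfl : ∀ i < m, ∀ w ∈ flag v (i + 1), x *ᵥ w ∈ flag v i)
    (hP : ∀ z ∈ perp S (flag v m), x *ᵥ z ∈ flag v m) : IsNilpotent x := by
  have h1 : ∀ i ≤ m, ∀ w ∈ flag v i, (x ^ i) *ᵥ w = 0 := by
    intro i
    induction i with
    | zero => intro _ w hw; simpa [flag] using hw
    | succ k ih =>
      intro hk w hw
      rw [pow_succ, ← mulVec_mulVec]
      exact ih (by omega) _ (hfl k (by omega) w hw)
  have h2 : ∀ i ≤ m, ∀ w, (x ^ i) *ᵥ w ∈ perp S (flag v i) := by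
    intro i
    induction i with
    | zero =>
      intro _ w
      rw [mem_perp]
      intro u hu
      have : u = 0 := by simpa [flag] using hu
      rw [this, form_zero_left]
    | succ k ih =>
      intro hk w
      rw [pow_succ', ← mulVec_mulVec]
      exact hS.mulVec_mem_perp hx (hfl k (by omega)) _ (ih (by omega) w)
  refine ⟨m + 1 + m, ?_⟩
  apply Matrix.toLin'.injective
  ext1
  ext1
  simp only [Matrix.toLin'_apply, LinearMap.comp_apply, map_zero, LinearMap.zero_apply]
  rw [pow_add, pow_succ, ← mulVec_mulVec, ← mulVec_mulVec, h1 m le_rfl _ (hP _ (h2 m le_rfl _))]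

/-- Stabilizing matrices act on each line of the graded flag by scalars, so commutators shift the
flag and are nilpotent. By Engel's theorem the derived algebra is nilpotent, hence the whole algebra
is solvable. -/
theorem isSolvable_flagStabilizer (hS : IsFormMatrix S ε) {m : ℕ} {v : ℕ → ι → ℂ}
    (hP : ∀ x ∈ flagStabilizer hS m v, ∀ z ∈ perp S (flag v m), x *ᵥ z ∈ flag v m) :
    LieAlgebra.IsSolvable (flagStabilizer hS m v) := by
  set C := flagStabilizer hS m v
  let D : LieIdeal ℂ C := LieAlgebra.derivedSeries ℂ C 1
  have hD : ∀ x : C, x ∈ D → ∀ i < m, ∀ w ∈ flag v (i + 1), (x : Matrix ι ι ℂ) *ᵥ w ∈ flag v i := by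
    intro x hx i hi w hw
    have hx' : x ∈ Submodule.span ℂ {z : C | ∃ a b : C, ⁅a, b⁆ = z} := by
      have h : (D : Submodule ℂ C) = Submodule.span ℂ {z : C | ∃ a b : C, ⁅a, b⁆ = z} := by
        change (LieAlgebra.derivedSeries ℂ C 1 : Submodule ℂ C) = _
        rw [LieAlgebra.coe_derivedSeries_one_eq]
      rw [← h]
      exact hx
    refine Submodule.span_induction
      (p := fun (y : C) _ => (y : Matrix ι ι ℂ) *ᵥ w ∈ flag v i) ?_ ?_ ?_ ?_ hx'
    · rintro _ ⟨a, b, rfl⟩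
      obtain ⟨hai, ha⟩ := (mem_flagStabilizer hS).1 a.2
      obtain ⟨hbi, hb⟩ := (mem_flagStabilizer hS).1 b.2
      rw [LieSubalgebra.coe_bracket, LieRing.of_associative_ring_bracket]
      have hvi : v i ∈ flag v (i + 1) := mem_flag v (by omega)
      obtain ⟨α, hα⟩ := mem_flag_succ (ha (i + 1) (by omega) _ hvi)
      obtain ⟨β, hβ⟩ := mem_flag_succ (hb (i + 1) (by omega) _ hvi)
      obtain ⟨γ, hγ⟩ := mem_flag_succ hw
      -- With α, β, γ the coefficients of v i in a (v i), b (v i) and w modulo `flag v i`, the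
      -- scalar terms cancel in the commutator and every remaining term visibly lies in `flag v i`.
      have e1 : ((a : Matrix ι ι ℂ) * (b : Matrix ι ι ℂ) - (b : Matrix ι ι ℂ) * (a : Matrix ι ι ℂ)) *ᵥ w
          = ((a : Matrix ι ι ℂ) *ᵥ (b : Matrix ι ι ℂ) *ᵥ (w - γ • v i) -
            (b : Matrix ι ι ℂ) *ᵥ (a : Matrix ι ι ℂ) *ᵥ (w - γ • v i)) +
            γ • (((a : Matrix ι ι ℂ) *ᵥ ((b : Matrix ι ι ℂ) *ᵥ v i - β • v i) -
              α • ((b : Matrix ι ι ℂ) *ᵥ v i - β • v i)) -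
            ((b : Matrix ι ι ℂ) *ᵥ ((a : Matrix ι ι ℂ) *ᵥ v i - α • v i) -
              β • ((a : Matrix ι ι ℂ) *ᵥ v i - α • v i)) +
              β • ((a : Matrix ι ι ℂ) *ᵥ v i - α • v i) - β • ((a : Matrix ι ι ℂ) *ᵥ v i - α • v i)
              ) := by
        simp only [sub_mulVec, ← mulVec_mulVec, mulVec_sub, mulVec_smul, smul_sub, smul_add,
          smul_smul]
        rw [mul_comm β α]
        abel
      rw [e1]
      have m1 := hb i hi.le _ hγ
      have m2 := ha i hi.le _ hγ
      refine add_mem (sub_mem (ha i hi.le _ m1) (hb i hi.le _ m2)) (Submodule.smul_mem _ _ ?_)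
      exact sub_mem (add_mem (sub_mem (sub_mem (ha i hi.le _ hβ) (Submodule.smul_mem _ _ hβ))
        (sub_mem (hb i hi.le _ hα) (Submodule.smul_mem _ _ hα))) (Submodule.smul_mem _ _ hα))
        (Submodule.smul_mem _ _ hα)
    · simp
    · intro x y _ _ hx hy
      change (x.1 + y.1) *ᵥ w ∈ _
      rw [add_mulVec]
      exact add_mem hx hy
    · intro c x _ hx
      change (c • x.1) *ᵥ w ∈ _
      rw [smul_mulVec]
      exact Submodule.smul_mem _ c hx
  have hnil : ∀ x : D, IsNilpotent ((x : C) : Matrix ι ι ℂ) := fun x =>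
    isNilpotent_of_flag hS ((mem_flagStabilizer hS).1 (x : C).2).1 (hD x x.2) (hP _ (x : C).2)
  have hDn : LieRing.IsNilpotent D := by
    rw [LieAlgebra.isNilpotent_iff_forall (R := ℂ)]
    intro x
    have h1 : IsNilpotent (LieAlgebra.ad ℂ (Matrix ι ι ℂ) ((x : C) : Matrix ι ι ℂ)) :=
      LieAlgebra.ad_nilpotent_of_nilpotent (hnil x)
    obtain ⟨k, hk⟩ := h1
    refine ⟨k, ?_⟩
    have h2 : ∀ (k : ℕ) (y : D), ((((LieAlgebra.ad ℂ D x) ^ k) y : D) : C).1 =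
        ((LieAlgebra.ad ℂ (Matrix ι ι ℂ) ((x : C) : Matrix ι ι ℂ)) ^ k) ((y : C) : Matrix ι ι ℂ) := by
      intro k
      induction k with
      | zero => intro y; rfl
      | succ k ih => intro y; rw [pow_succ, pow_succ, Module.End.mul_apply, ih]; rfl
    ext1 y
    apply Subtype.ext
    apply Subtype.ext
    rw [h2, hk]
    rfl
  have hDs : LieAlgebra.IsSolvable D := inferInstance
  obtain ⟨k, hk⟩ := hDs.solvable (R := ℂ)
  rw [LieIdeal.derivedSeries_eq_bot_iff] at hk
  refine LieAlgebra.IsSolvable.mk (R := ℂ) (k := k + 1) ?_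
  rw [LieAlgebra.derivedSeries_def, LieAlgebra.derivedSeriesOfIdeal_add]
  exact hk

/-- A maximal solvable subalgebra of `skew S` contains its orthogonal complement for the trace
form, and the latter consists of nilpotent matrices. -/
theorem mem_and_isNilpotent_of_orthogonal (hS : IsFormMatrix S ε)
    {𝔟 : LieSubalgebra ℂ (Matrix ι ι ℂ)}
    (hb : Maximal (fun 𝔞 : LieSubalgebra ℂ (Matrix ι ι ℂ) =>
      (𝔞 : Set (Matrix ι ι ℂ)) ⊆ skew S ∧ LieAlgebra.IsSolvable 𝔞) 𝔟)
    {x : Matrix ι ι ℂ} (hx : x ∈ skew S) (hxb : ∀ y ∈ 𝔟, (x * y).trace = 0) :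
    x ∈ 𝔟 ∧ IsNilpotent x := by
  obtain ⟨⟨hbs, hsol⟩, hmax⟩ := hb
  obtain ⟨m, v, hfl, hm⟩ := exists_maximal_flag S 𝔟
  have hmax' : ∀ v', ¬ IsStableFlag S 𝔟 (m + 1) v' := fun v' h => by
    have := hm _ _ h; omega
  have hP : ∀ y ∈ skew S, (∀ w ∈ flag v m, y *ᵥ w ∈ flag v m) →
      ∀ z ∈ perp S (flag v m), y *ᵥ z ∈ flag v m := fun y hy h =>
    hfl.mulVec_mem_of_maximal hS (fun x hx => hbs hx) hmax' hy h
  have hsolv : LieAlgebra.IsSolvable (flagStabilizer hS m v) :=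
    isSolvable_flagStabilizer hS fun y hy => hP y hy.1 (hy.2 m le_rfl)
  have hle : 𝔟 ≤ flagStabilizer hS m v := fun y hy =>
    ⟨hbs hy, fun i hi => hfl.flag_stable hi hy⟩
  have hge : flagStabilizer hS m v ≤ 𝔟 := hmax ⟨fun y hy => hy.1, hsolv⟩ hle
  have hiso : ∀ i < m, flag v m ≤ perp S (flag v i) := fun i hi z hz =>
    mem_perp.2 fun w hw => mem_perp.1 (hfl.flag_isotropic hz) w (flag_mono v hi.le hw)
  have hstep : ∀ i < m, x *ᵥ v i ∈ flag v i := by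
    intro i hi
    -- By double orthogonality it suffices to test x (v i) against each u orthogonal to `flag v i`.
    rw [← hS.perp_perp (flag v i), mem_perp]
    intro u hu
    let E : (ι → ℂ) → (ι → ℂ) → Matrix ι ι ℂ := fun v u => vecMulVec v (Sᵀ *ᵥ u)
    have hE : ∀ v u z, E v u *ᵥ z = form S u z • v := by
      intro v u z
      simp only [E, vecMulVec_mulVec, form]
      rw [Matrix.mulVec_transpose, Matrix.dotProduct_mulVec]
      ext; simp [mul_comm]
    have hEt : ∀ v u, (x * E v u).trace = form S u (x *ᵥ v) := by
      intro v u
      simp only [E, Matrix.mul_vecMulVec, Matrix.trace_vecMulVec, form]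
      rw [Matrix.mulVec_transpose, Matrix.dotProduct_mulVec, dotProduct_comm]
    have hEadj : ∀ v u, adj S (E v u) = ε • E u v := by
      intro v u
      simp only [E, adj_def, transpose_vecMulVec, Matrix.mul_vecMulVec, Matrix.vecMulVec_mul,
        Matrix.mulVec_mulVec]
      have h1 : Sᵀ * Sᵀ = ε • (1 : Matrix ι ι ℂ) := by
        conv_lhs => lhs; rw [hS.transpose_eq]
        rw [Matrix.smul_mul, hS.mul_transpose]
      rw [h1, smul_mulVec, one_mulVec, ← Matrix.mulVec_transpose]
      ext; simp [vecMulVec_apply, mul_assoc]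
    -- This skew matrix of rank at most two stabilizes the flag because u is orthogonal to `flag v
    -- i`. Its trace against x is 2⟨u, x (v i)⟩, which therefore vanishes.
    have hmem : E (v i) u - ε • E u (v i) ∈ flagStabilizer hS m v := by
      refine ⟨?_, fun j hj w hw => ?_⟩
      · rw [mem_skew, map_sub, map_smul, hEadj, hEadj, smul_smul, hS.sign_mul_self, one_smul,
          neg_sub]
      · have hw0 : form S (v i) w = 0 :=
          mem_perp.1 (hfl.flag_isotropic (flag_mono v hj hw)) _ (mem_flag v hi)
        rw [sub_mulVec, smul_mulVec, hE, hE, hw0, zero_smul, smul_zero, sub_zero]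
        by_cases hij : i < j
        · exact Submodule.smul_mem _ _ (mem_flag v hij)
        · rw [hS.form_comm, mem_perp.1 hu w (flag_mono v (by omega) hw), mul_zero, zero_smul]
          exact zero_mem _
    have htr := hxb _ (hge hmem)
    rw [mul_sub, Matrix.mul_smul, Matrix.trace_sub, Matrix.trace_smul, hEt, hEt, smul_eq_mul] at htr
    have h1 := hS.form_skew hx (v i) u
    have h2 := hS.form_comm u (x *ᵥ v i)
    have h3 : ε * form S (v i) (x *ᵥ u) = - form S u (x *ᵥ v i) := by
      rw [h2, h1]; ring
    rw [h3] at htr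
    have : (2 : ℂ) * form S u (x *ᵥ v i) = 0 := by linear_combination htr
    simpa using this
  have hstep' : ∀ i < m, ∀ w ∈ flag v (i + 1), x *ᵥ w ∈ flag v i := by
    intro i hi w hw
    refine flag_induction (p := fun w => x *ᵥ w ∈ flag v i) (by simp)
      (fun a b ha hb => by rw [mulVec_add]; exact add_mem ha hb)
      (fun c a ha => by rw [mulVec_smul]; exact Submodule.smul_mem _ c ha) (fun j hj => ?_) hw
    exact flag_mono v (by omega) (hstep j (by omega))
  have hstab : ∀ i ≤ m, ∀ w ∈ flag v i, x *ᵥ w ∈ flag v i := by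
    intro i hi w hw
    rcases Nat.eq_zero_or_pos i with rfl | hpos
    · have : w = 0 := by simpa [flag] using hw
      rw [this, mulVec_zero]
      exact zero_mem _
    · obtain ⟨k, rfl⟩ : ∃ k, i = k + 1 := ⟨i - 1, by omega⟩
      exact flag_mono v (by omega) (hstep' k (by omega) w hw)
  exact ⟨hge ⟨hx, hstab⟩, isNilpotent_of_flag hS hx hstep' (hP x hx (hstab m le_rfl))⟩

end Borel

/-! ### Parabolic subalgebras through the trace form -/

section Parabolic

variable {S : Matrix ι ι ℂ} {ε : ℂ} {R : (Matrix ι ι ℂ)ˣ}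

theorem exists_orthogonal_projection (R : (Matrix ι ι ℂ)ˣ) (N : Submodule ℂ (Matrix ι ι ℂ))
    (x : Matrix ι ι ℂ) : ∃ y ∈ N, ∀ w ∈ N, (dag R w * (x - y)).trace = 0 := by
  obtain ⟨d, b, hb⟩ := exists_orthonormal_family R N
  refine ⟨∑ i, (dag R (b i : Matrix ι ι ℂ) * x).trace • (b i : Matrix ι ι ℂ),
    sum_mem fun i _ => Submodule.smul_mem _ _ (b i).2, fun w hw => ?_⟩
  have hbi : ∀ j, (dag R (b j : Matrix ι ι ℂ) *
      (x - ∑ i, (dag R (b i : Matrix ι ι ℂ) * x).trace • (b i : Matrix ι ι ℂ))).trace = 0 := by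
    intro j
    simp [mul_sub, Matrix.trace_sub, Matrix.mul_sum, Matrix.trace_sum, hb]
  have hw' : w = ∑ i, b.repr ⟨w, hw⟩ i • (b i : Matrix ι ι ℂ) := by
    have := congrArg Subtype.val (b.sum_repr ⟨w, hw⟩)
    simpa only [Submodule.coe_sum, Submodule.coe_smul] using this.symm
  rw [hw', map_sum, Matrix.sum_mul, Matrix.trace_sum]
  refine Finset.sum_eq_zero fun i _ => ?_
  rw [map_smulₛₗ, Matrix.smul_mul, Matrix.trace_smul, hbi, smul_zero]

/-- Compatibility of the adjoints with respect to a Hermitian and a bilinear form. -/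
def IsCompatible (S : Matrix ι ι ℂ) (R : (Matrix ι ι ℂ)ˣ) : Prop :=
  ∀ x, adj S (dag R x) = dag R (adj S x)

theorem IsCompatible.dag_mem_skew (hc : IsCompatible S R) {x : Matrix ι ι ℂ} (hx : x ∈ skew S) :
    dag R x ∈ skew S := by
  rw [mem_skew] at *
  rw [hc, hx, map_neg]

/-- The properties of the parabolic subalgebras of `skew S` from which their structure follows:
the orthogonal complement for the trace form is contained in the subalgebra and nilpotent. -/
structure IsParabolicSpace (S : Matrix ι ι ℂ) (𝔭 : Submodule ℂ (Matrix ι ι ℂ)) : Prop where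
  le_skew : 𝔭 ≤ skew S
  lie_mem : ∀ x ∈ 𝔭, ∀ y ∈ 𝔭, x * y - y * x ∈ 𝔭
  orthogonal : ∀ x ∈ skew S, (∀ y ∈ 𝔭, (x * y).trace = 0) → x ∈ 𝔭 ∧ IsNilpotent x

/-- The orthogonal complement of `𝔭` in `skew S` for the trace form. -/
def nilrad (S : Matrix ι ι ℂ) (𝔭 : Submodule ℂ (Matrix ι ι ℂ)) :
    Submodule ℂ (Matrix ι ι ℂ) where
  carrier := {x | x ∈ skew S ∧ ∀ y ∈ 𝔭, (x * y).trace = 0}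
  add_mem' := fun {x y} hx hy => ⟨add_mem hx.1 hy.1, fun z hz => by
    rw [add_mul, Matrix.trace_add, hx.2 z hz, hy.2 z hz, add_zero]⟩
  zero_mem' := ⟨zero_mem _, fun z _ => by simp⟩
  smul_mem' := fun c x hx => ⟨Submodule.smul_mem _ c hx.1, fun z hz => by
    rw [Matrix.smul_mul, Matrix.trace_smul, hx.2 z hz, smul_zero]⟩

variable {𝔭 : Submodule ℂ (Matrix ι ι ℂ)}

theorem trace_lie_mul (x y z : Matrix ι ι ℂ) :
    ((x * y - y * x) * z).trace = (x * (y * z - z * y)).trace := by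
  rw [sub_mul, mul_sub, Matrix.trace_sub, Matrix.trace_sub, Matrix.mul_assoc,
    Matrix.mul_assoc y x z, Matrix.trace_mul_comm y, Matrix.mul_assoc x z y]

theorem trace_dag_mul_comm (R : (Matrix ι ι ℂ)ˣ) (x y : Matrix ι ι ℂ) :
    (dag R x * y).trace = star (dag R y * x).trace := by
  rw [← trace_dag, dag_mul, dag_dag]

namespace IsParabolicSpace

theorem nilrad_le (hp : IsParabolicSpace S 𝔭) : nilrad S 𝔭 ≤ 𝔭 := fun x hx =>
  (hp.orthogonal x hx.1 hx.2).1

theorem isNilpotent (hp : IsParabolicSpace S 𝔭) {x : Matrix ι ι ℂ} (hx : x ∈ nilrad S 𝔭) :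
    IsNilpotent x :=
  (hp.orthogonal x hx.1 hx.2).2

theorem lie_mem_nilrad (hS : IsFormMatrix S ε) (hp : IsParabolicSpace S 𝔭) {x y : Matrix ι ι ℂ}
    (hx : x ∈ nilrad S 𝔭) (hy : y ∈ 𝔭) : x * y - y * x ∈ nilrad S 𝔭 :=
  ⟨hS.lie_mem_skew hx.1 (hp.le_skew hy), fun z hz => by
    rw [trace_lie_mul, hx.2 _ (hp.lie_mem y hy z hz)]⟩

/-- Let y be the orthogonal projection of x to 𝔭. Then (x - y)† is trace-orthogonal to 𝔭, so it
belongs to 𝔫; its pairing with x - y is a squared norm, and the hypothesis makes it zero. -/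
theorem mem_of_orthogonal_nilrad (hc : IsCompatible S R) (hp : IsParabolicSpace S 𝔭)
    {x : Matrix ι ι ℂ} (hx : x ∈ skew S) (h : ∀ u ∈ nilrad S 𝔭, (x * u).trace = 0) : x ∈ 𝔭 := by
  obtain ⟨y, hy, hxy⟩ := exists_orthogonal_projection R 𝔭 x
  have hz : dag R (x - y) ∈ nilrad S 𝔭 :=
    ⟨hc.dag_mem_skew (sub_mem hx (hp.le_skew hy)), fun w hw => by
      rw [trace_dag_mul_comm, hxy w hw, star_zero]⟩
  have h0 : (dag R (x - y) * (x - y)).trace = 0 := by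
    rw [mul_sub, Matrix.trace_sub, hz.2 y hy, sub_zero, Matrix.trace_mul_comm, h _ hz]
  have := eq_zero_of_trace_dag_mul_self_re R (x := x - y) (by rw [h0]; rfl)
  rw [sub_eq_zero] at this
  rwa [this]

/-- Every skew matrix is a sum of elements of `n`, `𝔭 ∩ 𝔭†` and `n†`. -/
theorem exists_decomposition (hc : IsCompatible S R) (hp : IsParabolicSpace S 𝔭)
    {x : Matrix ι ι ℂ} (hx : x ∈ skew S) : ∃ u y z, u ∈ nilrad S 𝔭 ∧ y ∈ 𝔭 ∧ dag R y ∈ 𝔭 ∧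
      dag R z ∈ nilrad S 𝔭 ∧ x = u + y + z ∧ (x ∈ 𝔭 → z = 0) := by
  obtain ⟨y, hy, hxy⟩ := exists_orthogonal_projection R 𝔭 x
  obtain ⟨u, hu, hyu⟩ := exists_orthogonal_projection R (nilrad S 𝔭) y
  have hz : dag R (x - y) ∈ nilrad S 𝔭 :=
    ⟨hc.dag_mem_skew (sub_mem hx (hp.le_skew hy)), fun w hw => by
      rw [trace_dag_mul_comm, hxy w hw, star_zero]⟩
  have hyu' : y - u ∈ 𝔭 := sub_mem hy (hp.nilrad_le hu)
  refine ⟨u, y - u, x - y, hu, hyu', ?_, hz, by abel, fun hx' => ?_⟩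
  · refine hp.mem_of_orthogonal_nilrad hc (hc.dag_mem_skew (hp.le_skew hyu')) fun w hw => ?_
    rw [trace_dag_mul_comm, hyu w hw, star_zero]
  · exact eq_zero_of_trace_dag_mul_self_re R (by rw [hxy _ (sub_mem hx' hy)]; rfl)

end IsParabolicSpace

/-- The derivation of `n` induced by an element of `𝔭`. -/
def adNilrad (hS : IsFormMatrix S ε) (hp : IsParabolicSpace S 𝔭) {x : Matrix ι ι ℂ}
    (hx : x ∈ 𝔭) : nilrad S 𝔭 →ₗ[ℂ] nilrad S 𝔭 :=
  (LinearMap.mulLeft ℂ x - LinearMap.mulRight ℂ x).restrict fun y hy => by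
    have := neg_mem (hp.lie_mem_nilrad hS hy hx)
    simpa using this

theorem adNilrad_apply (hS : IsFormMatrix S ε) (hp : IsParabolicSpace S 𝔭) {x : Matrix ι ι ℂ}
    (hx : x ∈ 𝔭) (y : nilrad S 𝔭) : (adNilrad hS hp hx y : Matrix ι ι ℂ) = x * y - y * x := rfl

/-- `H` represents, for the trace form, the trace of the adjoint action on `n`. -/
theorem exists_rho (hS : IsFormMatrix S ε) (hc : IsCompatible S R) (hp : IsParabolicSpace S 𝔭) :
    ∃ H ∈ skew S, dag R H = H ∧
      (∀ x (hx : x ∈ 𝔭), (H * x).trace = LinearMap.trace ℂ _ (adNilrad hS hp hx)) ∧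
      ∀ x ∈ nilrad S 𝔭, x ≠ 0 → 0 < (dag R x * (H * x - x * H)).trace.re := by
  obtain ⟨d, b, hb⟩ := exists_orthonormal_family R (nilrad S 𝔭)
  have hb' : ∀ i j, ((b i : Matrix ι ι ℂ) * dag R (b j : Matrix ι ι ℂ)).trace =
      if i = j then 1 else 0 := fun i j => by
    rw [Matrix.trace_mul_comm, hb]; simp [eq_comm]
  have hrepr : ∀ (y : nilrad S 𝔭) i, b.repr y i = (dag R (b i : Matrix ι ι ℂ) * y).trace := by
    intro y i
    have h1 : (y : Matrix ι ι ℂ) = ∑ j, b.repr y j • (b j : Matrix ι ι ℂ) := by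
      have := congrArg Subtype.val (b.sum_repr y)
      simpa only [Submodule.coe_sum, Submodule.coe_smul] using this.symm
    conv_rhs => rw [h1]
    simp [Matrix.mul_sum, Matrix.trace_sum, hb]
  -- For an orthonormal basis b i of 𝔫 the element ∑ [b i, (b i)†] represents the adjoint trace:
  -- tr(Hx) = ∑ tr((b i)† [x, b i]).
  set H : Matrix ι ι ℂ := ∑ i, ((b i : Matrix ι ι ℂ) * dag R (b i : Matrix ι ι ℂ) -
    dag R (b i : Matrix ι ι ℂ) * (b i : Matrix ι ι ℂ)) with hH
  have hHt : ∀ x : Matrix ι ι ℂ, (H * x).trace =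
      ∑ i, (dag R (b i : Matrix ι ι ℂ) * (x * (b i : Matrix ι ι ℂ) - (b i : Matrix ι ι ℂ) * x)).trace := by
    intro x
    rw [hH, Matrix.sum_mul, Matrix.trace_sum]
    refine Finset.sum_congr rfl fun i _ => ?_
    rw [sub_mul, mul_sub, Matrix.trace_sub, Matrix.trace_sub, Matrix.mul_assoc,
      Matrix.trace_mul_comm, Matrix.mul_assoc, Matrix.mul_assoc]
  refine ⟨H, ?_, ?_, ?_, ?_⟩
  · exact sum_mem fun i _ => hS.lie_mem_skew (b i).2.1 (hc.dag_mem_skew (b i).2.1)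
  · rw [hH, map_sum]
    refine Finset.sum_congr rfl fun i _ => ?_
    rw [map_sub, dag_mul, dag_mul, dag_dag]
  · intro x hx
    rw [hHt, LinearMap.trace_eq_matrix_trace ℂ b, Matrix.trace]
    refine Finset.sum_congr rfl fun i _ => ?_
    rw [Matrix.diag_apply, LinearMap.toMatrix_apply, hrepr, adNilrad_apply]
  · intro x hx hx0
    have key : ∀ a : Matrix ι ι ℂ, ((a * dag R a - dag R a * a) * (x * dag R x - dag R x * x)).trace =
        (dag R (dag R a * x - x * dag R a) * (dag R a * x - x * dag R a)).trace -
        (dag R (a * x - x * a) * (a * x - x * a)).trace := by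
      intro a
      rw [map_sub, map_sub, dag_mul, dag_mul, dag_mul, dag_mul, dag_dag]
      generalize dag R a = a'
      generalize dag R x = x'
      have c1 : (x' * a * a' * x).trace = (a * a' * x * x').trace := by
        rw [Matrix.mul_assoc, Matrix.mul_assoc, Matrix.trace_mul_comm]; simp only [Matrix.mul_assoc]
      have c2 : (a * x' * x * a').trace = (a' * a * x' * x).trace := by
        rw [Matrix.trace_mul_comm]; simp only [Matrix.mul_assoc]
      have c3 : (x' * a' * a * x).trace = (a' * a * x * x').trace := by
        rw [Matrix.mul_assoc, Matrix.mul_assoc, Matrix.trace_mul_comm]; simp only [Matrix.mul_assoc]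
      have c4 : (a' * x' * x * a).trace = (a * a' * x' * x).trace := by
        rw [Matrix.trace_mul_comm]; simp only [Matrix.mul_assoc]
      have c5 : (x' * a * x * a').trace = (a' * x' * a * x).trace := by
        rw [Matrix.trace_mul_comm]; simp only [Matrix.mul_assoc]
      have c6 : (a * x' * a' * x).trace = (x' * a' * x * a).trace := by
        rw [Matrix.mul_assoc, Matrix.mul_assoc, Matrix.trace_mul_comm]; simp only [Matrix.mul_assoc]
      simp only [mul_sub, sub_mul, Matrix.trace_sub, ← Matrix.mul_assoc]
      rw [c1, c2, c3, c4, c5, c6]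
      ring
    let c : Fin d → Fin d → ℂ := fun i j =>
      ((b j : Matrix ι ι ℂ) * (dag R (b i : Matrix ι ι ℂ) * x - x * dag R (b i : Matrix ι ι ℂ))).trace
    -- The part of [(b i)†, x] orthogonal to 𝔫†. Up to sign, c i j is also the coefficient of [b j,
    -- x] at b i, so these terms cancel in the sum over the basis and tr(x† [H, x]) = ∑ ‖r i‖².
    let r : Fin d → Matrix ι ι ℂ := fun i =>
      (dag R (b i : Matrix ι ι ℂ) * x - x * dag R (b i : Matrix ι ι ℂ)) -
        ∑ j, c i j • dag R (b j : Matrix ι ι ℂ)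
    have hr : ∀ i, dag R (b i : Matrix ι ι ℂ) * x - x * dag R (b i : Matrix ι ι ℂ) =
        r i + ∑ j, c i j • dag R (b j : Matrix ι ι ℂ) := fun i => by simp [r]
    have hrb : ∀ i j, ((b j : Matrix ι ι ℂ) * r i).trace = 0 := by
      intro i j
      simp only [r]
      rw [mul_sub, Matrix.trace_sub, Matrix.mul_sum, Matrix.trace_sum]
      simp [hb', c]
    have hrb' : ∀ i j, (dag R (r i) * dag R (b j : Matrix ι ι ℂ)).trace = 0 := by
      intro i j
      rw [← dag_mul, trace_dag, hrb, star_zero]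
    have norm1 : ∀ i, (dag R (dag R (b i : Matrix ι ι ℂ) * x - x * dag R (b i : Matrix ι ι ℂ)) *
        (dag R (b i : Matrix ι ι ℂ) * x - x * dag R (b i : Matrix ι ι ℂ))).trace =
        (dag R (r i) * r i).trace + ∑ j, star (c i j) * c i j := by
      intro i
      rw [hr, map_add, map_sum]
      simp only [map_smulₛₗ, dag_dag, add_mul, mul_add, Matrix.trace_add, Matrix.sum_mul,
        Matrix.mul_sum, Matrix.trace_sum, Matrix.smul_mul, Matrix.mul_smul, Matrix.trace_smul, hrb,
        hrb', smul_zero, Finset.sum_const_zero, add_zero, zero_add, hb', smul_eq_mul, mul_ite,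
        mul_one, mul_zero, Finset.sum_ite_eq, Finset.mem_univ, if_true, starRingEnd_apply,
        Finset.sum_ite_eq']
      congr 1
      exact Finset.sum_congr rfl fun _ _ => mul_comm _ _
    have norm2 : ∀ i, (dag R ((b i : Matrix ι ι ℂ) * x - x * (b i : Matrix ι ι ℂ)) *
        ((b i : Matrix ι ι ℂ) * x - x * (b i : Matrix ι ι ℂ))).trace =
        ∑ j, star (c j i) * c j i := by
      intro i
      have hmem := hp.lie_mem_nilrad hS (b i).2 (hp.nilrad_le hx)
      have e1 : (b i : Matrix ι ι ℂ) * x - x * (b i : Matrix ι ι ℂ) =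
          ∑ j, (- c j i) • (b j : Matrix ι ι ℂ) := by
        have h1 := congrArg Subtype.val (b.sum_repr ⟨_, hmem⟩)
        simp only [Submodule.coe_sum, Submodule.coe_smul] at h1
        rw [← h1]
        refine Finset.sum_congr rfl fun j _ => ?_
        congr 1
        rw [hrepr]
        simp only [c]
        rw [← Matrix.trace_neg, ← mul_neg, neg_sub, Matrix.trace_mul_comm (dag R _)]
        exact trace_lie_mul _ _ _
      rw [e1, map_sum]
      simp only [map_smulₛₗ, Matrix.sum_mul,
        Matrix.mul_sum, Matrix.trace_sum, Matrix.smul_mul, Matrix.mul_smul, Matrix.trace_smul,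
        hb, smul_eq_mul, mul_ite, map_neg, neg_mul, mul_neg, neg_neg,
        mul_one, mul_zero, Finset.sum_ite_eq, Finset.mem_univ, if_true, starRingEnd_apply,
        Finset.sum_ite_eq', neg_zero]
      exact Finset.sum_congr rfl fun _ _ => mul_comm _ _
    have total : (dag R x * (H * x - x * H)).trace = ∑ i, (dag R (r i) * r i).trace := by
      have e1 : (dag R x * (H * x - x * H)).trace = (H * (x * dag R x - dag R x * x)).trace := by
        rw [Matrix.trace_mul_comm, trace_lie_mul]
      rw [e1, hH, Matrix.sum_mul, Matrix.trace_sum]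
      simp only [key, norm1, norm2]
      rw [Finset.sum_sub_distrib, Finset.sum_add_distrib]
      rw [Finset.sum_comm (f := fun i j => star (c j i) * c j i)]
      ring
    rw [total, Complex.re_sum]
    refine lt_of_le_of_ne (Finset.sum_nonneg fun i _ => trace_dag_mul_self_re_nonneg R _) ?_
    intro h0
    have hr0 : ∀ i, r i = 0 := fun i => eq_zero_of_trace_dag_mul_self_re R
      ((Finset.sum_eq_zero_iff_of_nonneg fun i _ => trace_dag_mul_self_re_nonneg R _).1 h0.symm i
        (Finset.mem_univ i))
    -- If all r i vanish, every [(b i)†, x] lies in 𝔫†, so [x†, x] is a self-adjoint element of 𝔫.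
    -- The trace form is zero on 𝔫, hence x is normal; being nilpotent, it is zero.
    have hmem : ∀ i, dag R (dag R (b i : Matrix ι ι ℂ) * x - x * dag R (b i : Matrix ι ι ℂ)) ∈
        nilrad S 𝔭 := by
      intro i
      rw [hr, hr0, zero_add, map_sum]
      refine sum_mem fun j _ => ?_
      rw [map_smulₛₗ, dag_dag]
      exact Submodule.smul_mem _ _ (b j).2
    have hx' : x = ∑ i, b.repr ⟨x, hx⟩ i • (b i : Matrix ι ι ℂ) := by
      have := congrArg Subtype.val (b.sum_repr ⟨x, hx⟩)
      simpa only [Submodule.coe_sum, Submodule.coe_smul] using this.symm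
    have hw : dag R x * x - x * dag R x ∈ nilrad S 𝔭 := by
      have e1 : dag R x * x - x * dag R x = dag R (dag R x * x - x * dag R x) := by
        rw [map_sub, dag_mul, dag_mul, dag_dag]
      have e2 : dag R x * x - x * dag R x =
          ∑ i, star (b.repr ⟨x, hx⟩ i) • (dag R (b i : Matrix ι ι ℂ) * x - x * dag R (b i : Matrix ι ι ℂ)) := by
        have e3 : dag R x = ∑ i, star (b.repr ⟨x, hx⟩ i) • dag R (b i : Matrix ι ι ℂ) := by
          conv_lhs => rw [hx', map_sum]
          simp only [map_smulₛₗ, starRingEnd_apply]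
        rw [e3, Matrix.sum_mul, Matrix.mul_sum, ← Finset.sum_sub_distrib]
        simp only [Matrix.smul_mul, Matrix.mul_smul, smul_sub]
      rw [e1, e2, map_sum]
      refine sum_mem fun i _ => ?_
      rw [map_smulₛₗ]
      exact Submodule.smul_mem _ _ (hmem i)
    have hw0 : dag R x * x - x * dag R x = 0 := by
      refine eq_zero_of_trace_dag_mul_self_re R ?_
      have e1 : dag R (dag R x * x - x * dag R x) = dag R x * x - x * dag R x := by
        rw [map_sub, dag_mul, dag_mul, dag_dag]
      rw [e1, hw.2 _ (hp.nilrad_le hw)]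
      rfl
    apply hx0
    apply eq_zero_of_dag_mul_self R
    refine eq_zero_of_isNilpotent_of_dag_eq R ?_ (by rw [dag_mul, dag_dag])
    exact Commute.isNilpotent_mul_left (sub_eq_zero.1 hw0) (hp.isNilpotent hx)

end Parabolic

/-! ### Spectral projections of the grading element -/

section Spectral

/-- `p` is the family of spectral projections of the self-adjoint matrix `H` and `s` is its
spectrum. -/
structure IsSpectral (R : (Matrix ι ι ℂ)ˣ) (H : Matrix ι ι ℂ) (s : Finset ℝ)
    (p : ℝ → Matrix ι ι ℂ) : Prop where
  mem_iff : ∀ c, c ∈ s ↔ p c ≠ 0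
  idem : ∀ c, p c * p c = p c
  ortho : ∀ c d, c ≠ d → p c * p d = 0
  sum_eq : ∑ c ∈ s, p c = 1
  dag_eq : ∀ c, dag R (p c) = p c
  left : ∀ c, H * p c = (c : ℂ) • p c
  right : ∀ c, p c * H = (c : ℂ) • p c

theorem exists_isSpectral (R : (Matrix ι ι ℂ)ˣ) {H : Matrix ι ι ℂ} (hH : dag R H = H) :
    ∃ s p, IsSpectral R H s p := by
  classical
  obtain ⟨W, μ, hW, hν⟩ := exists_diagonalization R hH
  let p : ℝ → Matrix ι ι ℂ := fun c =>
    (W : Matrix ι ι ℂ) * diagonal (fun i => if μ i = c then 1 else 0) * (↑W⁻¹ : Matrix ι ι ℂ)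
  have h0 : ∀ ν : ι → ℂ, (∀ i, ν i = 0) →
      (W : Matrix ι ι ℂ) * diagonal ν * (↑W⁻¹ : Matrix ι ι ℂ) = 0 := by
    intro ν h
    have : diagonal ν = 0 := by ext i j; simp [diagonal_apply, h]
    rw [this]; simp
  refine ⟨Finset.univ.image μ, p, ⟨fun c => ?_, fun c => ?_, fun c d hcd => ?_, ?_, fun c => ?_,
    fun c => ?_, fun c => ?_⟩⟩
  · constructor
    · intro hc h
      obtain ⟨i, -, rfl⟩ := Finset.mem_image.1 hc
      have h1 : diagonal (fun j => if μ j = μ i then (1 : ℂ) else 0) = 0 := by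
        calc _ = (↑W⁻¹ : Matrix ι ι ℂ) * p (μ i) * W := by simp [p, Matrix.mul_assoc]
          _ = 0 := by rw [h]; simp
      have := congrFun (congrFun h1 i) i
      simp at this
    · intro h
      by_contra hc
      apply h
      apply h0
      intro i
      rw [if_neg]
      rintro rfl
      exact hc (Finset.mem_image_of_mem _ (Finset.mem_univ i))
  · simp only [p]
    rw [conj_diagonal_mul]
    congr 3
    ext i
    split_ifs <;> simp
  · simp only [p]
    rw [conj_diagonal_mul]
    apply h0
    intro i
    by_cases h : μ i = c
    · rw [if_neg (c := μ i = d) (by rw [h]; exact hcd), mul_zero]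
    · rw [if_neg h, zero_mul]
  · simp only [p]
    rw [← Matrix.sum_mul, ← Matrix.mul_sum]
    have : ∑ c ∈ Finset.univ.image μ, diagonal (fun i => if μ i = c then (1 : ℂ) else 0) = 1 := by
      ext i j
      rw [Matrix.sum_apply]
      by_cases hij : i = j
      · subst hij
        simp
      · simp [hij]
    rw [this]; simp
  · simp only [p]
    rw [hν]
    congr 3
    ext i
    by_cases h : μ i = c <;> simp [h]
  · simp only [p]
    rw [hW, conj_diagonal_mul, ← Matrix.smul_mul, ← Matrix.mul_smul]
    congr 2
    ext i j
    by_cases hij : i = j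
    · subst hij
      by_cases h : μ i = c <;> simp [h]
    · simp [hij]
  · simp only [p]
    rw [hW, conj_diagonal_mul, ← Matrix.smul_mul, ← Matrix.mul_smul]
    congr 2
    ext i j
    by_cases hij : i = j
    · subst hij
      by_cases h : μ i = c <;> simp [h]
    · simp [hij]

namespace IsSpectral

variable {S : Matrix ι ι ℂ} {ε : ℂ} {R : (Matrix ι ι ℂ)ˣ} {H : Matrix ι ι ℂ} {s : Finset ℝ}
  {p : ℝ → Matrix ι ι ℂ}

theorem eq_zero (h : IsSpectral R H s p) {c : ℝ} (hc : c ∉ s) : p c = 0 := by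
  by_contra h0
  exact hc ((h.mem_iff c).2 h0)

theorem expand_left (h : IsSpectral R H s p) (x : Matrix ι ι ℂ) : x = ∑ c ∈ s, p c * x := by
  rw [← Matrix.sum_mul, h.sum_eq, Matrix.one_mul]

theorem expand_right (h : IsSpectral R H s p) (x : Matrix ι ι ℂ) : x = ∑ c ∈ s, x * p c := by
  rw [← Matrix.mul_sum, h.sum_eq, Matrix.mul_one]

theorem expand (h : IsSpectral R H s p) (x : Matrix ι ι ℂ) :
    x = ∑ c ∈ s, ∑ d ∈ s, p c * x * p d := by
  conv_lhs => rw [h.expand_left x]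
  exact Finset.sum_congr rfl fun c _ => h.expand_right _

theorem expand_mul (h : IsSpectral R H s p) (x y : Matrix ι ι ℂ) (c d : ℝ) :
    p c * (x * y) * p d = ∑ e ∈ s, (p c * x * p e) * (p e * y * p d) := by
  conv_lhs => rw [h.expand_right x]
  rw [Matrix.sum_mul, Matrix.mul_sum, Matrix.sum_mul]
  refine Finset.sum_congr rfl fun e _ => ?_
  conv_lhs => rw [← h.idem e]
  simp only [Matrix.mul_assoc]

theorem ext_blocks (h : IsSpectral R H s p) {x y : Matrix ι ι ℂ}
    (hxy : ∀ c ∈ s, ∀ d ∈ s, p c * x * p d = p c * y * p d) : x = y := by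
  rw [h.expand x, h.expand y]
  exact Finset.sum_congr rfl fun c hc => Finset.sum_congr rfl fun d hd => hxy c hc d hd

theorem block_lie (h : IsSpectral R H s p) (x : Matrix ι ι ℂ) (c d : ℝ) :
    p c * (H * x - x * H) * p d = ((c : ℂ) - d) • (p c * x * p d) := by
  rw [mul_sub, sub_mul, ← Matrix.mul_assoc, h.right, ← Matrix.mul_assoc, Matrix.mul_assoc _ H,
    h.left, Matrix.smul_mul, Matrix.smul_mul, Matrix.mul_smul, sub_smul]

theorem block_block (h : IsSpectral R H s p) (x : Matrix ι ι ℂ) (c d c' d' : ℝ) :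
    p c' * (p c * x * p d) * p d' = if c' = c ∧ d = d' then p c * x * p d else 0 := by
  split_ifs with hif
  · rw [hif.1, hif.2, ← Matrix.mul_assoc, ← Matrix.mul_assoc, h.idem, Matrix.mul_assoc, h.idem]
  · rw [not_and_or] at hif
    rcases hif with h1 | h1
    · rw [← Matrix.mul_assoc, ← Matrix.mul_assoc, h.ortho _ _ h1]; simp
    · rw [Matrix.mul_assoc, Matrix.mul_assoc _ (p d), h.ortho _ _ h1]; simp

theorem commute_iff (h : IsSpectral R H s p) {x : Matrix ι ι ℂ} :
    H * x = x * H ↔ ∀ c d, c ≠ d → p c * x * p d = 0 := by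
  constructor
  · intro hx c d hcd
    have := h.block_lie x c d
    rw [hx, sub_self, Matrix.mul_zero, Matrix.zero_mul] at this
    refine (smul_eq_zero.1 this.symm).resolve_left ?_
    exact sub_ne_zero.2 (by exact_mod_cast hcd)
  · intro hx
    rw [← sub_eq_zero]
    apply h.ext_blocks
    intro c _ d _
    rw [h.block_lie, Matrix.mul_zero, Matrix.zero_mul]
    by_cases hcd : c = d
    · simp [hcd]
    · rw [hx c d hcd, smul_zero]

theorem commute_proj (h : IsSpectral R H s p) {x : Matrix ι ι ℂ} (hx : H * x = x * H) (c : ℝ) :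
    p c * x = x * p c := by
  by_cases hc : c ∈ s
  · rw [h.commute_iff] at hx
    have h1 : p c * x = p c * x * p c := by
      conv_lhs => rw [h.expand_right (p c * x)]
      rw [Finset.sum_eq_single c (fun d _ hd => hx c d hd.symm) (fun h' => absurd hc h')]
    have h2 : x * p c = p c * x * p c := by
      conv_lhs => rw [h.expand_left (x * p c)]
      rw [Finset.sum_eq_single c (fun d _ hd => by rw [← Matrix.mul_assoc, hx d c hd])
        (fun h' => absurd hc h'), Matrix.mul_assoc]
    rw [h1, h2]
  · rw [h.eq_zero hc]; simp

/-- As H is skew, `adj S` turns right c-eigenvectors of H into left (-c)-eigenvectors;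
geometrically, the form pairs V_c with V_{-c}. -/
theorem adj_eq (h : IsSpectral R H s p) (hS : IsFormMatrix S ε) (hH : H ∈ skew S) (c : ℝ) :
    adj S (p c) = p (-c) := by
  rw [mem_skew] at hH
  have e1 : ∀ c, H * adj S (p c) = (-c : ℂ) • adj S (p c) := by
    intro c
    have := congrArg (adj S) (h.right c)
    rw [hS.adj_mul, hH, map_smul, neg_mul] at this
    rw [neg_smul, ← this, neg_neg]
  have e2 : ∀ c, adj S (p c) * H = (-c : ℂ) • adj S (p c) := by
    intro c
    have := congrArg (adj S) (h.left c)
    rw [hS.adj_mul, hH, map_smul, mul_neg] at this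
    rw [neg_smul, ← this, neg_neg]
  have e3 : ∀ c d, d ≠ -c → p d * adj S (p c) = 0 := by
    intro c d hd
    have h1 : ((d : ℂ) - (-c : ℂ)) • (p d * adj S (p c)) = 0 := by
      rw [sub_smul, ← Matrix.smul_mul, ← h.right, Matrix.mul_assoc, e1, Matrix.mul_smul, sub_self]
    refine (smul_eq_zero.1 h1).resolve_left ?_
    exact sub_ne_zero.2 (by exact_mod_cast hd)
  have e4 : ∑ d ∈ s, adj S (p d) = 1 := by rw [← map_sum, h.sum_eq, hS.adj_one]
  have e5 : adj S (p c) = p (-c) * adj S (p c) := by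
    conv_lhs => rw [h.expand_left (adj S (p c))]
    by_cases hc : -c ∈ s
    · rw [Finset.sum_eq_single (-c) (fun d _ hd => e3 c d hd) (fun h' => absurd hc h')]
    · rw [h.eq_zero hc, Matrix.zero_mul]
      exact Finset.sum_eq_zero fun d hd => e3 c d (fun h' => hc (h' ▸ hd))
  have e6 : p (-c) = p (-c) * adj S (p c) := by
    conv_lhs => rw [← Matrix.mul_one (p (-c)), ← e4, Matrix.mul_sum]
    by_cases hc : c ∈ s
    · rw [Finset.sum_eq_single c (fun d _ hd => e3 d _ (by simpa using hd.symm))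
        (fun h' => absurd hc h')]
    · rw [h.eq_zero hc, map_zero, Matrix.mul_zero]
      exact Finset.sum_eq_zero fun d hd => e3 d _ (by
        rintro h'
        rw [neg_inj] at h'
        exact hc (h' ▸ hd))
  rw [e5, ← e6]

theorem neg_mem (h : IsSpectral R H s p) (hS : IsFormMatrix S ε) (hH : H ∈ skew S) {c : ℝ}
    (hc : c ∈ s) : -c ∈ s := by
  rw [h.mem_iff] at hc ⊢
  intro h0
  apply hc
  rw [← hS.adj_adj (p c), h.adj_eq hS hH, h0, map_zero]

theorem adj_block (h : IsSpectral R H s p) (hS : IsFormMatrix S ε) (hH : H ∈ skew S)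
    (x : Matrix ι ι ℂ) (c d : ℝ) : adj S (p c * x * p d) = p (-d) * adj S x * p (-c) := by
  rw [hS.adj_mul, hS.adj_mul, h.adj_eq hS hH, h.adj_eq hS hH, Matrix.mul_assoc]

end IsSpectral

/-- Block upper triangular matrices for a family of projections. -/
def IsUpper (p : ℝ → Matrix ι ι ℂ) (x : Matrix ι ι ℂ) : Prop :=
  ∀ c d, c < d → p c * x * p d = 0

/-- Strictly block upper triangular matrices for a family of projections. -/
def IsStrict (p : ℝ → Matrix ι ι ℂ) (x : Matrix ι ι ℂ) : Prop :=
  ∀ c d, c ≤ d → p c * x * p d = 0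

/-- Applying T - k0 removes one component and multiplies the others by non-zero scalars, so
induction on the set of eigenvalues applies. -/
theorem mem_of_sum_eigenvectors {V : Type*} [AddCommGroup V] [Module ℂ V] (T : Module.End ℂ V)
    (N : Submodule ℂ V) (hT : ∀ v ∈ N, T v ∈ N) (s : Finset ℂ) :
    ∀ v : ℂ → V, (∀ k ∈ s, T (v k) = k • v k) → ∑ k ∈ s, v k ∈ N → ∀ k ∈ s, v k ∈ N := by
  classical
  induction s using Finset.induction_on with
  | empty => simp
  | insert k0 s hk0 ih =>
    intro v hv hsum
    have h1 : ∑ k ∈ s, (k - k0) • v k ∈ N := by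
      have : ∑ k ∈ s, (k - k0) • v k = T (∑ k ∈ insert k0 s, v k) - k0 • ∑ k ∈ insert k0 s, v k := by
        rw [map_sum, Finset.sum_insert hk0, Finset.sum_insert hk0, hv k0 (by simp), smul_add,
          Finset.smul_sum, add_sub_add_left_eq_sub, ← Finset.sum_sub_distrib]
        refine Finset.sum_congr rfl fun k hk => ?_
        rw [hv k (by simp [hk]), sub_smul]
      rw [this]
      exact sub_mem (hT _ hsum) (Submodule.smul_mem _ _ hsum)
    have h2 : ∀ k ∈ s, v k ∈ N := by
      intro k hk
      have := ih (fun k => (k - k0) • v k) (fun k hk => by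
        rw [map_smul, hv k (by simp [hk]), smul_comm]) h1 k hk
      have hne : k - k0 ≠ 0 := sub_ne_zero.2 (fun h => hk0 (h ▸ hk))
      exact (Submodule.smul_mem_iff _ hne).1 this
    intro k hk
    rcases Finset.mem_insert.1 hk with rfl | hk
    · rw [Finset.sum_insert hk0] at hsum
      exact (Submodule.add_mem_iff_left _ (sum_mem h2)).1 hsum
    · exact h2 k hk

end Spectral

/-! ### The isometry group and its adjoint action -/

/-- The group of all matrices of determinant one preserving the bilinear form `S`. -/
def isoGroup (S : Matrix ι ι ℂ) {ε : ℂ} (hS : IsFormMatrix S ε) : Subgroup (GL ι ℂ) where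
  carrier := {g | adj S (g : Matrix ι ι ℂ) * (g : Matrix ι ι ℂ) = 1 ∧ (g : Matrix ι ι ℂ).det = 1}
  mul_mem' := by
    rintro a b ⟨ha, ha'⟩ ⟨hb, hb'⟩
    refine ⟨?_, by rw [Units.val_mul, Matrix.det_mul, ha', hb', one_mul]⟩
    rw [Units.val_mul, hS.adj_mul, Matrix.mul_assoc, ← Matrix.mul_assoc (adj S (a : Matrix ι ι ℂ)),
      ha, Matrix.one_mul, hb]
  one_mem' := ⟨by simp [hS.adj_one], by simp⟩
  inv_mem' := by
    rintro a ⟨ha, ha'⟩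
    have h1 : (↑a⁻¹ : Matrix ι ι ℂ) = adj S (a : Matrix ι ι ℂ) := by
      rw [Matrix.coe_units_inv]; exact Matrix.inv_eq_left_inv ha
    refine ⟨?_, ?_⟩
    · rw [h1, hS.adj_adj, mul_eq_one_comm.1 ha]
    · rw [h1, hS.det_adj, ha']

section Iso

variable {S : Matrix ι ι ℂ} {ε : ℂ} {hS : IsFormMatrix S ε}

theorem mem_isoGroup {g : GL ι ℂ} : g ∈ isoGroup S hS ↔
    adj S (g : Matrix ι ι ℂ) * (g : Matrix ι ι ℂ) = 1 ∧ (g : Matrix ι ι ℂ).det = 1 := Iff.rfl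

theorem inv_eq_adj {g : GL ι ℂ} (hg : g ∈ isoGroup S hS) :
    (↑g⁻¹ : Matrix ι ι ℂ) = adj S (g : Matrix ι ι ℂ) := by
  rw [Matrix.coe_units_inv]; exact Matrix.inv_eq_left_inv hg.1

theorem Ad_mem_skew {g : GL ι ℂ} (hg : g ∈ isoGroup S hS) {x : Matrix ι ι ℂ} (hx : x ∈ skew S) :
    Ad g x ∈ skew S := by
  rw [mem_skew] at *
  rw [Ad, inv_eq_adj hg, hS.adj_mul, hS.adj_mul, hS.adj_adj, hx]
  simp [Matrix.mul_assoc]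

end Iso

theorem Ad_mul (g h : GL ι ℂ) (x : Matrix ι ι ℂ) : Ad (g * h) x = Ad g (Ad h x) := by
  simp [Ad, Matrix.mul_assoc]

theorem Ad_one (x : Matrix ι ι ℂ) : Ad 1 x = x := by simp [Ad]

theorem Ad_inv_Ad (g : GL ι ℂ) (x : Matrix ι ι ℂ) : Ad g⁻¹ (Ad g x) = x := by
  rw [← Ad_mul, inv_mul_cancel, Ad_one]

theorem Ad_Ad_inv (g : GL ι ℂ) (x : Matrix ι ι ℂ) : Ad g (Ad g⁻¹ x) = x := by
  rw [← Ad_mul, mul_inv_cancel, Ad_one]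

theorem trace_Ad (g : GL ι ℂ) (x : Matrix ι ι ℂ) : (Ad g x).trace = x.trace := by
  rw [Ad, Matrix.trace_mul_comm, ← Matrix.mul_assoc, Units.inv_mul, Matrix.one_mul]

theorem Ad_mul_mul (g : GL ι ℂ) (x y : Matrix ι ι ℂ) : Ad g (x * y) = Ad g x * Ad g y := by
  simp only [Ad, Matrix.mul_assoc, Units.inv_mul_cancel_left]

/-- The adjoint action as a linear map. -/
def AdLin (g : GL ι ℂ) : Matrix ι ι ℂ →ₗ[ℂ] Matrix ι ι ℂ where
  toFun := Ad g
  map_add' x y := by simp [Ad, mul_add, add_mul]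
  map_smul' c x := by simp [Ad]

theorem Ad_sub (g : GL ι ℂ) (x y : Matrix ι ι ℂ) : Ad g (x - y) = Ad g x - Ad g y :=
  map_sub (AdLin g) x y

theorem Ad_add (g : GL ι ℂ) (x y : Matrix ι ι ℂ) : Ad g (x + y) = Ad g x + Ad g y :=
  map_add (AdLin g) x y

/-- In finite dimension the injective endomorphism `Ad g` of N is onto, so stability under g already
gives stability under its inverse. -/
theorem Ad_inv_mem {g : GL ι ℂ} {N : Submodule ℂ (Matrix ι ι ℂ)} (h : ∀ x ∈ N, Ad g x ∈ N)
    {x : Matrix ι ι ℂ} (hx : x ∈ N) : Ad g⁻¹ x ∈ N := by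
  let f : N →ₗ[ℂ] N := (AdLin g).restrict h
  have hf : Function.Injective f := by
    intro a b hab
    have : Ad g a = Ad g b := congrArg Subtype.val hab
    ext1
    rw [← Ad_inv_Ad g a, this, Ad_inv_Ad]
  obtain ⟨y, hy⟩ := (LinearMap.injective_iff_surjective.1 hf) ⟨x, hx⟩
  have : Ad g y = x := congrArg Subtype.val hy
  rw [← this, Ad_inv_Ad]
  exact y.2

/-! ### Existence of a grading element -/

section Grading

variable {S : Matrix ι ι ℂ} {ε : ℂ} {R : (Matrix ι ι ℂ)ˣ} {𝔭 : Submodule ℂ (Matrix ι ι ℂ)}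

/-- `P` is the normalizer of `𝔭` in the isometry group of `S`. -/
def IsNormalizer {S : Matrix ι ι ℂ} {ε : ℂ} (hS : IsFormMatrix S ε)
    (𝔭 : Submodule ℂ (Matrix ι ι ℂ)) (P : Subgroup (GL ι ℂ)) : Prop :=
  ∀ g, g ∈ P ↔ g ∈ isoGroup S hS ∧ ∀ X ∈ 𝔭, Ad g X ∈ 𝔭

/-- A self-adjoint element `H` of the Levi subalgebra `𝔭 ∩ 𝔭†` which is central there, has positive
eigenvalues on `n` and is fixed, modulo `n`, by the normalizer of `𝔭`. -/
structure IsGrading {S : Matrix ι ι ℂ} {ε : ℂ} (hS : IsFormMatrix S ε) (R : (Matrix ι ι ℂ)ˣ)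
    (𝔭 : Submodule ℂ (Matrix ι ι ℂ)) (H : Matrix ι ι ℂ) : Prop where
  mem_skew : H ∈ skew S
  mem_parabolic : H ∈ 𝔭
  dag_eq : dag R H = H
  comm : ∀ y ∈ 𝔭, dag R y ∈ 𝔭 → H * y = y * H
  pos : ∀ x ∈ nilrad S 𝔭, x ≠ 0 → 0 < (dag R x * (H * x - x * H)).trace.re
  conj : ∀ g ∈ isoGroup S hS, (∀ X ∈ 𝔭, Ad g X ∈ 𝔭) → Ad g H - H ∈ nilrad S 𝔭

theorem Ad_mem_nilrad {hS : IsFormMatrix S ε} {g : GL ι ℂ} (hg : g ∈ isoGroup S hS)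
    (h𝔭 : ∀ X ∈ 𝔭, Ad g X ∈ 𝔭) {x : Matrix ι ι ℂ} (hx : x ∈ nilrad S 𝔭) : Ad g x ∈ nilrad S 𝔭 :=
  ⟨Ad_mem_skew hg hx.1, fun y hy => by
    rw [← Ad_Ad_inv g y, ← Ad_mul_mul, trace_Ad, hx.2 _ (Ad_inv_mem h𝔭 hy)]⟩

/-- The element H of `exists_rho` works. Nilpotent matrices act on 𝔫 with trace zero, so H is
orthogonal to 𝔫 and lies in 𝔭. Traces of commutators vanish, so [H, 𝔭] ⊆ 𝔫; for y in 𝔭 ∩ 𝔭† both [H,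
y] and its adjoint lie in 𝔫, which forces [H, y] = 0. Conjugation invariance of the trace gives the
last property. -/
theorem exists_isGrading (hS : IsFormMatrix S ε) (hc : IsCompatible S R)
    (hp : IsParabolicSpace S 𝔭) : ∃ H, IsGrading hS R 𝔭 H := by
  obtain ⟨H, hH, hd, htr, hpos⟩ := exists_rho hS hc hp
  refine ⟨H, hH, hp.mem_of_orthogonal_nilrad hc hH fun u hu => ?_, hd, fun y hy hy' => ?_, hpos, fun g hg hg𝔭 => ⟨sub_mem (Ad_mem_skew hg hH) hH,
    fun x hx => ?_⟩⟩
  · rw [htr u (hp.nilrad_le hu)]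
    have hnil : IsNilpotent (adNilrad hS hp (hp.nilrad_le hu)) := by
      have h1 : IsNilpotent (LinearMap.mulLeft ℂ u - LinearMap.mulRight ℂ u) :=
        LieAlgebra.ad_nilpotent_of_nilpotent (hp.isNilpotent hu)
      obtain ⟨k, hk⟩ := h1
      refine ⟨k, ?_⟩
      rw [adNilrad, Module.End.pow_restrict]
      ext1 v
      ext1
      rw [LinearMap.coe_restrict_apply, hk]
      rfl
    exact (LinearMap.isNilpotent_trace_of_isNilpotent hnil).eq_zero
  · have key : ∀ y ∈ 𝔭, H * y - y * H ∈ nilrad S 𝔭 := by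
      intro y hy
      refine ⟨hS.lie_mem_skew hH (hp.le_skew hy), fun z hz => ?_⟩
      rw [trace_lie_mul, htr _ (hp.lie_mem y hy z hz)]
      have : adNilrad hS hp (hp.lie_mem y hy z hz) + adNilrad hS hp hz * adNilrad hS hp hy =
          adNilrad hS hp hy * adNilrad hS hp hz := by
        ext1 u
        ext1
        rw [LinearMap.add_apply, Module.End.mul_apply, Module.End.mul_apply, Submodule.coe_add]
        simp only [adNilrad_apply, mul_sub, sub_mul, Matrix.mul_assoc]
        abel
      have h1 := congrArg (LinearMap.trace ℂ (nilrad S 𝔭)) this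
      rw [map_add, LinearMap.trace_mul_comm] at h1
      exact add_eq_right.1 h1
    have h1 := key y hy
    have h2 := neg_mem (key _ hy')
    have h3 : dag R (H * y - y * H) = -(H * dag R y - dag R y * H) := by
      rw [map_sub, dag_mul, dag_mul, hd, neg_sub]
    rw [← h3] at h2
    rw [← sub_eq_zero]
    refine eq_zero_of_trace_dag_mul_self_re R ?_
    rw [h2.2 _ (hp.nilrad_le h1)]
    rfl
  · obtain ⟨z, hz, rfl⟩ : ∃ z ∈ 𝔭, Ad g z = x := ⟨_, Ad_inv_mem hg𝔭 hx, Ad_Ad_inv g x⟩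
    have hn : ∀ u ∈ nilrad S 𝔭, Ad g u ∈ nilrad S 𝔭 := fun u hu => Ad_mem_nilrad hg hg𝔭 hu
    let A : nilrad S 𝔭 ≃ₗ[ℂ] nilrad S 𝔭 :=
      LinearEquiv.ofInjectiveEndo ((AdLin g).restrict hn) fun a b hab => by
        have : Ad g a = Ad g b := congrArg Subtype.val hab
        ext1
        rw [← Ad_inv_Ad g a, this, Ad_inv_Ad]
    have hA : ∀ u, (A u : Matrix ι ι ℂ) = Ad g u := fun u => rfl
    have h1 : adNilrad hS hp hx = A.conj (adNilrad hS hp hz) := by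
      ext1 u
      obtain ⟨v, rfl⟩ := A.surjective u
      rw [LinearEquiv.conj_apply_apply, LinearEquiv.symm_apply_apply]
      ext1
      rw [hA, adNilrad_apply, adNilrad_apply, hA, Ad_sub, Ad_mul_mul, Ad_mul_mul]
    rw [sub_mul, Matrix.trace_sub, ← Ad_mul_mul, trace_Ad, htr _ hx, htr _ hz, h1,
      LinearMap.trace_conj', sub_self]

end Grading

/-! ### Block triangular matrices -/

section Blocks

variable {R : (Matrix ι ι ℂ)ˣ} {H : Matrix ι ι ℂ} {s : Finset ℝ} {p : ℝ → Matrix ι ι ℂ}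
  {x y : Matrix ι ι ℂ}

theorem IsStrict.isUpper (hx : IsStrict p x) : IsUpper p x := fun c d h => hx c d h.le

theorem IsUpper.add (hx : IsUpper p x) (hy : IsUpper p y) : IsUpper p (x + y) := fun c d h => by
  rw [mul_add, add_mul, hx c d h, hy c d h, add_zero]

theorem IsUpper.neg (hx : IsUpper p x) : IsUpper p (-x) := fun c d h => by
  rw [mul_neg, neg_mul, hx c d h, neg_zero]

theorem IsUpper.sub (hx : IsUpper p x) (hy : IsUpper p y) : IsUpper p (x - y) := by
  rw [sub_eq_add_neg]; exact hx.add hy.neg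

theorem IsStrict.add (hx : IsStrict p x) (hy : IsStrict p y) : IsStrict p (x + y) := fun c d h => by
  rw [mul_add, add_mul, hx c d h, hy c d h, add_zero]

theorem IsStrict.neg (hx : IsStrict p x) : IsStrict p (-x) := fun c d h => by
  rw [mul_neg, neg_mul, hx c d h, neg_zero]

theorem IsStrict.sub (hx : IsStrict p x) (hy : IsStrict p y) : IsStrict p (x - y) := by
  rw [sub_eq_add_neg]; exact hx.add hy.neg

/-- The block diagonal part of a matrix. -/
def blk (s : Finset ℝ) (p : ℝ → Matrix ι ι ℂ) (x : Matrix ι ι ℂ) : Matrix ι ι ℂ :=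
  ∑ c ∈ s, p c * x * p c

namespace IsSpectral

variable (h : IsSpectral R H s p)
include h

theorem upper_mul (hx : IsUpper p x) (hy : IsUpper p y) : IsUpper p (x * y) := fun c d hcd => by
  rw [h.expand_mul]
  refine Finset.sum_eq_zero fun e _ => ?_
  rcases lt_or_ge c e with h1 | h1
  · rw [hx c e h1, Matrix.zero_mul]
  · rw [hy e d (h1.trans_lt hcd), Matrix.mul_zero]

theorem strict_mul (hx : IsStrict p x) (hy : IsUpper p y) : IsStrict p (x * y) := fun c d hcd => by
  rw [h.expand_mul]
  refine Finset.sum_eq_zero fun e _ => ?_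
  rcases le_or_gt c e with h1 | h1
  · rw [hx c e h1, Matrix.zero_mul]
  · rw [hy e d (h1.trans_le hcd), Matrix.mul_zero]

theorem mul_strict (hx : IsUpper p x) (hy : IsStrict p y) : IsStrict p (x * y) := fun c d hcd => by
  rw [h.expand_mul]
  refine Finset.sum_eq_zero fun e _ => ?_
  rcases lt_or_ge c e with h1 | h1
  · rw [hx c e h1, Matrix.zero_mul]
  · rw [hy e d (h1.trans hcd), Matrix.mul_zero]

theorem isUpper_of_commute (hx : H * x = x * H) : IsUpper p x := fun c d hcd =>
  h.commute_iff.1 hx c d hcd.ne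

theorem isUpper_one : IsUpper p (1 : Matrix ι ι ℂ) := h.isUpper_of_commute (by simp)

theorem block_blk (x : Matrix ι ι ℂ) (c d : ℝ) :
    p c * blk s p x * p d = if c = d then p c * x * p c else 0 := by
  rw [blk, Matrix.mul_sum, Matrix.sum_mul]
  by_cases hc : c ∈ s
  · rw [Finset.sum_eq_single c (fun e _ he => by rw [h.block_block, if_neg (by tauto)])
      (fun h' => absurd hc h'), h.block_block]
    simp
  · rw [h.eq_zero hc]; simp

theorem commute_blk (x : Matrix ι ι ℂ) : H * blk s p x = blk s p x * H := by
  rw [h.commute_iff]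
  intro c d hcd
  rw [h.block_blk, if_neg hcd]

theorem blk_of_commute (hx : H * x = x * H) : blk s p x = x := by
  apply h.ext_blocks
  intro c _ d _
  rw [h.block_blk]
  split_ifs with hcd
  · rw [hcd]
  · rw [h.commute_iff.1 hx c d hcd]

theorem blk_one : blk s p (1 : Matrix ι ι ℂ) = 1 := h.blk_of_commute (by simp)

theorem sub_blk_strict (hx : IsUpper p x) : IsStrict p (x - blk s p x) := fun c d hcd => by
  rw [mul_sub, sub_mul, h.block_blk]
  split_ifs with h1
  · rw [h1, sub_self]
  · rw [hx c d (lt_of_le_of_ne hcd h1), sub_zero]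

theorem blk_mul (hx : IsUpper p x) (hy : IsUpper p y) :
    blk s p (x * y) = blk s p x * blk s p y := by
  apply h.ext_blocks
  intro c hc d _
  rw [h.block_blk]
  split_ifs with hcd
  · subst hcd
    rw [h.expand_mul, h.expand_mul]
    rw [Finset.sum_eq_single c _ (fun h' => absurd hc h'), Finset.sum_eq_single c _ (fun h' => absurd hc h')]
    · rw [h.block_blk, h.block_blk, if_pos rfl, if_pos rfl]
    · intro e _ he
      rw [h.block_blk, if_neg he.symm, Matrix.zero_mul]
    · intro e _ he
      rcases lt_or_gt_of_ne he with h1 | h1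
      · rw [hy e c h1, Matrix.mul_zero]
      · rw [hx c e h1, Matrix.zero_mul]
  · rw [h.commute_iff.1 _ c d hcd]
    rw [← Matrix.mul_assoc, h.commute_blk, Matrix.mul_assoc, h.commute_blk, Matrix.mul_assoc]

theorem blk_eq_zero (hx : IsStrict p x) : blk s p x = 0 :=
  Finset.sum_eq_zero fun c _ => hx c c le_rfl

theorem blk_sub (x y : Matrix ι ι ℂ) : blk s p (x - y) = blk s p x - blk s p y := by
  simp only [blk, mul_sub, sub_mul, Finset.sum_sub_distrib]

theorem trace_eq_sum (x : Matrix ι ι ℂ) : x.trace = ∑ c ∈ s, (p c * x * p c).trace := by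
  conv_lhs => rw [h.expand_left x]
  rw [Matrix.trace_sum]
  refine Finset.sum_congr rfl fun c _ => ?_
  rw [Matrix.trace_mul_comm (p c * x), ← Matrix.mul_assoc, h.idem]

theorem trace_eq_zero_of_strict (hx : IsStrict p x) : x.trace = 0 := by
  rw [h.trace_eq_sum]
  exact Finset.sum_eq_zero fun c _ => by rw [hx c c le_rfl, Matrix.trace_zero]

/-- A block (c, d) of x^k can be non-zero only if at least k spectral values lie in [d, c), since
each factor strictly changes the eigenvalue. -/
theorem isNilpotent_of_strict (hx : IsStrict p x) : IsNilpotent x := by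
  classical
  have key : ∀ k : ℕ, ∀ c d, (s.filter fun e => d ≤ e ∧ e < c).card < k → p c * x ^ k * p d = 0 := by
    intro k
    induction k with
    | zero => intro c d h0; exact absurd h0 (Nat.not_lt_zero _)
    | succ k ih =>
      intro c d hk
      rw [pow_succ', h.expand_mul]
      refine Finset.sum_eq_zero fun e he => ?_
      rcases le_or_gt c e with h1 | h1
      · rw [hx c e h1, Matrix.zero_mul]
      · rcases le_or_gt d e with h2 | h2
        · rw [ih e d, Matrix.mul_zero]
          refine lt_of_lt_of_le (Finset.card_lt_card ?_) (Nat.lt_succ_iff.1 hk)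
          refine ⟨fun a ha => ?_, fun hsub => ?_⟩
          · simp only [Finset.mem_filter] at ha ⊢
            exact ⟨ha.1, ha.2.1, ha.2.2.trans h1⟩
          · have := hsub (Finset.mem_filter.2 ⟨he, h2, h1⟩)
            simp at this
        · have hst : ∀ j : ℕ, IsUpper p (x ^ j) := by
            intro j
            induction j with
            | zero => rw [pow_zero]; exact h.isUpper_one
            | succ j ihj => rw [pow_succ]; exact h.upper_mul ihj hx.isUpper
          rw [hst k e d h2, Matrix.mul_zero]
  refine ⟨s.card + 1, ?_⟩
  apply h.ext_blocks
  intro c _ d _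
  rw [key _ c d (Nat.lt_succ_iff.2 (Finset.card_filter_le _ _))]
  simp

theorem isUpper_adj {S : Matrix ι ι ℂ} {ε : ℂ} (hS : IsFormMatrix S ε) (hH : H ∈ skew S)
    (hx : IsUpper p x) : IsUpper p (adj S x) := fun c d hcd => by
  rw [← neg_neg c, ← neg_neg d, ← h.adj_block hS hH, hx _ _ (neg_lt_neg hcd), map_zero]

theorem blk_adj {S : Matrix ι ι ℂ} {ε : ℂ} (hS : IsFormMatrix S ε) (hH : H ∈ skew S)
    (x : Matrix ι ι ℂ) : blk s p (adj S x) = adj S (blk s p x) := by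
  apply h.ext_blocks
  intro c _ d _
  conv_rhs => rw [← neg_neg c, ← neg_neg d, ← h.adj_block hS hH, h.block_blk]
  rw [h.block_blk]
  by_cases hcd : c = d
  · subst hcd
    rw [if_pos rfl, if_pos rfl, h.adj_block hS hH, neg_neg]
  · rw [if_neg hcd, if_neg (fun h' => hcd (neg_injective h').symm), map_zero]

end IsSpectral

/-- The characteristic polynomial of x is a power of X; evaluation at -1 gives the determinant of
-(1 + x). -/
theorem det_one_add_of_isNilpotent (hx : IsNilpotent x) : (1 + x).det = 1 := by
  have h1 : x.charpoly = Polynomial.X ^ Fintype.card ι :=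
    sub_eq_zero.1 (Matrix.isNilpotent_charpoly_sub_pow_of_isNilpotent hx).eq_zero
  have h2 := congrArg (Polynomial.eval (-1)) h1
  rw [Matrix.eval_charpoly, Polynomial.eval_pow, Polynomial.eval_X] at h2
  have h3 : scalar ι (-1 : ℂ) - x = -(1 + x) := by
    rw [map_neg, map_one, neg_add, sub_eq_add_neg]
  rw [h3, Matrix.det_neg] at h2
  have h4 : (-1 : ℂ) ^ Fintype.card ι ≠ 0 := pow_ne_zero _ (by norm_num)
  exact mul_left_cancel₀ h4 (by rw [h2, mul_one])

end Blocks

/-! ### Parabolic subalgebras and normalizers as block triangular matrices -/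

section GradedParabolic

/-- A grading of a parabolic space together with the spectral projections of the grading element. -/
structure IsGradedParabolic {S : Matrix ι ι ℂ} {ε : ℂ} (hS : IsFormMatrix S ε)
    (R : (Matrix ι ι ℂ)ˣ) (𝔭 : Submodule ℂ (Matrix ι ι ℂ)) (H : Matrix ι ι ℂ) (s : Finset ℝ)
    (p : ℝ → Matrix ι ι ℂ) : Prop where
  compat : IsCompatible S R
  parabolic : IsParabolicSpace S 𝔭
  grading : IsGrading hS R 𝔭 H
  spectral : IsSpectral R H s p

namespace IsGradedParabolic

variable {S : Matrix ι ι ℂ} {ε : ℂ} {hS : IsFormMatrix S ε} {R : (Matrix ι ι ℂ)ˣ}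
  {𝔭 : Submodule ℂ (Matrix ι ι ℂ)} {H : Matrix ι ι ℂ} {s : Finset ℝ} {p : ℝ → Matrix ι ι ℂ}
  (h : IsGradedParabolic hS R 𝔭 H s p)
include h

/-- The space 𝔫 is stable under ad H, so it contains the ad H-eigencomponents of x. Positivity of
the grading on 𝔫 makes the eigenvalue c - d of each non-zero component positive. -/
theorem isStrict_of_mem_nilrad {x : Matrix ι ι ℂ} (hx : x ∈ nilrad S 𝔭) : IsStrict p x := by
  classical
  let T : Module.End ℂ (Matrix ι ι ℂ) := LinearMap.mulLeft ℂ H - LinearMap.mulRight ℂ H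
  have hT : ∀ v, T v = H * v - v * H := fun v => rfl
  have hTn : ∀ v ∈ nilrad S 𝔭, T v ∈ nilrad S 𝔭 := by
    intro v hv
    rw [hT, ← neg_sub]
    exact neg_mem (h.parabolic.lie_mem_nilrad hS hv h.grading.mem_parabolic)
  let K : Finset ℂ := (s ×ˢ s).image fun q => (q.1 : ℂ) - q.2
  let v : ℂ → Matrix ι ι ℂ := fun k =>
    ∑ q ∈ (s ×ˢ s).filter (fun q => (q.1 : ℂ) - q.2 = k), p q.1 * x * p q.2
  have hv : ∀ k, T (v k) = k • v k := by
    intro k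
    simp only [v]
    rw [map_sum, Finset.smul_sum]
    refine Finset.sum_congr rfl fun q hq => ?_
    rw [hT, ← (Finset.mem_filter.1 hq).2, ← Matrix.mul_assoc, ← Matrix.mul_assoc,
      h.spectral.left, Matrix.mul_assoc _ _ H, h.spectral.right, Matrix.mul_smul, Matrix.smul_mul,
      Matrix.smul_mul, sub_smul]
  have hsum : ∑ k ∈ K, v k = x := by
    conv_rhs => rw [h.spectral.expand x, ← Finset.sum_product']
    exact Finset.sum_fiberwise_of_maps_to (fun q hq => Finset.mem_image_of_mem _ hq) _
  have hmem := mem_of_sum_eigenvectors T (nilrad S 𝔭) hTn K v (fun k _ => hv k) (by rwa [hsum])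
  have hblock : ∀ c ∈ s, ∀ d ∈ s, p c * v ((c : ℂ) - d) * p d = p c * x * p d := by
    intro c hc d hd
    simp only [v]
    rw [Matrix.mul_sum, Matrix.sum_mul, Finset.sum_eq_single (c, d)]
    · rw [h.spectral.block_block, if_pos ⟨rfl, rfl⟩]
    · intro q _ hq
      rw [h.spectral.block_block, if_neg]
      rintro ⟨h1, h2⟩
      exact hq (Prod.ext h1.symm h2)
    · intro hq
      exact (hq (Finset.mem_filter.2 ⟨Finset.mem_product.2 ⟨hc, hd⟩, rfl⟩)).elim
  intro c d hcd
  by_cases hc : c ∈ s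
  · by_cases hd : d ∈ s
    · rw [← hblock c hc d hd]
      by_cases h0 : v ((c : ℂ) - d) = 0
      · rw [h0, Matrix.mul_zero, Matrix.zero_mul]
      · have h1 := hmem _ (Finset.mem_image_of_mem (fun q : ℝ × ℝ => (q.1 : ℂ) - q.2)
          (Finset.mem_product.2 ⟨hc, hd⟩ : (c, d) ∈ s ×ˢ s))
        have h2 := h.grading.pos _ h1 h0
        simp only at h2
        rw [← hT, hv, Matrix.mul_smul, Matrix.trace_smul, smul_eq_mul, ← Complex.ofReal_sub,
          Complex.re_ofReal_mul] at h2
        have h3 := trace_dag_mul_self_re_nonneg R (v ((c - d : ℝ) : ℂ))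
        nlinarith
    · rw [h.spectral.eq_zero hd, Matrix.mul_zero]
  · rw [h.spectral.eq_zero hc, Matrix.zero_mul, Matrix.zero_mul]

theorem isUpper_of_mem {x : Matrix ι ι ℂ} (hx : x ∈ 𝔭) : IsUpper p x := by
  obtain ⟨u, y, z, hu, hy, hy', -, rfl, h0⟩ :=
    h.parabolic.exists_decomposition h.compat (h.parabolic.le_skew hx)
  rw [h0 hx, add_zero]
  exact (h.isStrict_of_mem_nilrad hu).isUpper.add
    (h.spectral.isUpper_of_commute (h.grading.comm y hy hy'))

theorem mem_nilrad_iff {x : Matrix ι ι ℂ} : x ∈ nilrad S 𝔭 ↔ x ∈ skew S ∧ IsStrict p x :=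
  ⟨fun hx => ⟨hx.1, h.isStrict_of_mem_nilrad hx⟩, fun hx => ⟨hx.1, fun _ hy =>
    h.spectral.trace_eq_zero_of_strict (h.spectral.strict_mul hx.2 (h.isUpper_of_mem hy))⟩⟩

theorem mem_iff {x : Matrix ι ι ℂ} : x ∈ 𝔭 ↔ x ∈ skew S ∧ IsUpper p x :=
  ⟨fun hx => ⟨h.parabolic.le_skew hx, h.isUpper_of_mem hx⟩, fun hx =>
    h.parabolic.mem_of_orthogonal_nilrad h.compat hx.1 fun _ hu =>
      h.spectral.trace_eq_zero_of_strict (h.spectral.mul_strict hx.2 (h.isStrict_of_mem_nilrad hu))⟩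

theorem mem_of_commute {x : Matrix ι ι ℂ} (hx : x ∈ skew S) (hH : H * x = x * H) : x ∈ 𝔭 :=
  h.mem_iff.2 ⟨hx, h.spectral.isUpper_of_commute hH⟩

/-- If g normalizes 𝔭, then x = Ad g H - H is strict and gH - Hg = xg. In the lowest row with a
forbidden block of g, the right side involves only lower rows and vanishes there, while the left
side multiplies the block by a non-zero scalar. -/
theorem normalizes_iff {g : GL ι ℂ} (hg : g ∈ isoGroup S hS) :
    (∀ x ∈ 𝔭, Ad g x ∈ 𝔭) ↔ IsUpper p (g : Matrix ι ι ℂ) := by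
  classical
  constructor
  · intro hn
    have hst := h.isStrict_of_mem_nilrad (h.grading.conj g hg hn)
    set x := Ad g H - H with hx
    have hxg : (g : Matrix ι ι ℂ) * H = H * g + x * g := by
      rw [hx, sub_mul, Ad, Matrix.mul_assoc _ _ (g : Matrix ι ι ℂ), Units.inv_mul, Matrix.mul_one]
      abel
    by_contra hcon
    simp only [IsUpper, not_forall] at hcon
    obtain ⟨c0, d0, hcd0, hne0⟩ := hcon
    let F := s.filter fun c => ∃ d, c < d ∧ p c * (g : Matrix ι ι ℂ) * p d ≠ 0
    have hF : F.Nonempty := ⟨c0, Finset.mem_filter.2 ⟨by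
      by_contra hc
      exact hne0 (by rw [h.spectral.eq_zero hc, Matrix.zero_mul, Matrix.zero_mul]), d0, hcd0, hne0⟩⟩
    obtain ⟨c, hc, hmin⟩ := Finset.exists_min_image F id hF
    obtain ⟨-, d, hcd, hne⟩ := Finset.mem_filter.1 hc
    have h1 := h.spectral.block_lie (g : Matrix ι ι ℂ) c d
    rw [hxg, ← sub_sub, sub_self, zero_sub, mul_neg, neg_mul, h.spectral.expand_mul,
      Finset.sum_eq_zero, neg_zero] at h1
    · refine hne ((smul_eq_zero.1 h1.symm).resolve_left ?_)
      exact sub_ne_zero.2 (by exact_mod_cast hcd.ne)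
    · intro e he
      rcases le_or_gt c e with h2 | h2
      · rw [hst c e h2, Matrix.zero_mul]
      · rw [by_contra fun h3 : ¬ p e * (g : Matrix ι ι ℂ) * p d = 0 =>
          absurd (hmin e (Finset.mem_filter.2 ⟨he, d, h2.trans hcd, h3⟩)) (not_le.2 h2),
          Matrix.mul_zero]
  · intro hu x hx
    rw [h.mem_iff] at hx ⊢
    refine ⟨Ad_mem_skew hg hx.1, ?_⟩
    rw [Ad, inv_eq_adj hg]
    exact h.spectral.upper_mul (h.spectral.upper_mul hu hx.2)
      (h.spectral.isUpper_adj hS h.grading.mem_skew hu)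

end IsGradedParabolic

end GradedParabolic

/-! ### Exponentials and Lie algebras of matrix groups -/

section Exponential

open scoped Matrix.Norms.Operator

theorem hasSum_exp (X : Matrix ι ι ℂ) :
    HasSum (fun n : ℕ => ((n.factorial : ℝ)⁻¹) • X ^ n) (NormedSpace.exp X) :=
  NormedSpace.exp_series_hasSum_exp' (𝕂 := ℝ) X

theorem hasDerivAt_exp_smul (X : Matrix ι ι ℂ) (t : ℝ) :
    HasDerivAt (fun u : ℝ => NormedSpace.exp (u • X)) (NormedSpace.exp (t • X) * X) t :=
  hasDerivAt_exp_smul_const X t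

theorem continuous_exp_smul (X : Matrix ι ι ℂ) :
    Continuous fun u : ℝ => NormedSpace.exp (u • X) :=
  continuous_iff_continuousAt.2 fun t => (hasDerivAt_exp_smul X t).continuousAt

theorem map_exp_of_map_pow (f : Matrix ι ι ℂ →ₗ[ℝ] Matrix ι ι ℂ) {X Y : Matrix ι ι ℂ}
    (h : ∀ k, f (X ^ k) = Y ^ k) : f (NormedSpace.exp X) = NormedSpace.exp Y := by
  have h1 := (hasSum_exp X).map f (LinearMap.continuous_of_finiteDimensional f)
  refine h1.unique ?_
  have h2 : (f ∘ fun n : ℕ => ((n.factorial : ℝ)⁻¹) • X ^ n) =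
      fun n : ℕ => ((n.factorial : ℝ)⁻¹) • Y ^ n := by
    funext n
    rw [Function.comp_apply, map_smul, h]
  rw [h2]
  exact hasSum_exp Y

theorem exp_sub_sum_mem (N : Submodule ℝ (Matrix ι ι ℂ)) {X : Matrix ι ι ℂ} (m : ℕ)
    (h : ∀ k, m ≤ k → X ^ k ∈ N) :
    NormedSpace.exp X - ∑ k ∈ Finset.range m, ((k.factorial : ℝ)⁻¹) • X ^ k ∈ N := by
  have h1 := (hasSum_nat_add_iff' m).2 (hasSum_exp X)
  refine (Submodule.closed_of_finiteDimensional N).mem_of_tendsto h1 (Filter.Eventually.of_forall ?_)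
  exact fun t => sum_mem fun n _ => N.smul_mem _ (h _ (Nat.le_add_left _ _))

theorem exp_mem (N : Submodule ℝ (Matrix ι ι ℂ)) {X : Matrix ι ι ℂ} (h : ∀ k, X ^ k ∈ N) :
    NormedSpace.exp X ∈ N := by
  simpa using exp_sub_sum_mem N 0 fun k _ => h k

theorem exp_sub_one_mem (N : Submodule ℝ (Matrix ι ι ℂ)) {X : Matrix ι ι ℂ}
    (h : ∀ k, X ^ (k + 1) ∈ N) : NormedSpace.exp X - 1 ∈ N := by
  simpa using exp_sub_sum_mem N 1 fun k hk => by
    obtain ⟨j, rfl⟩ := Nat.exists_eq_add_of_le' hk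
    exact h j

theorem eq_of_exp_smul_eq {X Y : Matrix ι ι ℂ}
    (h : ∀ t : ℝ, NormedSpace.exp (t • X) = NormedSpace.exp (t • Y)) : X = Y := by
  have h1 := hasDerivAt_exp_smul X 0
  rw [funext h] at h1
  simpa using h1.unique (hasDerivAt_exp_smul Y 0)

theorem mem_of_exp_smul_mem (N : Submodule ℝ (Matrix ι ι ℂ)) {X : Matrix ι ι ℂ}
    (h : ∀ t : ℝ, NormedSpace.exp (t • X) - 1 ∈ N) : X ∈ N := by
  have h1 := (hasDerivAt_exp_smul X 0).tendsto_slope_zero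
  simp only [zero_add, zero_smul, NormedSpace.exp_zero, Matrix.one_mul] at h1
  exact (Submodule.closed_of_finiteDimensional N).mem_of_tendsto h1
    (Filter.Eventually.of_forall fun t => N.smul_mem _ (h t))

theorem adj_exp {S : Matrix ι ι ℂ} {ε : ℂ} (hS : IsFormMatrix S ε) (X : Matrix ι ι ℂ) :
    adj S (NormedSpace.exp X) = NormedSpace.exp (adj S X) := by
  refine map_exp_of_map_pow ((adj S).restrictScalars ℝ) fun k => ?_
  simp only [LinearMap.coe_restrictScalars]
  induction k with
  | zero => simp [hS.adj_one]
  | succ k ih => rw [pow_succ, hS.adj_mul, ih, pow_succ']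

theorem dag_exp (R : (Matrix ι ι ℂ)ˣ) (X : Matrix ι ι ℂ) :
    dag R (NormedSpace.exp X) = NormedSpace.exp (dag R X) := by
  let f : Matrix ι ι ℂ →ₗ[ℝ] Matrix ι ι ℂ :=
    { toFun := dag R
      map_add' := map_add _
      map_smul' := fun c x => by
        have : c • x = (c : ℂ) • x := rfl
        rw [this, map_smulₛₗ, Complex.conj_ofReal]
        rfl }
  refine map_exp_of_map_pow f fun k => ?_
  change dag R (X ^ k) = dag R X ^ k
  induction k with
  | zero => simp [dag_one]
  | succ k ih => rw [pow_succ, dag_mul, ih, pow_succ']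

theorem exp_add_smul (X : Matrix ι ι ℂ) (t u : ℝ) : NormedSpace.exp ((t + u) • X) =
    NormedSpace.exp (t • X) * NormedSpace.exp (u • X) := by
  rw [add_smul, Matrix.exp_add_of_commute]
  exact ((Commute.refl X).smul_left t).smul_right u

/-- The exponential as an invertible matrix. -/
noncomputable def expGL (X : Matrix ι ι ℂ) : GL ι ℂ := (Matrix.isUnit_exp X).unit

theorem coe_expGL (X : Matrix ι ι ℂ) : (expGL X : Matrix ι ι ℂ) = NormedSpace.exp X := rfl

theorem mem_lieAlg_iff {G : Subgroup (GL ι ℂ)} {X : Matrix ι ι ℂ} :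
    X ∈ lieAlg G ↔ ∀ t : ℝ, expGL (t • X) ∈ G := by
  refine forall_congr' fun t => ⟨?_, fun h => ⟨_, h, rfl⟩⟩
  rintro ⟨g, hg, h⟩
  rwa [show expGL (t • X) = g from Units.ext h.symm]

theorem lieAlg_mono {G G' : Subgroup (GL ι ℂ)} (h : G ≤ G') : lieAlg G ⊆ lieAlg G' :=
  fun X hX t => by
    obtain ⟨g, hg, e⟩ := hX t
    exact ⟨g, h hg, e⟩

theorem expGL_mem_isoGroup {S : Matrix ι ι ℂ} {ε : ℂ} {hS : IsFormMatrix S ε} {X : Matrix ι ι ℂ}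
    (hX : X ∈ skew S) : expGL X ∈ isoGroup S hS := by
  have h1 : ∀ Y ∈ skew S, adj S (NormedSpace.exp Y) * NormedSpace.exp Y = 1 := by
    intro Y hY
    rw [adj_exp hS, mem_skew.1 hY, ← Matrix.exp_add_of_commute _ _ (Commute.refl Y).neg_left,
      neg_add_cancel, NormedSpace.exp_zero]
  refine ⟨h1 X hX, ?_⟩
  -- Preserving the form only gives determinant ±1; writing exp X as the square of exp(X/2) excludes
  -- -1.
  have h2 := h1 ((1 / 2 : ℂ) • X) (Submodule.smul_mem _ _ hX)
  have h3 := congrArg Matrix.det h2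
  rw [Matrix.det_mul, hS.det_adj, Matrix.det_one, ← Matrix.det_mul,
    ← Matrix.exp_add_of_commute _ _ (Commute.refl _), ← add_smul, add_halves, one_smul] at h3
  exact h3

theorem mem_lieAlg_isoGroup {S : Matrix ι ι ℂ} {ε : ℂ} {hS : IsFormMatrix S ε}
    {X : Matrix ι ι ℂ} : X ∈ lieAlg (isoGroup S hS) ↔ X ∈ skew S := by
  rw [mem_lieAlg_iff]
  refine ⟨fun h => ?_, fun h t => expGL_mem_isoGroup (mem_skew.2 ?_)⟩
  · rw [mem_skew]
    refine eq_of_exp_smul_eq fun t => ?_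
    have h1 := inv_eq_adj (h t)
    rw [Matrix.coe_units_inv, coe_expGL, ← Matrix.exp_neg, adj_exp hS] at h1
    rw [smul_neg, h1]
    congr 1
    exact (map_smul ((adj S).restrictScalars ℝ) t X).symm
  · rw [← smul_neg, ← mem_skew.1 h]
    exact map_smul ((adj S).restrictScalars ℝ) t X

theorem commute_of_exp_smul {A X : Matrix ι ι ℂ}
    (h : ∀ t : ℝ, A * NormedSpace.exp (t • X) = NormedSpace.exp (t • X) * A) : A * X = X * A := by
  let N : Submodule ℝ (Matrix ι ι ℂ) :=
    LinearMap.ker (LinearMap.mulLeft ℝ A - LinearMap.mulRight ℝ A)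
  have hN : ∀ x, x ∈ N ↔ A * x = x * A := fun x => by
    rw [LinearMap.mem_ker, LinearMap.sub_apply, sub_eq_zero]; rfl
  refine (hN X).1 (mem_of_exp_smul_mem N fun t => (hN _).2 ?_)
  rw [mul_sub, sub_mul, h, Matrix.mul_one, Matrix.one_mul]

theorem commute_exp {A X : Matrix ι ι ℂ} (h : A * X = X * A) :
    A * NormedSpace.exp X = NormedSpace.exp X * A :=
  (show Commute A X from h).exp_right

theorem continuous_expGL_smul (X : Matrix ι ι ℂ) : Continuous fun t : ℝ => expGL (t • X) := by
  refine Units.continuous_iff.2 ⟨continuous_exp_smul X, ?_⟩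
  have : (fun t : ℝ => (↑(expGL (t • X))⁻¹ : Matrix ι ι ℂ)) =
      fun t : ℝ => NormedSpace.exp (t • -X) := by
    funext t
    rw [Matrix.coe_units_inv, coe_expGL, ← Matrix.exp_neg, smul_neg]
  rw [this]
  exact continuous_exp_smul _

end Exponential

section Projections

variable {R : (Matrix ι ι ℂ)ˣ} {H : Matrix ι ι ℂ} {s : Finset ℝ} {p : ℝ → Matrix ι ι ℂ}

/-- The submodule of block upper triangular matrices. -/
def upperSubmodule (p : ℝ → Matrix ι ι ℂ) : Submodule ℂ (Matrix ι ι ℂ) where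
  carrier := {x | IsUpper p x}
  add_mem' := fun hx hy => hx.add hy
  zero_mem' := fun c d _ => by simp
  smul_mem' := fun a x hx c d hcd => by
    rw [Matrix.mul_smul, Matrix.smul_mul, hx c d hcd, smul_zero]

/-- The submodule of strictly block upper triangular matrices. -/
def strictSubmodule (p : ℝ → Matrix ι ι ℂ) : Submodule ℂ (Matrix ι ι ℂ) where
  carrier := {x | IsStrict p x}
  add_mem' := fun hx hy => hx.add hy
  zero_mem' := fun c d _ => by simp
  smul_mem' := fun a x hx c d hcd => by
    rw [Matrix.mul_smul, Matrix.smul_mul, hx c d hcd, smul_zero]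

namespace IsSpectral

variable (h : IsSpectral R H s p)
include h

theorem isUpper_pow {x : Matrix ι ι ℂ} (hx : IsUpper p x) (k : ℕ) : IsUpper p (x ^ k) := by
  induction k with
  | zero => rw [pow_zero]; exact h.isUpper_one
  | succ k ih => rw [pow_succ]; exact h.upper_mul ih hx

theorem isUpper_exp {x : Matrix ι ι ℂ} (hx : IsUpper p x) : IsUpper p (NormedSpace.exp x) :=
  exp_mem ((upperSubmodule p).restrictScalars ℝ) (h.isUpper_pow hx)

theorem isStrict_exp {x : Matrix ι ι ℂ} (hx : IsStrict p x) :
    IsStrict p (NormedSpace.exp x - 1) :=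
  exp_sub_one_mem ((strictSubmodule p).restrictScalars ℝ) fun k => by
    rw [pow_succ]
    exact h.mul_strict (h.isUpper_pow hx.isUpper k) hx

theorem isUpper_of_exp {x : Matrix ι ι ℂ} (hx : ∀ t : ℝ, IsUpper p (NormedSpace.exp (t • x))) :
    IsUpper p x :=
  mem_of_exp_smul_mem ((upperSubmodule p).restrictScalars ℝ) fun t =>
    (hx t).sub h.isUpper_one

theorem isStrict_of_exp {x : Matrix ι ι ℂ}
    (hx : ∀ t : ℝ, IsStrict p (NormedSpace.exp (t • x) - 1)) : IsStrict p x :=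
  mem_of_exp_smul_mem ((strictSubmodule p).restrictScalars ℝ) hx

end IsSpectral

end Projections

theorem continuous_dag (R : (Matrix ι ι ℂ)ˣ) : Continuous (dag R) := by
  have : (dag R : Matrix ι ι ℂ → Matrix ι ι ℂ) = fun x => _ := funext fun x => dag_def R x
  rw [this]
  exact (continuous_const.matrix_mul ((continuous_const.matrix_mul
    continuous_id).matrix_mul continuous_const).matrix_conjTranspose).matrix_mul continuous_const

/-! ### Levi decomposition and generic grading elements -/

section LeviDecomposition

open Filter Topology
open scoped Matrix.Norms.Operator

/-- The centralizer of `H` in the isometry group of `S`. -/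
def leviGroup {S : Matrix ι ι ℂ} {ε : ℂ} (hS : IsFormMatrix S ε) (H : Matrix ι ι ℂ) :
    Subgroup (GL ι ℂ) where
  carrier := {g | g ∈ isoGroup S hS ∧ H * (g : Matrix ι ι ℂ) = (g : Matrix ι ι ℂ) * H}
  mul_mem' := fun {a b} ha hb => ⟨mul_mem ha.1 hb.1, by
    rw [Units.val_mul, ← Matrix.mul_assoc, ha.2, Matrix.mul_assoc, hb.2, Matrix.mul_assoc]⟩
  one_mem' := ⟨one_mem _, by simp⟩
  inv_mem' := fun {a} ha => ⟨inv_mem ha.1,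
    (show Commute H (a : Matrix ι ι ℂ) from ha.2).units_inv_right⟩

section

variable {S : Matrix ι ι ℂ} {ε : ℂ} {hS : IsFormMatrix S ε} {H : Matrix ι ι ℂ}

theorem mem_lieAlg_leviGroup {X : Matrix ι ι ℂ} :
    X ∈ lieAlg (leviGroup hS H) ↔ X ∈ skew S ∧ H * X = X * H := by
  constructor
  · intro h
    refine ⟨mem_lieAlg_isoGroup.1 (lieAlg_mono (fun g hg => hg.1 : leviGroup hS H ≤ isoGroup S hS) h),
      commute_of_exp_smul fun t => (mem_lieAlg_iff.1 h t).2⟩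
  · rintro ⟨h1, h2⟩
    rw [mem_lieAlg_iff]
    refine fun t => ⟨mem_lieAlg_iff.1 (mem_lieAlg_isoGroup.2 h1) t, commute_exp ?_⟩
    rw [Matrix.mul_smul, Matrix.smul_mul, h2]

end

namespace IsGradedParabolic

variable {S : Matrix ι ι ℂ} {ε : ℂ} {hS : IsFormMatrix S ε} {R : (Matrix ι ι ℂ)ˣ}
  {𝔭 : Submodule ℂ (Matrix ι ι ℂ)} {H : Matrix ι ι ℂ} {s : Finset ℝ} {p : ℝ → Matrix ι ι ℂ}

section

variable (h : IsGradedParabolic hS R 𝔭 H s p)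
include h

theorem isUpper_inv {g : GL ι ℂ} (hg : g ∈ isoGroup S hS) (hu : IsUpper p (g : Matrix ι ι ℂ)) :
    IsUpper p (↑g⁻¹ : Matrix ι ι ℂ) := by
  rw [inv_eq_adj hg]
  exact h.spectral.isUpper_adj hS h.grading.mem_skew hu

theorem isUpper_of_sub_one {x : Matrix ι ι ℂ} (hx : IsStrict p (x - 1)) : IsUpper p x := by
  simpa using hx.isUpper.add h.spectral.isUpper_one

/-- The group of isometries which are block unitriangular. -/
def uniGroup : Subgroup (GL ι ℂ) where
  carrier := {g | g ∈ isoGroup S hS ∧ IsStrict p ((g : Matrix ι ι ℂ) - 1)}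
  mul_mem' := fun {a b} ha hb => ⟨mul_mem ha.1 hb.1, by
    have : ((a * b : GL ι ℂ) : Matrix ι ι ℂ) - 1 =
        ((a : Matrix ι ι ℂ) - 1) * b + ((b : Matrix ι ι ℂ) - 1) := by
      rw [Units.val_mul, sub_mul, Matrix.one_mul]; abel
    rw [this]
    exact (h.spectral.strict_mul ha.2 (h.isUpper_of_sub_one hb.2)).add hb.2⟩
  one_mem' := ⟨one_mem _, fun c d _ => by simp⟩
  inv_mem' := fun {a} ha => ⟨inv_mem ha.1, by
    have : ((a⁻¹ : GL ι ℂ) : Matrix ι ι ℂ) - 1 =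
        -((↑a⁻¹ : Matrix ι ι ℂ) * ((a : Matrix ι ι ℂ) - 1)) := by
      rw [mul_sub, Units.inv_mul, Matrix.mul_one, neg_sub]
    rw [this]
    exact (h.spectral.mul_strict (h.isUpper_inv ha.1 (h.isUpper_of_sub_one ha.2)) ha.2).neg⟩

theorem mem_uniGroup {g : GL ι ℂ} : g ∈ h.uniGroup ↔
    g ∈ isoGroup S hS ∧ IsStrict p ((g : Matrix ι ι ℂ) - 1) := Iff.rfl

theorem mem_lieAlg_uniGroup {X : Matrix ι ι ℂ} : X ∈ lieAlg h.uniGroup ↔ X ∈ nilrad S 𝔭 := by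
  rw [h.mem_nilrad_iff]
  constructor
  · intro hX
    exact ⟨mem_lieAlg_isoGroup.1 (lieAlg_mono (fun g hg => hg.1 : h.uniGroup ≤ isoGroup S hS) hX),
      h.spectral.isStrict_of_exp fun t => (mem_lieAlg_iff.1 hX t).2⟩
  · rintro ⟨h1, h2⟩
    rw [mem_lieAlg_iff]
    exact fun t => ⟨mem_lieAlg_iff.1 (mem_lieAlg_isoGroup.2 h1) t,
      h.spectral.isStrict_exp (((strictSubmodule p).restrictScalars ℝ).smul_mem t h2)⟩

theorem mem_lieAlg_of_isNormalizer {P : Subgroup (GL ι ℂ)} (hP : IsNormalizer hS 𝔭 P)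
    {X : Matrix ι ι ℂ} : X ∈ lieAlg P ↔ X ∈ 𝔭 := by
  have hP' : ∀ g, g ∈ P ↔ g ∈ isoGroup S hS ∧ IsUpper p (g : Matrix ι ι ℂ) := fun g => by
    rw [hP]
    exact and_congr_right fun hg => h.normalizes_iff hg
  rw [h.mem_iff]
  constructor
  · intro hX
    refine ⟨mem_lieAlg_isoGroup.1 (lieAlg_mono (fun g hg => ((hP' g).1 hg).1) hX), ?_⟩
    exact h.spectral.isUpper_of_exp fun t => ((hP' _).1 (mem_lieAlg_iff.1 hX t)).2
  · rintro ⟨h1, h2⟩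
    rw [mem_lieAlg_iff]
    exact fun t => (hP' _).2 ⟨mem_lieAlg_iff.1 (mem_lieAlg_isoGroup.2 h1) t,
      h.spectral.isUpper_exp (((upperSubmodule p).restrictScalars ℝ).smul_mem t h2)⟩

/-- Taking block diagonal parts is multiplicative on block upper triangular matrices. So the
diagonal part l of g is again an isometry, and l⁻¹ g is unitriangular: this is the Levi
decomposition of P. -/
theorem exists_blk_unit {g : GL ι ℂ} (hg : g ∈ isoGroup S hS) (hu : IsUpper p (g : Matrix ι ι ℂ)) :
    ∃ l ∈ leviGroup hS H, (l : Matrix ι ι ℂ) = blk s p g ∧ l⁻¹ * g ∈ h.uniGroup := by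
  have hu' := h.isUpper_inv hg hu
  let l : GL ι ℂ := ⟨blk s p g, blk s p (↑g⁻¹ : Matrix ι ι ℂ),
    by rw [← h.spectral.blk_mul hu hu', Units.mul_inv, h.spectral.blk_one],
    by rw [← h.spectral.blk_mul hu' hu, Units.inv_mul, h.spectral.blk_one]⟩
  have hl : (l : Matrix ι ι ℂ) = blk s p g := rfl
  have hl' : (↑l⁻¹ : Matrix ι ι ℂ) = blk s p (↑g⁻¹ : Matrix ι ι ℂ) := rfl
  have hst : IsStrict p (((l⁻¹ * g : GL ι ℂ) : Matrix ι ι ℂ) - 1) := by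
    have : ((l⁻¹ * g : GL ι ℂ) : Matrix ι ι ℂ) - 1 =
        (↑l⁻¹ : Matrix ι ι ℂ) * ((g : Matrix ι ι ℂ) - blk s p g) := by
      rw [mul_sub, ← hl, Units.inv_mul, Units.val_mul]
    rw [this]
    refine h.spectral.mul_strict ?_ (h.spectral.sub_blk_strict hu)
    rw [hl']
    exact h.spectral.isUpper_of_commute (h.spectral.commute_blk _)
  have hdet : ((l⁻¹ * g : GL ι ℂ) : Matrix ι ι ℂ).det = 1 := by
    have := det_one_add_of_isNilpotent (h.spectral.isNilpotent_of_strict hst)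
    rwa [add_sub_cancel] at this
  have hlm : l ∈ isoGroup S hS := by
    refine ⟨?_, ?_⟩
    · rw [hl, ← h.spectral.blk_adj hS h.grading.mem_skew, ← h.spectral.blk_mul
        (h.spectral.isUpper_adj hS h.grading.mem_skew hu) hu, hg.1, h.spectral.blk_one]
    · have h1 : (g : Matrix ι ι ℂ) = l * ((l⁻¹ * g : GL ι ℂ) : Matrix ι ι ℂ) := by
        rw [← Units.val_mul, mul_inv_cancel_left]
      have h2 := hg.2
      rw [h1, Matrix.det_mul, hdet, mul_one] at h2
      exact h2
  exact ⟨l, ⟨hlm, h.spectral.commute_blk _⟩, hl, mul_mem (inv_mem hlm) hg, hst⟩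

theorem commute_of_forall_leviGroup {D : Matrix ι ι ℂ}
    (hD : ∀ g ∈ leviGroup hS H, D * (g : Matrix ι ι ℂ) = g * D) {y : Matrix ι ι ℂ}
    (hy : y ∈ skew S) (hHy : H * y = y * H) : D * y = y * D :=
  commute_of_exp_smul fun t => hD _ (mem_lieAlg_iff.1 (mem_lieAlg_leviGroup.2 ⟨hy, hHy⟩) t)

/-- Small perturbations of H by a self-adjoint D commuting with the Levi group remain gradings. The
only open condition is positivity on 𝔫, and it survives because the quadratic form of H has a
positive minimum on the compact unit sphere of 𝔫. -/
theorem eventually_isGrading {D : Matrix ι ι ℂ} (hDs : D ∈ skew S) (hDd : dag R D = D)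
    (hD : ∀ g ∈ leviGroup hS H, D * (g : Matrix ι ι ℂ) = g * D) :
    ∀ᶠ δ : ℝ in 𝓝[>] (0 : ℝ), IsGrading hS R 𝔭 (H + (δ : ℂ) • D) := by
  have hDH : D * H = H * D := h.commute_of_forall_leviGroup hD h.grading.mem_skew rfl
  have hD𝔭 : D ∈ 𝔭 := h.mem_of_commute hDs hDH.symm
  have hconj : ∀ g ∈ isoGroup S hS, (∀ X ∈ 𝔭, Ad g X ∈ 𝔭) → Ad g D - D ∈ nilrad S 𝔭 := by
    intro g hg hn
    rw [h.mem_nilrad_iff]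
    refine ⟨sub_mem (Ad_mem_skew hg hDs) hDs, ?_⟩
    have hu := (h.normalizes_iff hg).1 hn
    obtain ⟨l, hl, -, hlg⟩ := h.exists_blk_unit hg hu
    -- Writing g = lu with u unitriangular and l commuting with D, one gets Ad g D - D = l [u - 1,
    -- D] g⁻¹, which is strict.
    have e1 : Ad g D - D = ((l : Matrix ι ι ℂ) *
        ((((l⁻¹ * g : GL ι ℂ) : Matrix ι ι ℂ) - 1) * D -
          D * (((l⁻¹ * g : GL ι ℂ) : Matrix ι ι ℂ) - 1))) * (↑g⁻¹ : Matrix ι ι ℂ) := by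
      have e2 : (((l⁻¹ * g : GL ι ℂ) : Matrix ι ι ℂ) - 1) * D -
          D * (((l⁻¹ * g : GL ι ℂ) : Matrix ι ι ℂ) - 1) =
          (↑l⁻¹ : Matrix ι ι ℂ) * (g * D - D * g) := by
        have e3 : D * ((↑l⁻¹ : Matrix ι ι ℂ) * (g : Matrix ι ι ℂ)) =
            (↑l⁻¹ : Matrix ι ι ℂ) * (D * g) := by
          rw [← Matrix.mul_assoc, hD _ (inv_mem hl), Matrix.mul_assoc]
        rw [Units.val_mul, mul_sub D, e3]
        simp only [sub_mul, mul_sub, Matrix.mul_assoc, Matrix.one_mul, Matrix.mul_one]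
        abel
      rw [e2, Units.mul_inv_cancel_left, sub_mul, Matrix.mul_assoc D, Units.mul_inv, Matrix.mul_one,
        Ad]
    have hDu := h.spectral.isUpper_of_commute hDH.symm
    rw [e1]
    exact h.spectral.strict_mul (h.spectral.mul_strict (h.spectral.isUpper_of_commute hl.2)
      ((h.spectral.strict_mul hlg.2 hDu).sub (h.spectral.mul_strict hDu hlg.2)))
      (h.isUpper_inv hg hu)
  let F : Matrix ι ι ℂ → Matrix ι ι ℂ → ℝ := fun A x => (dag R x * (A * x - x * A)).trace.re
  have hF : ∀ A, Continuous (F A) := fun A => by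
    refine Complex.continuous_re.comp (Continuous.matrix_trace ((continuous_dag R).mul ?_))
    exact (continuous_const.mul continuous_id).sub (continuous_id.mul continuous_const)
  have hFs : ∀ (A x : Matrix ι ι ℂ) (r : ℝ), F A ((r : ℂ) • x) = r ^ 2 * F A x := by
    intro A x r
    simp only [F]
    rw [map_smulₛₗ, Complex.conj_ofReal, Matrix.mul_smul, Matrix.smul_mul (r : ℂ) x A,
      ← smul_sub, Matrix.mul_smul, Matrix.smul_mul, smul_smul, Matrix.trace_smul, ← Complex.ofReal_mul, smul_eq_mul,
      Complex.re_ofReal_mul, sq]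
  have hFa : ∀ (δ : ℝ) x, F (H + (δ : ℂ) • D) x = F H x + δ * F D x := by
    intro δ x
    simp only [F]
    have e : dag R x * ((H + (δ : ℂ) • D) * x - x * (H + (δ : ℂ) • D)) =
        dag R x * (H * x - x * H) + (δ : ℂ) • (dag R x * (D * x - x * D)) := by
      simp only [add_mul, mul_add, mul_sub, Matrix.smul_mul, Matrix.mul_smul, smul_sub]
      abel
    rw [e, Matrix.trace_add, Matrix.trace_smul, Complex.add_re, smul_eq_mul, Complex.re_ofReal_mul]
  have hcomp : IsCompact (Metric.sphere (0 : Matrix ι ι ℂ) 1 ∩ (nilrad S 𝔭 : Set (Matrix ι ι ℂ))) :=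
    (isCompact_sphere _ _).inter_right (Submodule.closed_of_finiteDimensional _)
  have hev : ∀ᶠ δ : ℝ in 𝓝[>] (0 : ℝ), ∀ x ∈ nilrad S 𝔭, x ≠ 0 → 0 < F (H + (δ : ℂ) • D) x := by
    have hred : ∀ δ : ℝ, (∀ x ∈ Metric.sphere (0 : Matrix ι ι ℂ) 1 ∩
        (nilrad S 𝔭 : Set (Matrix ι ι ℂ)), 0 < F (H + (δ : ℂ) • D) x) →
        ∀ x ∈ nilrad S 𝔭, x ≠ 0 → 0 < F (H + (δ : ℂ) • D) x := by
      intro δ hδ x hx hx0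
      have hn : ‖x‖ ≠ 0 := norm_ne_zero_iff.2 hx0
      have h1 := hδ (((‖x‖⁻¹ : ℝ) : ℂ) • x) ⟨by
        rw [mem_sphere_zero_iff_norm, norm_smul, Complex.norm_real, norm_inv, norm_norm,
          inv_mul_cancel₀ hn], Submodule.smul_mem _ _ hx⟩
      rw [hFs] at h1
      exact pos_of_mul_pos_right h1 (sq_nonneg _)
    rcases (Metric.sphere (0 : Matrix ι ι ℂ) 1 ∩
      (nilrad S 𝔭 : Set (Matrix ι ι ℂ))).eq_empty_or_nonempty with hemp | hne
    · refine Eventually.of_forall fun δ => hred δ ?_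
      rw [hemp]
      exact fun x hx => hx.elim
    · obtain ⟨x0, hx0, hmin⟩ := hcomp.exists_isMinOn hne (hF H).continuousOn
      obtain ⟨x1, hx1, hmin1⟩ := hcomp.exists_isMinOn hne (hF D).continuousOn
      have hpos : 0 < F H x0 := h.grading.pos x0 hx0.2 (by
        rintro rfl
        simpa using hx0.1)
      have hlim : Tendsto (fun δ : ℝ => F H x0 + δ * F D x1) (𝓝[>] 0) (𝓝 (F H x0)) := by
        have : Continuous fun δ : ℝ => F H x0 + δ * F D x1 := by fun_prop
        simpa using (this.tendsto 0).mono_left nhdsWithin_le_nhds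
      filter_upwards [hlim.eventually (lt_mem_nhds hpos), self_mem_nhdsWithin] with δ h1 h2
      refine hred δ fun x hx => ?_
      rw [hFa]
      have h3 := hmin hx
      have h4 := hmin1 hx
      simp only [Set.mem_ofPred_eq] at h3 h4
      exact h1.trans_le (add_le_add h3 (mul_le_mul_of_nonneg_left h4 (le_of_lt h2)))
  filter_upwards [hev] with δ hδ
  refine ⟨add_mem h.grading.mem_skew (Submodule.smul_mem _ _ hDs),
    add_mem h.grading.mem_parabolic (Submodule.smul_mem _ _ hD𝔭), ?_, fun y hy hy' => ?_, hδ,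
    fun g hg hn => ?_⟩
  · rw [map_add, map_smulₛₗ, h.grading.dag_eq, hDd, Complex.conj_ofReal]
  · have h1 := h.grading.comm y hy hy'
    rw [add_mul, mul_add, h1, Matrix.smul_mul, Matrix.mul_smul,
      h.commute_of_forall_leviGroup hD (h.parabolic.le_skew hy) h1]
  · have e1 : Ad g (H + (δ : ℂ) • D) - (H + (δ : ℂ) • D) =
        (Ad g H - H) + (δ : ℂ) • (Ad g D - D) := by
      rw [Ad_add, show Ad g ((δ : ℂ) • D) = (δ : ℂ) • Ad g D from map_smul (AdLin g) _ _, smul_sub]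
      abel
    rw [e1]
    exact add_mem (h.grading.conj g hg hn) (Submodule.smul_mem _ _ (hconj g hg hn))

end

/-- There is a grading element whose kernel is as small as possible. -/
theorem exists_generic (hS : IsFormMatrix S ε) (hc : IsCompatible S R)
    (hp : IsParabolicSpace S 𝔭) : ∃ H s p, IsGradedParabolic hS R 𝔭 H s p ∧
      ∀ D ∈ skew S, dag R D = D → (∀ g ∈ leviGroup hS H, D * (g : Matrix ι ι ℂ) = g * D) →
        D * p 0 = 0 := by
  obtain ⟨H0, hH0⟩ := exists_isGrading hS hc hp
  -- This is the dimension of the kernel of H times the size of the matrices, so minimizing it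
  -- minimizes the kernel of H.
  let rk : Matrix ι ι ℂ → ℕ := fun H => Module.finrank ℂ (LinearMap.ker (LinearMap.mulLeft ℂ H))
  have hmem : ∀ {A x : Matrix ι ι ℂ}, x ∈ LinearMap.ker (LinearMap.mulLeft ℂ A) ↔ A * x = 0 :=
    Iff.rfl
  obtain ⟨H, hH, hmin⟩ := exists_minimalFor_of_wellFoundedLT (fun H => IsGrading hS R 𝔭 H) rk
    ⟨H0, hH0⟩
  obtain ⟨s, p, hsp⟩ := exists_isSpectral R hH.dag_eq
  have h : IsGradedParabolic hS R 𝔭 H s p := ⟨hc, hp, hH, hsp⟩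
  refine ⟨H, s, p, h, fun D hDs hDd hD => ?_⟩
  by_contra hne
  have hDH : D * H = H * D := h.commute_of_forall_leviGroup hD h.grading.mem_skew rfl
  have hdet0 : (p 0 + H).det ≠ 0 := by
    have : (p 0 + H) * ∑ c ∈ s, (if c = 0 then 1 else (c : ℂ)⁻¹) • p c = 1 := by
      rw [Matrix.mul_sum, ← hsp.sum_eq]
      refine Finset.sum_congr rfl fun c _ => ?_
      rw [Matrix.mul_smul, add_mul, hsp.left]
      by_cases hc : c = 0
      · subst hc
        simp [hsp.idem]
      · rw [hsp.ortho _ _ (Ne.symm hc), zero_add, if_neg hc, smul_smul, inv_mul_cancel₀, one_smul]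
        exact_mod_cast hc
    exact (Matrix.isUnit_det_of_right_inverse this).ne_zero
  have hcont : Continuous fun δ : ℝ => (p 0 + (H + (δ : ℂ) • D)).det := by fun_prop
  have hev : ∀ᶠ δ : ℝ in 𝓝[>] (0 : ℝ), (p 0 + (H + (δ : ℂ) • D)).det ≠ 0 := by
    refine nhdsWithin_le_nhds ((hcont.tendsto 0).eventually_ne ?_)
    simpa using hdet0
  obtain ⟨δ, ⟨hδ1, hδ2⟩, hδ3⟩ :=
    ((h.eventually_isGrading hDs hDd hD).and hev |>.and self_mem_nhdsWithin).exists
  have hTp : (H + (δ : ℂ) • D) * p 0 = p 0 * (H + (δ : ℂ) • D) := by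
    rw [add_mul, mul_add, hsp.left, hsp.right, Matrix.smul_mul, Matrix.mul_smul,
      hsp.commute_proj hDH.symm]
  -- For small δ the matrix p 0 + H + δD is invertible and commutes with p 0, so the kernel of H +
  -- δD lies in V_0. If D p 0 ≠ 0 the kernel is strictly smaller than V_0, contrary to minimality.
  have hle : LinearMap.ker (LinearMap.mulLeft ℂ (H + (δ : ℂ) • D)) ≤
      LinearMap.ker (LinearMap.mulLeft ℂ H) := by
    intro x hx
    rw [hmem] at hx ⊢
    have h1 : (p 0 + (H + (δ : ℂ) • D)) * (x - p 0 * x) = 0 := by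
      rw [add_mul, mul_sub, mul_sub, ← Matrix.mul_assoc, ← Matrix.mul_assoc, hsp.idem, hTp, hx,
        Matrix.mul_assoc, hx]
      simp
    have h2 : x - p 0 * x = 0 := by
      rw [← Matrix.one_mul (x - p 0 * x), ← Matrix.nonsing_inv_mul _ (Ne.isUnit hδ2),
        Matrix.mul_assoc, h1, Matrix.mul_zero]
    rw [sub_eq_zero.1 h2, ← Matrix.mul_assoc, hsp.left]
    simp
  have hlt : rk (H + (δ : ℂ) • D) < rk H := by
    refine Submodule.finrank_lt_finrank_of_lt (lt_of_le_of_ne hle fun heq => hne ?_)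
    have h1 : p 0 ∈ LinearMap.ker (LinearMap.mulLeft ℂ H) := by
      rw [hmem, hsp.left]; simp
    rw [← heq, hmem, add_mul, hsp.left, Complex.ofReal_zero, zero_smul, zero_add, Matrix.smul_mul] at h1
    refine (smul_eq_zero.1 h1).resolve_left ?_
    exact_mod_cast (ne_of_gt hδ3)
  exact absurd (hmin hδ1 hlt.le) (not_le.2 hlt)

end IsGradedParabolic

end LeviDecomposition

/-! ### Nil algebras of matrices -/

section NilAlgebras

/-- The Fitting idempotent of x is a polynomial in x without constant term, hence an element of N.
Its trace is its rank, so it is zero and x is nilpotent. -/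
theorem isNilpotent_of_forall_trace_eq_zero {N : Submodule ℂ (Matrix ι ι ℂ)} (hmul : N * N ≤ N)
    (htr : ∀ x ∈ N, x.trace = 0) {x : Matrix ι ι ℂ} (hx : x ∈ N) : IsNilpotent x := by
  have hint : IsIntegral ℂ x := Algebra.IsIntegral.isIntegral x
  obtain ⟨r, hr, hr'⟩ := Polynomial.exists_eq_pow_rootMultiplicity_mul_and_not_dvd (minpoly ℂ x)
    (minpoly.ne_zero hint) 0
  rw [map_zero, sub_zero] at hr hr'
  set m := (minpoly ℂ x).rootMultiplicity 0
  have hcop : IsCoprime ((Polynomial.X : Polynomial ℂ) ^ (m + 1)) r :=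
    (Polynomial.irreducible_X.coprime_iff_not_dvd.2 hr').pow_left
  obtain ⟨a, b, hab⟩ := hcop
  have h0 : x ^ m * Polynomial.aeval x r = 0 := by
    have := minpoly.aeval ℂ x
    rwa [hr, map_mul, map_pow, Polynomial.aeval_X] at this
  have h1 : Polynomial.aeval x a * x ^ (m + 1) + Polynomial.aeval x b * Polynomial.aeval x r = 1 := by
    have := congrArg (Polynomial.aeval x) hab
    simpa using this
  set e := Polynomial.aeval x a * x ^ (m + 1) with he
  have hc : ∀ q q' : Polynomial ℂ, Polynomial.aeval x q * Polynomial.aeval x q' =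
      Polynomial.aeval x q' * Polynomial.aeval x q := fun q q' => by
    rw [← map_mul, mul_comm, map_mul]
  have hxr : Polynomial.aeval x b * Polynomial.aeval x r = 1 - e := eq_sub_of_add_eq' h1
  have hxm : x ^ m * (1 - e) = 0 := by
    rw [← hxr, hc b r, ← Matrix.mul_assoc, h0, Matrix.zero_mul]
  have hee : e * e = e := by
    have : e * (1 - e) = 0 := by
      calc e * (1 - e) = Polynomial.aeval x a * x ^ (m + 1) * (1 - e) := congrArg (· * (1 - e)) he
        _ = Polynomial.aeval x a * (x * (x ^ m * (1 - e))) := by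
          rw [pow_succ']; simp only [Matrix.mul_assoc]
        _ = 0 := by rw [hxm]; simp
    rw [mul_sub, Matrix.mul_one, sub_eq_zero] at this
    exact this.symm
  have hN : ∀ (q : Polynomial ℂ), ∀ y ∈ N, Polynomial.aeval x q * y ∈ N := by
    intro q
    induction q using Polynomial.induction_on with
    | C c =>
      intro y hy
      rw [Polynomial.aeval_C, ← Algebra.smul_def]
      exact N.smul_mem _ hy
    | add q q' hq hq' =>
      intro y hy
      rw [map_add, add_mul]
      exact add_mem (hq y hy) (hq' y hy)
    | monomial k c ih =>
      intro y hy
      rw [pow_succ, ← mul_assoc, map_mul, Polynomial.aeval_X, Matrix.mul_assoc]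
      exact ih _ (hmul (Submodule.mul_mem_mul hx hy))
  have heN : e ∈ N := by
    rw [he, pow_succ, ← Matrix.mul_assoc]
    have := hN (a * Polynomial.X ^ m) x hx
    simpa using this
  have he0 : e = 0 := by
    have h2 : IsIdempotentElem (Matrix.toLin' e) := by
      rw [IsIdempotentElem, Module.End.mul_eq_comp, ← Matrix.toLin'_mul, hee]
    have h3 := LinearMap.IsIdempotentElem.eq_zero_of_trace_eq_zero h2 (by rw [Matrix.trace_toLin'_eq, htr e heN])
    simpa using h3
  exact ⟨m, by rw [he0, sub_zero, Matrix.mul_one] at hxm; exact hxm⟩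

/-- After adjoining scalars, N becomes a nil ideal of an Artinian ring. It is contained in the
Jacobson radical, which is nilpotent. -/
theorem exists_pow_eq_bot {N : Submodule ℂ (Matrix ι ι ℂ)} (hmul : N * N ≤ N)
    (hnil : ∀ x ∈ N, IsNilpotent x) : ∃ k, N ^ k = ⊥ := by
  obtain ⟨A, hA⟩ : ∃ A : Subalgebra ℂ (Matrix ι ι ℂ), ∀ {x}, x ∈ A ↔
      ∃ c : ℂ, ∃ y ∈ N, x = algebraMap ℂ _ c + y := ⟨
    { carrier := {x | ∃ c : ℂ, ∃ y ∈ N, x = algebraMap ℂ _ c + y}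
      mul_mem' := by
        rintro _ _ ⟨c, y, hy, rfl⟩ ⟨d, z, hz, rfl⟩
        refine ⟨c * d, c • z + d • y + y * z, add_mem (add_mem (N.smul_mem _ hz) (N.smul_mem _ hy))
          (hmul (Submodule.mul_mem_mul hy hz)), ?_⟩
        rw [Algebra.smul_def, Algebra.smul_def, Algebra.commutes d y, map_mul]
        noncomm_ring
      add_mem' := by
        rintro _ _ ⟨c, y, hy, rfl⟩ ⟨d, z, hz, rfl⟩
        exact ⟨c + d, y + z, add_mem hy hz, by rw [map_add]; abel⟩
      algebraMap_mem' := fun c => ⟨c, 0, zero_mem _, by simp⟩ }, Iff.rfl⟩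
  have hNA : ∀ x ∈ N, x ∈ A := fun x hx => hA.2 ⟨0, x, hx, by simp⟩
  have : IsArtinianRing A := IsArtinianRing.of_finite ℂ A
  let J : Ideal A := Ideal.jacobson ⊥
  obtain ⟨k, hk⟩ : ∃ k, J ^ k = 0 := IsArtinianRing.isNilpotent_jacobson_bot (R := A)
  have hJ : ∀ x (hx : x ∈ N), (⟨x, hNA x hx⟩ : A) ∈ Ideal.jacobson (⊥ : Ideal A) := by
    intro x hx
    rw [Ideal.mem_jacobson_iff]
    intro y
    obtain ⟨c, w, hw, hy⟩ := hA.1 y.2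
    have h1 : (y : Matrix ι ι ℂ) * x ∈ N := by
      rw [hy, add_mul, ← Algebra.smul_def]
      exact add_mem (N.smul_mem _ hx) (hmul (Submodule.mul_mem_mul hw hx))
    set x' : A := ⟨x, hNA x hx⟩ with hx'
    have h2 : IsNilpotent (y * x') := by
      obtain ⟨j, hj⟩ := hnil _ h1
      exact ⟨j, Subtype.ext (by simpa using hj)⟩
    obtain ⟨u, hu⟩ := h2.isUnit_one_add
    refine ⟨↑u⁻¹, ?_⟩
    have h3 : (↑u⁻¹ : A) * y * x' + ↑u⁻¹ - 1 = ↑u⁻¹ * (1 + y * x') - 1 := by noncomm_ring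
    rw [Ideal.mem_bot, h3, ← hu, Units.inv_mul, sub_self]
  have hpow : ∀ (m : ℕ) (x : Matrix ι ι ℂ), x ∈ N ^ m → ∃ a : A, a ∈ J ^ m ∧ A.val a = x := by
    intro m
    induction m with
    | zero =>
      intro x hx
      rw [pow_zero, Submodule.mem_one] at hx
      obtain ⟨c, rfl⟩ := hx
      exact ⟨algebraMap ℂ A c, by rw [Submodule.pow_zero, Ideal.one_eq_top]; trivial, rfl⟩
    | succ m ih =>
      intro x hx
      rw [pow_succ] at hx
      refine Submodule.mul_induction_on hx ?_ ?_
      · intro y hy z hz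
        obtain ⟨a, ha, rfl⟩ := ih y hy
        exact ⟨a * ⟨z, hNA z hz⟩, by
          rw [Submodule.pow_succ]; exact Ideal.mul_mem_mul ha (hJ z hz), rfl⟩
      · rintro _ _ ⟨a, ha, rfl⟩ ⟨b, hb, rfl⟩
        exact ⟨a + b, add_mem ha hb, rfl⟩
  refine ⟨k, (Submodule.eq_bot_iff _).2 fun x hx => ?_⟩
  obtain ⟨a, ha, rfl⟩ := hpow k x hx
  rw [hk] at ha
  rw [show a = 0 from ha]
  rfl

end NilAlgebras

/-! ### The unipotent radical -/

section UnipotentRadical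

open Filter Topology
open scoped Matrix.Norms.Operator

theorem mul_exp_of_mul_eq {A X : Matrix ι ι ℂ} {c : ℝ} (h : A * X = (c : ℂ) • A) :
    A * NormedSpace.exp X = (Real.exp c : ℂ) • A := by
  have h1 := (hasSum_exp X).map (LinearMap.mulLeft ℝ A) (LinearMap.continuous_of_finiteDimensional _)
  have h2 : ∀ k : ℕ, A * X ^ k = ((c ^ k : ℝ) : ℂ) • A := by
    intro k
    induction k with
    | zero => simp
    | succ k ih =>
      rw [pow_succ, ← Matrix.mul_assoc, ih, Matrix.smul_mul, h, smul_smul, pow_succ,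
        Complex.ofReal_mul]
  have h3 : HasSum (fun n : ℕ => ((n.factorial : ℝ)⁻¹ • c ^ n : ℝ) • A) (Real.exp c • A) := by
    rw [Real.exp_eq_exp_ℝ]
    exact (NormedSpace.exp_series_hasSum_exp' (𝕂 := ℝ) c).smul_const A
  refine h1.unique ?_
  change HasSum _ (Real.exp c • A)
  convert h3 using 1
  funext n
  rw [Function.comp_apply, map_smul, LinearMap.mulLeft_apply, h2, smul_eq_mul, mul_smul]
  rfl

theorem exp_mul_of_mul_eq {A X : Matrix ι ι ℂ} {c : ℝ} (h : X * A = (c : ℂ) • A) :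
    NormedSpace.exp X * A = (Real.exp c : ℂ) • A := by
  have h1 : Aᵀ * Xᵀ = (c : ℂ) • Aᵀ := by rw [← Matrix.transpose_mul, h, Matrix.transpose_smul]
  have h2 := congrArg Matrix.transpose (mul_exp_of_mul_eq h1)
  rwa [Matrix.exp_transpose, ← Matrix.transpose_mul, Matrix.transpose_transpose,
    Matrix.transpose_smul, Matrix.transpose_transpose] at h2

/-- A subgroup cut out by matrices whose entries are polynomials is algebraic. -/
theorem isAlgebraic_of_matrices {G : Subgroup (GL ι ℂ)}
    (F : Set (Matrix ι ι (MvPolynomial (ι × ι) ℂ)))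
    (h : ∀ g : GL ι ℂ, g ∈ G ↔ ∀ M ∈ F, (MvPolynomial.eval fun ij : ι × ι =>
      (g : Matrix ι ι ℂ) ij.1 ij.2).mapMatrix M = 0) : IsAlgebraic G := by
  refine ⟨{q | ∃ M ∈ F, ∃ i j, q = M i j}, fun g => ?_⟩
  rw [h]
  constructor
  · rintro h1 q ⟨M, hM, i, j, rfl⟩
    exact congrFun (congrFun (h1 M hM) i) j
  · intro h1 M hM
    ext i j
    exact h1 _ ⟨M, hM, i, j, rfl⟩

namespace IsSpectral

variable {R : (Matrix ι ι ℂ)ˣ} {H : Matrix ι ι ℂ} {s : Finset ℝ} {p : ℝ → Matrix ι ι ℂ}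
  (h : IsSpectral R H s p)
include h

theorem block_exp_conj (x : Matrix ι ι ℂ) (t c d : ℝ) :
    p c * (NormedSpace.exp (t • H) * x * NormedSpace.exp (-(t • H))) * p d =
      (Real.exp (t * (c - d)) : ℂ) • (p c * x * p d) := by
  have h1 : p c * NormedSpace.exp (t • H) = (Real.exp (t * c) : ℂ) • p c :=
    mul_exp_of_mul_eq (by
      rw [Matrix.mul_smul, h.right, Complex.ofReal_mul, mul_smul]; rfl)
  have h2 : NormedSpace.exp (-(t • H)) * p d = (Real.exp (-(t * d)) : ℂ) • p d :=
    exp_mul_of_mul_eq (by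
      rw [Matrix.neg_mul, Matrix.smul_mul, h.left, Complex.ofReal_neg, neg_smul, Complex.ofReal_mul,
        mul_smul]; rfl)
  rw [mul_sub, sub_eq_add_neg, Real.exp_add, Complex.ofReal_mul, mul_smul, ← Matrix.mul_smul, ← h2,
    ← Matrix.smul_mul, ← Matrix.smul_mul, ← h1]
  simp only [Matrix.mul_assoc]

/-- Conjugation by exp(tH) scales block (c, d) by exp(t(c - d)), so as t → -∞ the off-diagonal
blocks of a unitriangular matrix, all with c > d, die out. -/
theorem tendsto_exp_conj {x : Matrix ι ι ℂ} (hx : IsStrict p (x - 1)) :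
    Tendsto (fun t : ℝ => NormedSpace.exp (t • H) * x * NormedSpace.exp (-(t • H))) atBot (𝓝 1) := by
  have h1 : ∀ y : Matrix ι ι ℂ, y = ∑ q ∈ s ×ˢ s, p q.1 * y * p q.2 := fun y => by
    rw [Finset.sum_product]; exact h.expand y
  have e1 : (fun t : ℝ => NormedSpace.exp (t • H) * x * NormedSpace.exp (-(t • H))) = fun t : ℝ =>
      ∑ q ∈ s ×ˢ s, (Real.exp (t * (q.1 - q.2)) : ℂ) • (p q.1 * x * p q.2) := by
    funext t
    conv_lhs => rw [h1 (NormedSpace.exp (t • H) * x * NormedSpace.exp (-(t • H)))]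
    exact Finset.sum_congr rfl fun q _ => h.block_exp_conj x t q.1 q.2
  rw [h1 1, e1]
  refine tendsto_finsetSum _ fun q _ => ?_
  obtain ⟨c, d⟩ := q
  simp only
  have h2 : p c * x * p d = p c * (x - 1) * p d + p c * 1 * p d := by
    rw [mul_sub, sub_mul, sub_add_cancel]
  rcases lt_trichotomy c d with hcd | rfl | hcd
  · rw [h2, hx c d hcd.le, Matrix.mul_one, h.ortho _ _ hcd.ne]
    simp
  · rw [h2, hx c c le_rfl]
    simp
  · rw [Matrix.mul_one, h.ortho _ _ hcd.ne']
    have h3 : Tendsto (fun t : ℝ => Real.exp (t * (c - d))) atBot (𝓝 0) :=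
      Real.tendsto_exp_atBot.comp (tendsto_id.atBot_mul_const (sub_pos.2 hcd))
    have h4 := ((Complex.continuous_ofReal.tendsto 0).comp h3).smul_const (p c * x * p d)
    simpa using h4

end IsSpectral

namespace IsGradedParabolic

variable {S : Matrix ι ι ℂ} {ε : ℂ} {hS : IsFormMatrix S ε} {R : (Matrix ι ι ℂ)ˣ}
  {𝔭 : Submodule ℂ (Matrix ι ι ℂ)} {H : Matrix ι ι ℂ} {s : Finset ℝ} {p : ℝ → Matrix ι ι ℂ}
  (h : IsGradedParabolic hS R 𝔭 H s p)
include h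

theorem isAlgebraic_uniGroup : IsAlgebraic h.uniGroup := by
  let X := Matrix.mvPolynomialX ι ι ℂ
  let c : Matrix ι ι ℂ →+* Matrix ι ι (MvPolynomial (ι × ι) ℂ) := (MvPolynomial.C).mapMatrix
  have hc : ∀ (g : GL ι ℂ) (A : Matrix ι ι ℂ), (MvPolynomial.eval fun ij : ι × ι =>
      (g : Matrix ι ι ℂ) ij.1 ij.2).mapMatrix (c A) = A := by
    intro g A
    ext i j
    simp [c]
  have hX : ∀ g : GL ι ℂ, (MvPolynomial.eval fun ij : ι × ι =>
      (g : Matrix ι ι ℂ) ij.1 ij.2).mapMatrix X = g := fun g => Matrix.mvPolynomialX_mapMatrix_eval _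
  have hXt : ∀ g : GL ι ℂ, (MvPolynomial.eval fun ij : ι × ι =>
      (g : Matrix ι ι ℂ) ij.1 ij.2).mapMatrix Xᵀ = (g : Matrix ι ι ℂ)ᵀ := fun g => by
    conv_rhs => rw [← hX g]
    rfl
  -- No equation for the determinant is needed: unitriangular matrices have determinant one.
  refine isAlgebraic_of_matrices ({c Sᵀ * Xᵀ * c S * X - 1} ∪
    {M | ∃ a b : ℝ, a ≤ b ∧ M = c (p a) * (X - 1) * c (p b)}) fun g => ?_
  rw [h.mem_uniGroup]
  constructor
  · rintro ⟨h1, h2⟩ M (rfl | ⟨a, b, hab, rfl⟩)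
    · rw [map_sub, map_mul, map_mul, map_mul, hc, hc, hX, hXt, map_one, sub_eq_zero]
      exact h1.1
    · rw [map_mul, map_mul, map_sub, hc, hc, hX, map_one]
      exact h2 a b hab
  · intro hM
    have h2 : IsStrict p ((g : Matrix ι ι ℂ) - 1) := by
      intro a b hab
      have := hM _ (Or.inr ⟨a, b, hab, rfl⟩)
      rwa [map_mul, map_mul, map_sub, hc, hc, hX, map_one] at this
    have h1 := hM _ (Or.inl rfl)
    rw [map_sub, map_mul, map_mul, map_mul, hc, hc, hX, hXt, map_one, sub_eq_zero] at h1
    refine ⟨⟨h1, ?_⟩, h2⟩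
    have h3 := det_one_add_of_isNilpotent (h.spectral.isNilpotent_of_strict h2)
    rwa [add_sub_cancel] at h3

theorem exp_smul_mem_leviGroup (t : ℝ) : expGL (t • H) ∈ leviGroup hS H :=
  mem_lieAlg_iff.1 (mem_lieAlg_leviGroup.2 ⟨h.grading.mem_skew, rfl⟩) t

theorem conj_mem_uniGroup {g u : GL ι ℂ} (hg : g ∈ isoGroup S hS)
    (hu : IsUpper p (g : Matrix ι ι ℂ)) (h1 : u ∈ h.uniGroup) : g * u * g⁻¹ ∈ h.uniGroup := by
  refine ⟨mul_mem (mul_mem hg h1.1) (inv_mem hg), ?_⟩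
  have : ((g * u * g⁻¹ : GL ι ℂ) : Matrix ι ι ℂ) - 1 =
      (g : Matrix ι ι ℂ) * ((u : Matrix ι ι ℂ) - 1) * (↑g⁻¹ : Matrix ι ι ℂ) := by
    rw [mul_sub, sub_mul, Matrix.mul_one, Units.mul_inv]; rfl
  rw [this]
  exact h.spectral.strict_mul (h.spectral.mul_strict hu h1.2) (h.isUpper_inv hg hu)

/-- Conjugation by exp(tH) contracts u to 1 as t → -∞ within the group; the orbit together with its
limit point is a connected set joining u to 1. -/
theorem isConnected_uniGroup : IsConnected (h.uniGroup : Set (GL ι ℂ)) := by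
  refine ⟨⟨1, one_mem _⟩, isPreconnected_of_forall 1 fun u hu => ?_⟩
  let γ : ℝ → GL ι ℂ := fun t => expGL (t • H) * u * (expGL (t • H))⁻¹
  have hγ : Continuous γ := ((continuous_expGL_smul H).mul continuous_const).mul
    (continuous_expGL_smul H).inv
  have hval : ∀ (x : GL ι ℂ) (t : ℝ), ((expGL (t • H) * x * (expGL (t • H))⁻¹ : GL ι ℂ) :
      Matrix ι ι ℂ) = NormedSpace.exp (t • H) * x * NormedSpace.exp (-(t • H)) := by
    intro x t
    rw [Units.val_mul, Units.val_mul, Matrix.coe_units_inv, coe_expGL, Matrix.exp_neg]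
  have hmem : ∀ t, γ t ∈ h.uniGroup := fun t =>
    h.conj_mem_uniGroup (h.exp_smul_mem_leviGroup t).1
      (h.spectral.isUpper_of_commute (h.exp_smul_mem_leviGroup t).2) hu
  have hlim : Tendsto γ atBot (𝓝 1) := by
    -- Convergence in the general linear group means convergence of both the matrix and its inverse.
    rw [Units.isEmbedding_embedProduct.tendsto_nhds_iff]
    refine Tendsto.prodMk_nhds ?_ ?_
    · have := h.spectral.tendsto_exp_conj hu.2
      refine this.congr fun t => ?_
      exact (hval u t).symm
    · refine (MulOpposite.continuous_op.tendsto _).comp ?_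
      have := h.spectral.tendsto_exp_conj (inv_mem hu).2
      rw [inv_one]
      refine this.congr fun t => ?_
      rw [← hval]
      refine congrArg Units.val ?_
      simp only [γ]
      group
  refine ⟨insert 1 (Set.range γ), ?_, Set.mem_insert _ _, Set.mem_insert_of_mem _ ⟨0, ?_⟩, ?_⟩
  · rintro _ (rfl | ⟨t, rfl⟩)
    · exact one_mem _
    · exact hmem t
  · have : expGL ((0 : ℝ) • H) = 1 := Units.ext (by rw [coe_expGL]; simp)
    simp only [γ]
    rw [this]
    simp
  · refine (isPreconnected_range hγ).subset_closure (Set.subset_insert _ _) ?_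
    rintro _ (rfl | ht)
    · exact mem_closure_of_tendsto hlim (Eventually.of_forall fun t => ⟨t, rfl⟩)
    · exact subset_closure ht

theorem dag_mem_leviGroup {g : GL ι ℂ} (hg : g ∈ leviGroup hS H) :
    ∃ g' ∈ leviGroup hS H, (g' : Matrix ι ι ℂ) = dag R g := by
  refine ⟨⟨dag R g, dag R (↑g⁻¹ : Matrix ι ι ℂ), ?_, ?_⟩, ⟨⟨?_, ?_⟩, ?_⟩, rfl⟩
  · rw [← dag_mul, Units.inv_mul, dag_one]
  · rw [← dag_mul, Units.mul_inv, dag_one]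
  · change adj S (dag R g) * dag R g = 1
    rw [h.compat, ← dag_mul, mul_eq_one_comm.1 hg.1.1, dag_one]
  · change (dag R (g : Matrix ι ι ℂ)).det = 1
    have h1 : (↑R⁻¹ : Matrix ι ι ℂ).det * (R : Matrix ι ι ℂ).det = 1 := by
      rw [← Matrix.det_mul, Units.inv_mul, Matrix.det_one]
    have h2 : (R : Matrix ι ι ℂ).det * (↑R⁻¹ : Matrix ι ι ℂ).det = 1 := by rw [mul_comm, h1]
    rw [dag_def, Matrix.det_mul, Matrix.det_mul, Matrix.det_conjTranspose, Matrix.det_mul,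
      Matrix.det_mul, hg.1.2, mul_one, h2, star_one, mul_one, h1]
  · change H * dag R g = dag R g * H
    have := congrArg (dag R) hg.2
    rw [dag_mul, dag_mul, h.grading.dag_eq] at this
    exact this.symm

theorem mem_iff_of_isNormalizer {P : Subgroup (GL ι ℂ)} (hP : IsNormalizer hS 𝔭 P) (g : GL ι ℂ) :
    g ∈ P ↔ g ∈ isoGroup S hS ∧ IsUpper p (g : Matrix ι ι ℂ) := by
  rw [hP]
  exact and_congr_right fun hg => h.normalizes_iff hg

theorem leviGroup_le {P : Subgroup (GL ι ℂ)} (hP : IsNormalizer hS 𝔭 P) : leviGroup hS H ≤ P :=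
  fun _ hg => (h.mem_iff_of_isNormalizer hP _).2 ⟨hg.1, h.spectral.isUpper_of_commute hg.2⟩

theorem uniGroup_le {P : Subgroup (GL ι ℂ)} (hP : IsNormalizer hS 𝔭 P) : h.uniGroup ≤ P :=
  fun _ hg => (h.mem_iff_of_isNormalizer hP _).2 ⟨hg.1, h.isUpper_of_sub_one hg.2⟩

/-- The elements blk u - 1 span a non-unital algebra N of traceless matrices, so N^k = 0 for some k.
The span B of the Levi group is an algebra with BN ⊆ NB, so products from B and N are nilpotent. For
x = blk u - 1 the adjoint x† lies in B; hence x† x is nilpotent and self-adjoint, and x = 0. This is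
the reductivity of the Levi group. -/
theorem blk_eq_one_of_unipotent {P U : Subgroup (GL ι ℂ)} (hP : IsNormalizer hS 𝔭 P) (hUP : U ≤ P)
    (hUn : ∀ g ∈ P, ∀ u ∈ U, g * u * g⁻¹ ∈ U)
    (hUu : ∀ u ∈ U, IsNilpotent ((u : Matrix ι ι ℂ) - 1)) {u : GL ι ℂ} (hu : u ∈ U) :
    blk s p u = 1 := by
  have hup : ∀ g ∈ P, IsUpper p (g : Matrix ι ι ℂ) := fun g hg =>
    ((h.mem_iff_of_isNormalizer hP g).1 hg).2
  let N : Submodule ℂ (Matrix ι ι ℂ) :=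
    Submodule.span ℂ ((fun u : GL ι ℂ => blk s p u - 1) '' U)
  let B : Submodule ℂ (Matrix ι ι ℂ) :=
    Submodule.span ℂ ((fun u : GL ι ℂ => (u : Matrix ι ι ℂ)) '' leviGroup hS H)
  have hNmem : ∀ u ∈ U, blk s p u - 1 ∈ N := fun u hu => Submodule.subset_span ⟨u, hu, rfl⟩
  have hBmem : ∀ g ∈ leviGroup hS H, (g : Matrix ι ι ℂ) ∈ B := fun g hg =>
    Submodule.subset_span ⟨g, hg, rfl⟩
  have hNN : N * N ≤ N := by
    rw [Submodule.span_mul_span, Submodule.span_le]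
    rintro _ ⟨_, ⟨a, ha, rfl⟩, _, ⟨b, hb, rfl⟩, rfl⟩
    have : (blk s p a - 1) * (blk s p b - 1) =
        (blk s p ((a * b : GL ι ℂ) : Matrix ι ι ℂ) - 1) - (blk s p a - 1) - (blk s p b - 1) := by
      rw [Units.val_mul, h.spectral.blk_mul (hup a (hUP ha)) (hup b (hUP hb))]
      noncomm_ring
    simp only [SetLike.mem_coe]
    rw [this]
    exact sub_mem (sub_mem (hNmem _ (mul_mem ha hb)) (hNmem a ha)) (hNmem b hb)
  have htr : ∀ x ∈ N, x.trace = 0 := by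
    intro x hx
    refine Submodule.span_induction ?_ (by simp) (fun x y _ _ hx hy => by simp [hx, hy])
      (fun c x _ hx => by simp [hx]) hx
    rintro _ ⟨a, ha, rfl⟩
    obtain ⟨k, hk⟩ := hUu a ha
    have h1 : IsUpper p ((a : Matrix ι ι ℂ) - 1) := (hup a (hUP ha)).sub h.spectral.isUpper_one
    have h2 : ∀ k, blk s p (((a : Matrix ι ι ℂ) - 1) ^ k) = blk s p ((a : Matrix ι ι ℂ) - 1) ^ k := by
      intro k
      induction k with
      | zero => rw [pow_zero, pow_zero, h.spectral.blk_one]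
      | succ k ih => rw [pow_succ, h.spectral.blk_mul (h.spectral.isUpper_pow h1 k) h1, ih, pow_succ]
    have h3 : IsNilpotent (blk s p a - 1) := by
      refine ⟨k, ?_⟩
      have := h2 k
      rw [hk, h.spectral.blk_sub, h.spectral.blk_one] at this
      rw [← this]
      simp [blk]
    exact (Matrix.isNilpotent_trace_of_isNilpotent h3).eq_zero
  obtain ⟨k, hk⟩ := exists_pow_eq_bot hNN fun x hx => isNilpotent_of_forall_trace_eq_zero hNN htr hx
  have hBB : B * B ≤ B := by
    rw [Submodule.span_mul_span, Submodule.span_le]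
    rintro _ ⟨_, ⟨a, ha, rfl⟩, _, ⟨b, hb, rfl⟩, rfl⟩
    exact hBmem (a * b) (mul_mem ha hb)
  have hBN : B * N ≤ N * B := by
    rw [Submodule.span_mul_span, Submodule.span_le]
    rintro _ ⟨_, ⟨a, ha, rfl⟩, _, ⟨b, hb, rfl⟩, rfl⟩
    have haP := h.leviGroup_le hP ha
    have : (a : Matrix ι ι ℂ) * (blk s p b - 1) =
        (blk s p ((a * b * a⁻¹ : GL ι ℂ) : Matrix ι ι ℂ) - 1) * a := by
      rw [Units.val_mul, Units.val_mul, h.spectral.blk_mul (h.spectral.upper_mul (hup a haP)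
        (hup b (hUP hb))) (hup _ (inv_mem haP)), h.spectral.blk_mul (hup a haP) (hup b (hUP hb)),
        h.spectral.blk_of_commute ha.2, h.spectral.blk_of_commute (inv_mem ha).2, mul_sub, sub_mul,
        Matrix.mul_assoc _ _ (a : Matrix ι ι ℂ), Units.inv_mul, Matrix.mul_one, Matrix.mul_one,
        Matrix.one_mul]
    simp only [SetLike.mem_coe]
    rw [this]
    exact Submodule.mul_mem_mul (hNmem _ (hUn a haP b hb)) (hBmem a ha)
  have hpow : ∀ j, (N * B) ^ (j + 1) ≤ N ^ (j + 1) * B := by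
    intro j
    induction j with
    | zero => simp
    | succ j ih =>
      calc (N * B) ^ (j + 1 + 1) = (N * B) ^ (j + 1) * (N * B) := pow_succ _ _
        _ ≤ N ^ (j + 1) * B * (N * B) := mul_le_mul_left ih _
        _ = N ^ (j + 1) * (B * N) * B := by simp only [mul_assoc]
        _ ≤ N ^ (j + 1) * (N * B) * B := mul_le_mul_left (mul_le_mul_right hBN _) _
        _ = N ^ (j + 1 + 1) * (B * B) := by
          rw [pow_succ N (j + 1)]; simp only [mul_assoc]
        _ ≤ N ^ (j + 1 + 1) * B := mul_le_mul_right hBB _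
  have huP := hUP hu
  obtain ⟨l, hl, hlb, -⟩ := h.exists_blk_unit ((h.mem_iff_of_isNormalizer hP u).1 huP).1 (hup u huP)
  set x := blk s p u - 1 with hx
  have hdx : dag R x ∈ B := by
    obtain ⟨l', hl', e⟩ := h.dag_mem_leviGroup hl
    rw [hx, map_sub, dag_one, ← hlb, ← e]
    exact sub_mem (hBmem _ hl') (hBmem 1 (one_mem _))
  have hnil : IsNilpotent (dag R x * x) := by
    refine ⟨k + 1, ?_⟩
    have h1 : (dag R x * x) ^ (k + 1) ∈ (N * B) ^ (k + 1) :=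
      Submodule.pow_mem_pow _ (hBN (Submodule.mul_mem_mul hdx (hNmem u hu))) _
    have h2 := hpow k h1
    rw [pow_succ, hk] at h2
    simpa using h2
  have hx0 : x = 0 := eq_zero_of_dag_mul_self R
    (eq_zero_of_isNilpotent_of_dag_eq R hnil (by rw [dag_mul, dag_dag]))
  rwa [hx, sub_eq_zero] at hx0

/-- The unipotent radical of the normalizer of `𝔭` consists of the block unitriangular
isometries. -/
theorem unipotentRadical_eq {P : Subgroup (GL ι ℂ)} (hP : IsNormalizer hS 𝔭 P) :
    unipotentRadical P = h.uniGroup := by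
  refine le_antisymm (sSup_le ?_) (le_sSup ⟨h.uniGroup_le hP, h.isAlgebraic_uniGroup,
    h.isConnected_uniGroup, fun g hg u hu => ?_, fun u hu => h.spectral.isNilpotent_of_strict hu.2⟩)
  · rintro U ⟨hUP, -, -, hUn, hUu⟩ u hu
    have h1 := (h.mem_iff_of_isNormalizer hP u).1 (hUP hu)
    refine ⟨h1.1, ?_⟩
    rw [← h.blk_eq_one_of_unipotent hP hUP hUn hUu hu]
    exact h.spectral.sub_blk_strict h1.2
  · have h1 := (h.mem_iff_of_isNormalizer hP g).1 hg
    exact h.conj_mem_uniGroup h1.1 h1.2 hu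

end IsGradedParabolic

end UnipotentRadical

/-! ### Continuous one-parameter groups -/

section OneParameter

open Filter Topology
open scoped Matrix.Norms.Operator

/-- Continuous one-parameter groups of matrices are exponentials. -/
theorem exists_eq_exp_of_continuous {σ : ℝ → Matrix ι ι ℂ} (hσ : Continuous σ) (h0 : σ 0 = 1)
    (hadd : ∀ a b, σ (a + b) = σ a * σ b) : ∃ X, ∀ t : ℝ, σ t = NormedSpace.exp (t • X) := by
  -- The primitive F of σ satisfies F(t + a) - F(t) = σ(t) F(a). Since F(a)/a → 1, some F(a) is
  -- invertible, so σ is as differentiable as F.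
  let F : ℝ → Matrix ι ι ℂ := fun t => ∫ u in (0 : ℝ)..t, σ u
  have hF : ∀ t, HasDerivAt F (σ t) t := fun t => (hσ.integral_hasStrictDerivAt 0 t).hasDerivAt
  have hF0 : F 0 = 0 := intervalIntegral.integral_same
  have hFadd : ∀ t a, F (t + a) - F t = σ t * F a := by
    intro t a
    have h1 : F (t + a) - F t = ∫ u in t..(t + a), σ u :=
      intervalIntegral.integral_interval_sub_left (hσ.intervalIntegrable _ _)
        (hσ.intervalIntegrable _ _)
    have h2 : ∫ u in t..(t + a), σ u = ∫ u in (0 : ℝ)..a, σ (t + u) := by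
      rw [intervalIntegral.integral_comp_add_left, add_zero]
    have h3 := (ContinuousLinearMap.mul ℝ (Matrix ι ι ℂ) (σ t)).intervalIntegral_comp_comm
      (hσ.intervalIntegrable (μ := MeasureTheory.volume) 0 a)
    rw [h1, h2]
    simp only [hadd]
    exact h3
  have hslope : Tendsto (fun a : ℝ => a⁻¹ • F a) (𝓝[≠] 0) (𝓝 1) := by
    have := (hF 0).tendsto_slope_zero
    simp only [zero_add, hF0, sub_zero] at this
    rw [h0] at this
    exact this
  have hdet : ∀ᶠ a : ℝ in 𝓝[≠] 0, (a⁻¹ • F a).det ≠ 0 := by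
    have hc : Continuous fun A : Matrix ι ι ℂ => A.det := continuous_id.matrix_det
    exact ((hc.tendsto 1).comp hslope).eventually_ne (by simp)
  obtain ⟨a, ha⟩ := hdet.exists
  have hFa : IsUnit (F a).det := by
    rw [isUnit_iff_ne_zero]
    intro h1
    apply ha
    rw [show a⁻¹ • F a = ((a⁻¹ : ℝ) : ℂ) • F a from rfl, Matrix.det_smul, h1, mul_zero]
  set B := (F a)⁻¹ with hB
  have hσF : ∀ t, σ t = (F (t + a) - F t) * B := fun t => by
    rw [hFadd, Matrix.mul_assoc, hB, Matrix.mul_nonsing_inv _ hFa, Matrix.mul_one]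
  let X : Matrix ι ι ℂ := (σ a - 1) * B
  have hder : ∀ t, HasDerivAt σ (σ t * X) t := by
    intro t
    have h1 : HasDerivAt (fun t => F (t + a)) (σ (t + a)) t := (hF (t + a)).comp_add_const t a
    have h2 := (h1.sub (hF t)).mul_const B
    rw [hadd] at h2
    have h3 : (σ t * σ a - σ t) * B = σ t * X := by
      simp only [X]
      rw [← Matrix.mul_assoc, mul_sub, Matrix.mul_one]
    rw [h3] at h2
    rwa [show σ = fun t => (F (t + a) - F t) * B from funext hσF] at h2 ⊢
  refine ⟨X, fun t => ?_⟩
  have hG : ∀ t, HasDerivAt (fun t => σ t * NormedSpace.exp (t • -X)) 0 t := by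
    intro t
    have h1 := (hder t).mul (hasDerivAt_exp_smul (-X) t)
    have h2 : X * NormedSpace.exp (t • -X) = NormedSpace.exp (t • -X) * X :=
      commute_exp (by rw [Matrix.mul_smul, Matrix.smul_mul, mul_neg, neg_mul])
    have h3 : σ t * X * NormedSpace.exp (t • -X) + σ t * (NormedSpace.exp (t • -X) * -X) = 0 := by
      rw [Matrix.mul_assoc, h2, mul_neg, mul_neg, add_neg_cancel]
    rw [h3] at h1
    exact h1
  have hconst := is_const_of_deriv_eq_zero (fun t => (hG t).differentiableAt)
    (fun t => (hG t).deriv) t 0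
  simp only [zero_smul, NormedSpace.exp_zero, h0, Matrix.mul_one] at hconst
  have h3 : NormedSpace.exp (t • -X) * NormedSpace.exp (t • X) = 1 := by
    rw [← Matrix.exp_add_of_commute _ _ (((Commute.refl X).neg_left.smul_left t).smul_right t),
      smul_neg, neg_add_cancel, NormedSpace.exp_zero]
  calc σ t = σ t * (NormedSpace.exp (t • -X) * NormedSpace.exp (t • X)) := by
        rw [h3, Matrix.mul_one]
    _ = NormedSpace.exp (t • X) := by rw [← Matrix.mul_assoc, hconst, Matrix.one_mul]

end OneParameter

/-! ### Identification of an arbitrary Levi subgroup -/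

section LeviSubgroups

open Filter Topology

theorem locallyCompactSpace_GL : LocallyCompactSpace (GL ι ℂ) := by
  have : LocallyCompactSpace (Matrix ι ι ℂ) := inferInstanceAs (LocallyCompactSpace (ι → ι → ℂ))
  infer_instance

theorem sigmaCompactSpace_GL : SigmaCompactSpace (GL ι ℂ) := by
  have h1 : SigmaCompactSpace (Matrix ι ι ℂ) := inferInstanceAs (SigmaCompactSpace (ι → ι → ℂ))
  have h2 : SigmaCompactSpace (Matrix ι ι ℂ)ᵐᵒᵖ :=
    (MulOpposite.opHomeomorph (M := Matrix ι ι ℂ)).symm.isClosedEmbedding.sigmaCompactSpace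
  exact Units.isClosedEmbedding_embedProduct.sigmaCompactSpace

theorem IsAlgebraic.isClosed {G : Subgroup (GL ι ℂ)} (hG : IsAlgebraic G) :
    IsClosed (G : Set (GL ι ℂ)) := by
  obtain ⟨F, hF⟩ := hG
  have : (G : Set (GL ι ℂ)) = ⋂ q ∈ F, {g : GL ι ℂ | MvPolynomial.eval
      (fun ij : ι × ι => (g : Matrix ι ι ℂ) ij.1 ij.2) q = 0} := by
    ext g
    simp only [SetLike.mem_coe, Set.mem_iInter]
    exact hF g
  rw [this]
  refine isClosed_biInter fun q _ => isClosed_eq ?_ continuous_const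
  refine (MvPolynomial.continuous_eval q).comp (continuous_pi fun ij => ?_)
  exact Units.continuous_val.matrix_elem ij.1 ij.2

theorem isClosed_leviGroup {S : Matrix ι ι ℂ} {ε : ℂ} {hS : IsFormMatrix S ε} {H : Matrix ι ι ℂ} :
    IsClosed (leviGroup hS H : Set (GL ι ℂ)) := by
  have hc : Continuous fun g : GL ι ℂ => (g : Matrix ι ι ℂ) := Units.continuous_val
  have : (leviGroup hS H : Set (GL ι ℂ)) = ({g : GL ι ℂ | Sᵀ * (g : Matrix ι ι ℂ)ᵀ * S * g = 1} ∩
      {g : GL ι ℂ | (g : Matrix ι ι ℂ).det = 1}) ∩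
      {g : GL ι ℂ | H * (g : Matrix ι ι ℂ) = (g : Matrix ι ι ℂ) * H} := rfl
  rw [this]
  refine ((isClosed_eq ?_ continuous_const).inter (isClosed_eq hc.matrix_det continuous_const)).inter
    (isClosed_eq (continuous_const.matrix_mul hc) (hc.matrix_mul continuous_const))
  exact ((continuous_const.matrix_mul hc.matrix_transpose).matrix_mul continuous_const).matrix_mul hc

namespace IsGradedParabolic

variable {S : Matrix ι ι ℂ} {ε : ℂ} {hS : IsFormMatrix S ε} {R : (Matrix ι ι ℂ)ˣ}
  {𝔭 : Submodule ℂ (Matrix ι ι ℂ)} {H : Matrix ι ι ℂ} {s : Finset ℝ} {p : ℝ → Matrix ι ι ℂ}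
  (h : IsGradedParabolic hS R 𝔭 H s p)
include h

/-- P is generated by L and its unipotent radical, and block diagonal parts are trivial on the
latter. -/
theorem exists_mem_blk_eq {P L : Subgroup (GL ι ℂ)} (hP : IsNormalizer hS 𝔭 P) (hL : IsLevi P L)
    {g : GL ι ℂ} (hg : g ∈ P) : ∃ l ∈ L, blk s p l = blk s p g := by
  have hup : ∀ g ∈ P, IsUpper p (g : Matrix ι ι ℂ) := fun g hg =>
    ((h.mem_iff_of_isNormalizer hP g).1 hg).2
  let T : Subgroup (GL ι ℂ) :=
    { carrier := {g | g ∈ P ∧ ∃ l ∈ L, blk s p l = blk s p g}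
      mul_mem' := by
        rintro a b ⟨ha, l, hl, hla⟩ ⟨hb, l', hl', hlb⟩
        refine ⟨mul_mem ha hb, l * l', mul_mem hl hl', ?_⟩
        rw [Units.val_mul, Units.val_mul, h.spectral.blk_mul (hup a ha) (hup b hb),
          h.spectral.blk_mul (hup l (hL.1 hl)) (hup l' (hL.1 hl')), hla, hlb]
      one_mem' := ⟨one_mem _, 1, one_mem _, rfl⟩
      inv_mem' := by
        rintro a ⟨ha, l, hl, hla⟩
        refine ⟨inv_mem ha, l⁻¹, inv_mem hl, ?_⟩
        have h1 : blk s p (↑l⁻¹ : Matrix ι ι ℂ) * blk s p l = 1 := by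
          rw [← h.spectral.blk_mul (hup _ (hL.1 (inv_mem hl))) (hup _ (hL.1 hl)), Units.inv_mul,
            h.spectral.blk_one]
        have h2 : blk s p a * blk s p (↑a⁻¹ : Matrix ι ι ℂ) = 1 := by
          rw [← h.spectral.blk_mul (hup _ ha) (hup _ (inv_mem ha)), Units.mul_inv,
            h.spectral.blk_one]
        rw [hla] at h1
        rw [← Matrix.mul_one (blk s p (↑l⁻¹ : Matrix ι ι ℂ)), ← h2, ← Matrix.mul_assoc, h1,
          Matrix.one_mul] }
  have hT : P ≤ T := by
    rw [← hL.2.2.2]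
    refine sup_le (fun l hl => ⟨hL.1 hl, l, hl, rfl⟩) fun u hu => ?_
    rw [h.unipotentRadical_eq hP] at hu
    refine ⟨h.uniGroup_le hP hu, 1, one_mem _, ?_⟩
    have h1 := h.spectral.blk_eq_zero hu.2
    rw [h.spectral.blk_sub, sub_eq_zero] at h1
    exact h1.symm
  exact (hT hg).2

theorem dag_eq_neg_of_mem_lieAlg {K : Subgroup (GL ι ℂ)}
    (hKR : ∀ k ∈ K, dag R (k : Matrix ι ι ℂ) = (↑k⁻¹ : Matrix ι ι ℂ)) {Y : Matrix ι ι ℂ}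
    (hY : Y ∈ lieAlg K) : dag R Y = -Y := by
  refine eq_of_exp_smul_eq fun t => ?_
  have h1 := hKR _ (mem_lieAlg_iff.1 hY t)
  rw [coe_expGL, dag_exp, Matrix.coe_units_inv, coe_expGL, ← Matrix.exp_neg] at h1
  rw [smul_neg, ← h1]
  congr 1
  rw [show t • Y = (t : ℂ) • Y from rfl, map_smulₛₗ, Complex.conj_ofReal]
  rfl

/-- Elements of 𝔨 are skew-adjoint and so lie in 𝔭 ∩ 𝔭†, where H is central; the claim follows from
𝔩 = 𝔨 + i𝔨. -/
theorem commute_of_mem_lieAlg {P L K : Subgroup (GL ι ℂ)} (hP : IsNormalizer hS 𝔭 P)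
    (hL : IsLevi P L) (hK : IsCompactRealForm L K)
    (hKR : ∀ k ∈ K, dag R (k : Matrix ι ι ℂ) = (↑k⁻¹ : Matrix ι ι ℂ)) {X : Matrix ι ι ℂ}
    (hX : X ∈ lieAlg L) : H * X = X * H := by
  have hc : ∀ Y ∈ lieAlg K, H * Y = Y * H := fun Y hY => by
    have h1 := (h.mem_lieAlg_of_isNormalizer hP).1 (lieAlg_mono (hK.1.trans hL.1) hY)
    refine h.grading.comm Y h1 ?_
    rw [h.dag_eq_neg_of_mem_lieAlg hKR hY]
    exact neg_mem h1
  obtain ⟨⟨Y1, Y2⟩, ⟨h1, h2, rfl⟩, -⟩ := hK.2.2 X hX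
  simp only at h1 h2 ⊢
  rw [mul_add, add_mul, Matrix.mul_smul, Matrix.smul_mul, hc _ h1, hc _ h2]

/-- The block diagonal part is a continuous bijective homomorphism from L to the centralizer of H,
and it is open because L is σ-compact. Hence exp(tX) lifts to a one-parameter group exp(tX') in L.
As X' commutes with H, its exponentials are already block diagonal, so the lift is exp(tX) itself.
-/
theorem lieAlg_leviGroup_subset {P L K : Subgroup (GL ι ℂ)} (hP : IsNormalizer hS 𝔭 P)
    (hL : IsLevi P L) (hK : IsCompactRealForm L K)
    (hKR : ∀ k ∈ K, dag R (k : Matrix ι ι ℂ) = (↑k⁻¹ : Matrix ι ι ℂ)) :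
    lieAlg (leviGroup hS H) ⊆ lieAlg L := by
  have hup : ∀ g ∈ P, IsUpper p (g : Matrix ι ι ℂ) := fun g hg =>
    ((h.mem_iff_of_isNormalizer hP g).1 hg).2
  have hex : ∀ g : L, ∃ l : leviGroup hS H, ((l : GL ι ℂ) : Matrix ι ι ℂ) =
      blk s p ((g : GL ι ℂ) : Matrix ι ι ℂ) := fun g => by
    have hgP := (h.mem_iff_of_isNormalizer hP _).1 (hL.1 g.2)
    obtain ⟨l, hl, hlb, -⟩ := h.exists_blk_unit hgP.1 hgP.2
    exact ⟨⟨l, hl⟩, hlb⟩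
  choose f hf using hex
  let φ : L →* leviGroup hS H := MonoidHom.mk' f fun a b => by
    apply Subtype.ext
    apply Units.ext
    rw [hf, Subgroup.coe_mul, Subgroup.coe_mul, Units.val_mul, Units.val_mul, hf, hf,
      h.spectral.blk_mul (hup _ (hL.1 a.2)) (hup _ (hL.1 b.2))]
  have hφ : ∀ g : L, ((φ g : GL ι ℂ) : Matrix ι ι ℂ) = blk s p ((g : GL ι ℂ) : Matrix ι ι ℂ) := hf
  have hblk : Continuous (blk s p) :=
    continuous_finsetSum _ fun c _ => (continuous_const.matrix_mul continuous_id).matrix_mul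
      continuous_const
  have hφc : Continuous φ := by
    refine Continuous.subtype_mk (f := fun g : L => (φ g : GL ι ℂ)) ?_ _
    rw [Units.continuous_iff]
    refine ⟨(hblk.comp (Units.continuous_val.comp continuous_subtype_val)).congr fun g => (hφ g).symm,
      (hblk.comp (Units.continuous_val.comp (continuous_subtype_val.comp continuous_inv))).congr
        fun g => ?_⟩
    have := hφ g⁻¹
    rw [map_inv] at this
    exact this.symm
  have hsurj : Function.Surjective φ := by
    rintro ⟨l, hl⟩
    obtain ⟨g, hg, e⟩ := h.exists_mem_blk_eq hP hL (h.leviGroup_le hP hl)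
    refine ⟨⟨g, hg⟩, Subtype.ext (Units.ext ?_)⟩
    rw [hφ, e, h.spectral.blk_of_commute hl.2]
  have hinj : Function.Injective φ := by
    rw [injective_iff_map_eq_one]
    intro g hg
    have h1 : blk s p ((g : GL ι ℂ) : Matrix ι ι ℂ) = 1 := by rw [← hφ, hg]; rfl
    have h2 : (g : GL ι ℂ) ∈ L ⊓ unipotentRadical P := by
      rw [h.unipotentRadical_eq hP]
      refine ⟨g.2, ((h.mem_iff_of_isNormalizer hP _).1 (hL.1 g.2)).1, ?_⟩
      rw [← h1]
      exact h.spectral.sub_blk_strict (hup _ (hL.1 g.2))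
    rw [hL.2.2.1, Subgroup.mem_bot] at h2
    exact Subtype.ext h2
  have hopen : IsOpenMap φ := by
    have i1 := sigmaCompactSpace_GL (ι := ι)
    have i2 := locallyCompactSpace_GL (ι := ι)
    have i3 : SigmaCompactSpace L := hL.2.1.isClosed.sigmaCompactSpace
    have i4 : LocallyCompactSpace (leviGroup hS H) := isClosed_leviGroup.locallyCompactSpace
    exact φ.isOpenMap_of_sigmaCompact hsurj hφc
  let e : L ≃* leviGroup hS H := MulEquiv.ofBijective φ ⟨hinj, hsurj⟩
  have hec : Continuous e.symm := by
    rw [← e.coe_toEquiv_symm, Equiv.continuous_symm_iff]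
    exact hopen
  intro X hX
  have hX' := mem_lieAlg_iff.1 hX
  let τ : ℝ → leviGroup hS H := fun t => ⟨expGL (t • X), hX' t⟩
  have hτc : Continuous τ := (continuous_expGL_smul X).subtype_mk _
  let σ : ℝ → Matrix ι ι ℂ := fun t => ((e.symm (τ t) : GL ι ℂ) : Matrix ι ι ℂ)
  have hτadd : ∀ a b, τ (a + b) = τ a * τ b := fun a b =>
    Subtype.ext (Units.ext (exp_add_smul X a b))
  have hτ0 : τ 0 = 1 := Subtype.ext (Units.ext (by
    change NormedSpace.exp ((0 : ℝ) • X) = 1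
    rw [zero_smul, NormedSpace.exp_zero]))
  obtain ⟨X', hX'e⟩ := exists_eq_exp_of_continuous (σ := σ)
    (Units.continuous_val.comp (continuous_subtype_val.comp (hec.comp hτc)))
    (by simp only [σ]; rw [hτ0, map_one]; rfl)
    (fun a b => by simp only [σ]; rw [hτadd, map_mul]; rfl)
  have hX'L : X' ∈ lieAlg L := fun t => ⟨e.symm (τ t), (e.symm (τ t)).2, hX'e t⟩
  have hcomm := h.commute_of_mem_lieAlg hP hL hK hKR hX'L
  intro t
  refine ⟨e.symm (τ t), (e.symm (τ t)).2, ?_⟩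
  have h1 : blk s p (σ t) = NormedSpace.exp (t • X) := by
    simp only [σ]
    rw [← hφ]
    exact congrArg (fun g : leviGroup hS H => ((g : GL ι ℂ) : Matrix ι ι ℂ))
      (e.apply_symm_apply (τ t))
  rw [← h1, h.spectral.blk_of_commute]
  rw [hX'e]
  exact commute_exp (by rw [Matrix.mul_smul, Matrix.smul_mul, hcomm])

/-- The Levi subgroup whose compact real form is unitary for `R` is the centralizer of `H`. -/
theorem eq_leviGroup {P L K : Subgroup (GL ι ℂ)} (hP : IsNormalizer hS 𝔭 P)
    (hL : IsLevi P L) (hK : IsCompactRealForm L K)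
    (hKR : ∀ k ∈ K, dag R (k : Matrix ι ι ℂ) = (↑k⁻¹ : Matrix ι ι ℂ)) :
    L = leviGroup hS H := by
  have hup : ∀ g ∈ P, IsUpper p (g : Matrix ι ι ℂ) := fun g hg =>
    ((h.mem_iff_of_isNormalizer hP g).1 hg).2
  have hexp : ∀ t : ℝ, expGL (t • H) ∈ L := mem_lieAlg_iff.1
    (h.lieAlg_leviGroup_subset hP hL hK hKR (mem_lieAlg_leviGroup.2 ⟨h.grading.mem_skew, rfl⟩))
  have hle : L ≤ leviGroup hS H := by
    intro g hg
    have hgP := (h.mem_iff_of_isNormalizer hP g).1 (hL.1 hg)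
    obtain ⟨l, hl, hlb, hlu⟩ := h.exists_blk_unit hgP.1 hgP.2
    refine ⟨hgP.1, (commute_of_exp_smul fun t => ?_).symm⟩
    set x := expGL (t • H) with hx
    have hxl := h.exp_smul_mem_leviGroup t
    have hxl' : x * l = l * x := by
      apply Units.ext
      rw [Units.val_mul, Units.val_mul, hx, coe_expGL]
      refine (commute_exp ?_).symm
      rw [Matrix.mul_smul, Matrix.smul_mul, hl.2]
    -- The commutator of exp(tH) with g lies in L because both do. It lies in the unipotent radical
    -- because exp(tH) commutes with the block diagonal part of g. Hence it is trivial.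
    have h1 : x * g * x⁻¹ * g⁻¹ ∈ L ⊓ unipotentRadical P := by
      refine ⟨L.mul_mem (L.mul_mem (L.mul_mem (hexp t) hg) (L.inv_mem (hexp t))) (L.inv_mem hg), ?_⟩
      rw [h.unipotentRadical_eq hP]
      have e1 : x * g * x⁻¹ * g⁻¹ = l * ((x * (l⁻¹ * g) * x⁻¹) * (l⁻¹ * g)⁻¹) * l⁻¹ := by
        have e2 : x * l⁻¹ = l⁻¹ * x := by
          rw [eq_inv_mul_iff_mul_eq, ← mul_assoc, ← hxl', mul_assoc, mul_inv_cancel, mul_one]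
        calc x * g * x⁻¹ * g⁻¹ = l * (l⁻¹ * x) * g * x⁻¹ * g⁻¹ := by group
          _ = _ := by rw [← e2]; group
      rw [e1]
      refine h.conj_mem_uniGroup hl.1 (h.spectral.isUpper_of_commute hl.2) (mul_mem ?_ (inv_mem hlu))
      exact h.conj_mem_uniGroup hxl.1 (h.spectral.isUpper_of_commute hxl.2) hlu
    rw [hL.2.2.1, Subgroup.mem_bot, mul_inv_eq_one, mul_inv_eq_iff_eq_mul] at h1
    exact (congrArg Units.val h1).symm
  refine le_antisymm hle fun g hg => ?_
  obtain ⟨l, hl, e⟩ := h.exists_mem_blk_eq hP hL (h.leviGroup_le hP hg)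
  rw [h.spectral.blk_of_commute (hle hl).2, h.spectral.blk_of_commute hg.2] at e
  rwa [← Units.ext e]

end IsGradedParabolic

end LeviSubgroups

/-! ### Hermitian inner products adapted to K and to the bilinear form -/

section CompatibleForms

open MeasureTheory
theorem IsSpectral.commute_sum {R : (Matrix ι ι ℂ)ˣ} {H : Matrix ι ι ℂ} {s : Finset ℝ}
    {p : ℝ → Matrix ι ι ℂ} (h : IsSpectral R H s p) (a : ℝ → ℂ) {x : Matrix ι ι ℂ}
    (hx : H * x = x * H) : (∑ c ∈ s, a c • p c) * x = x * ∑ c ∈ s, a c • p c := by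
  rw [Matrix.sum_mul, Matrix.mul_sum]
  refine Finset.sum_congr rfl fun c _ => ?_
  rw [Matrix.smul_mul, Matrix.mul_smul, h.commute_proj hx]

theorem IsSpectral.sum_mul_sum {R : (Matrix ι ι ℂ)ˣ} {H : Matrix ι ι ℂ} {s : Finset ℝ}
    {p : ℝ → Matrix ι ι ℂ} (h : IsSpectral R H s p) (a b : ℝ → ℂ) :
    (∑ c ∈ s, a c • p c) * ∑ c ∈ s, b c • p c = ∑ c ∈ s, (a c * b c) • p c := by
  rw [Matrix.sum_mul]
  refine Finset.sum_congr rfl fun c hc => ?_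
  rw [Matrix.mul_sum, Finset.sum_eq_single c (fun d _ hd => by
    rw [Matrix.smul_mul, Matrix.mul_smul, h.ortho _ _ hd.symm, smul_zero, smul_zero]) (fun h' => absurd hc h'),
    Matrix.smul_mul, Matrix.mul_smul, h.idem, smul_smul]

theorem IsSpectral.adj_eq_self {S : Matrix ι ι ℂ} {ε : ℂ} (hS : IsFormMatrix S ε)
    {R : (Matrix ι ι ℂ)ˣ} {T : Matrix ι ι ℂ} {s : Finset ℝ} {p : ℝ → Matrix ι ι ℂ}
    (h : IsSpectral R T s p) (hT : adj S T = T) (c : ℝ) : adj S (p c) = p c := by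
  have e1 : ∀ c, T * adj S (p c) = (c : ℂ) • adj S (p c) := by
    intro c
    have := congrArg (adj S) (h.right c)
    rwa [hS.adj_mul, hT, map_smul] at this
  have e2 : ∀ c d, d ≠ c → p d * adj S (p c) = 0 := by
    intro c d hd
    have h1 : ((d : ℂ) - c) • (p d * adj S (p c)) = 0 := by
      rw [sub_smul, ← Matrix.smul_mul, ← h.right, Matrix.mul_assoc, e1, Matrix.mul_smul, sub_self]
    exact (smul_eq_zero.1 h1).resolve_left (sub_ne_zero.2 (by exact_mod_cast hd))
  by_cases hc : c ∈ s
  · have e3 : adj S (p c) = p c * adj S (p c) := by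
      conv_lhs => rw [h.expand_left (adj S (p c))]
      exact Finset.sum_eq_single c (fun d _ hd => e2 c d hd) (fun h' => absurd hc h')
    have e4 : p c = p c * adj S (p c) := by
      conv_lhs => rw [← Matrix.mul_one (p c), ← hS.adj_one, ← h.sum_eq, map_sum, Matrix.mul_sum]
      exact Finset.sum_eq_single c (fun d _ hd => e2 d c hd.symm) (fun h' => absurd hc h')
    rw [e3, ← e4]
  · rw [h.eq_zero hc, map_zero]

/-- Positive self-adjoint matrices have fourth roots. -/
theorem exists_fourth_root {R : (Matrix ι ι ℂ)ˣ} {T : Matrix ι ι ℂ} (hT : dag R T = T)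
    (hpos : ∀ x, x ≠ 0 → 0 < (dag R x * (T * x)).trace.re) :
    ∃ Q : (Matrix ι ι ℂ)ˣ, dag R (Q : Matrix ι ι ℂ) = Q ∧
      ((Q : Matrix ι ι ℂ) * Q) * ((Q : Matrix ι ι ℂ) * Q) = T ∧
      (∀ x, T * x = x * T → (Q : Matrix ι ι ℂ) * x = x * Q) ∧
      ∀ {S : Matrix ι ι ℂ} {ε : ℂ}, IsFormMatrix S ε → adj S T = T →
        adj S (Q : Matrix ι ι ℂ) = Q := by
  obtain ⟨s, p, h⟩ := exists_isSpectral R hT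
  have hc : ∀ c ∈ s, 0 < c := by
    intro c hc
    have h1 := hpos (p c) ((h.mem_iff c).1 hc)
    rw [h.left, Matrix.mul_smul, Matrix.trace_smul, smul_eq_mul, Complex.re_ofReal_mul] at h1
    exact pos_of_mul_pos_left h1 (trace_dag_mul_self_re_nonneg R _)
  let a : ℝ → ℂ := fun c => (Real.sqrt (Real.sqrt c) : ℂ)
  have ha : ∀ c ∈ s, a c * a c * (a c * a c) = (c : ℂ) := by
    intro c hcs
    simp only [a]
    rw [← Complex.ofReal_mul, Real.mul_self_sqrt (Real.sqrt_nonneg c), ← Complex.ofReal_mul,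
      Real.mul_self_sqrt (hc c hcs).le]
  have hQ4 : ((∑ c ∈ s, a c • p c) * ∑ c ∈ s, a c • p c) *
      ((∑ c ∈ s, a c • p c) * ∑ c ∈ s, a c • p c) = T := by
    rw [h.sum_mul_sum, h.sum_mul_sum, h.expand_right T]
    refine Finset.sum_congr rfl fun c hcs => ?_
    rw [ha c hcs, h.left]
  have hu : IsUnit (∑ c ∈ s, a c • p c) := by
    have : (∑ c ∈ s, a c • p c) * ∑ c ∈ s, (a c)⁻¹ • p c = 1 := by
      rw [h.sum_mul_sum, ← h.sum_eq]
      refine Finset.sum_congr rfl fun c hcs => ?_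
      rw [mul_inv_cancel₀, one_smul]
      simp only [a]
      exact_mod_cast (Real.sqrt_pos.2 (Real.sqrt_pos.2 (hc c hcs))).ne'
    rw [Matrix.isUnit_iff_isUnit_det]
    exact Matrix.isUnit_det_of_right_inverse this
  obtain ⟨Q, hQ⟩ := hu
  refine ⟨Q, ?_, ?_, fun x hx => ?_, fun hS hT' => ?_⟩
  · rw [hQ, map_sum]
    refine Finset.sum_congr rfl fun c _ => ?_
    rw [map_smulₛₗ, h.dag_eq, Complex.conj_ofReal]
  · rw [hQ, hQ4]
  · rw [hQ]
    exact h.commute_sum a hx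
  · rw [hQ, map_sum]
    refine Finset.sum_congr rfl fun c _ => ?_
    rw [map_smul, h.adj_eq_self hS hT']

/-- A compact group of matrices is unitary for some Hermitian inner product. -/
theorem exists_dag_eq_inv_of_isCompact {K : Subgroup (GL ι ℂ)}
    (hK : IsCompact (K : Set (GL ι ℂ))) :
    ∃ R : (Matrix ι ι ℂ)ˣ, ∀ k ∈ K, dag R (k : Matrix ι ι ℂ) = (↑k⁻¹ : Matrix ι ι ℂ) := by
  have : CompactSpace K := isCompact_iff_compactSpace.1 hK
  let _ : MeasurableSpace K := borel K
  have : BorelSpace K := ⟨rfl⟩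
  let μ : Measure K := Measure.haar
  -- The Haar average of the forms (k⁻¹)ᴴ k⁻¹ is a positive Hermitian matrix M invariant under K. A
  -- fourth root Q of M gives R = Q² with Rᴴ R = M.
  let f : K → Matrix ι ι ℂ := fun k =>
    (((k⁻¹ : K) : GL ι ℂ) : Matrix ι ι ℂ)ᴴ * (((k⁻¹ : K) : GL ι ℂ) : Matrix ι ι ℂ)
  have hf : Continuous f := by
    have h1 : Continuous fun k : K => (((k⁻¹ : K) : GL ι ℂ) : Matrix ι ι ℂ) :=
      Units.continuous_val.comp (continuous_subtype_val.comp continuous_inv)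
    exact h1.matrix_conjTranspose.matrix_mul h1
  let F : K → ι → ι → ℂ := f
  have hF : Continuous F := hf
  have hint : Integrable F μ := hF.integrable_of_hasCompactSupport (HasCompactSupport.of_compactSpace F)
  let M' : ι → ι → ℂ := ∫ k, F k ∂μ
  let M : Matrix ι ι ℂ := M'
  have hmap : ∀ T : Matrix ι ι ℂ →ₗ[ℝ] ℂ, T M = ∫ k, T (f k) ∂μ := fun T =>
    ((LinearMap.toContinuousLinearMap
      (show (ι → ι → ℂ) →ₗ[ℝ] ℂ from T)).integral_comp_comm hint).symm
  have hinv : ∀ k : K, M = (((k⁻¹ : K) : GL ι ℂ) : Matrix ι ι ℂ)ᴴ * M *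
      (((k⁻¹ : K) : GL ι ℂ) : Matrix ι ι ℂ) := by
    intro k
    set g := (((k⁻¹ : K) : GL ι ℂ) : Matrix ι ι ℂ) with hg
    ext i j
    let T : Matrix ι ι ℂ →ₗ[ℝ] ℂ :=
      { toFun := fun A => (gᴴ * A * g) i j
        map_add' := fun A B => by rw [mul_add, add_mul, Matrix.add_apply]
        map_smul' := fun c A => by rw [Matrix.mul_smul, Matrix.smul_mul, Matrix.smul_apply]; rfl }
    let T' : Matrix ι ι ℂ →ₗ[ℝ] ℂ :=
      { toFun := fun A => A i j
        map_add' := fun A B => rfl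
        map_smul' := fun c A => rfl }
    refine (hmap T').trans (Eq.trans ?_ (hmap T).symm)
    rw [← integral_mul_left_eq_self (fun x => T' (f x)) k]
    refine integral_congr_ae (Filter.Eventually.of_forall fun x => ?_)
    change f (k * x) i j = (gᴴ * f x * g) i j
    simp only [f]
    rw [_root_.mul_inv_rev, Subgroup.coe_mul, Units.val_mul, Matrix.conjTranspose_mul, ← hg]
    simp only [Matrix.mul_assoc]
  have hherm : Mᴴ = M := by
    ext i j
    let T : Matrix ι ι ℂ →ₗ[ℝ] ℂ :=
      { toFun := fun A => star (A j i)
        map_add' := fun A B => by rw [Matrix.add_apply, star_add]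
        map_smul' := fun c A => by rw [Matrix.smul_apply, star_smul, star_trivial]; rfl }
    let T' : Matrix ι ι ℂ →ₗ[ℝ] ℂ :=
      { toFun := fun A => A i j
        map_add' := fun A B => rfl
        map_smul' := fun c A => rfl }
    refine (hmap T).trans (Eq.trans ?_ (hmap T').symm)
    refine integral_congr_ae (Filter.Eventually.of_forall fun x => ?_)
    change (f x)ᴴ i j = f x i j
    simp only [f]
    rw [Matrix.conjTranspose_mul, Matrix.conjTranspose_conjTranspose]
  have hdag1 : ∀ x : Matrix ι ι ℂ, dag 1 x = xᴴ := fun x => by simp [dag_def]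
  have hpos : ∀ x : Matrix ι ι ℂ, x ≠ 0 → 0 < (dag 1 x * (M * x)).trace.re := by
    intro x hx
    let T : Matrix ι ι ℂ →ₗ[ℝ] ℝ :=
      { toFun := fun A => (dag 1 x * (A * x)).trace.re
        map_add' := fun A B => by rw [add_mul, mul_add, Matrix.trace_add, Complex.add_re]
        map_smul' := fun c A => by
          rw [Matrix.smul_mul, Matrix.mul_smul, Matrix.trace_smul, Complex.smul_re]; rfl }
    have h1 : (dag 1 x * (M * x)).trace.re = ∫ k, T (f k) ∂μ :=
      ((LinearMap.toContinuousLinearMap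
        (show (ι → ι → ℂ) →ₗ[ℝ] ℝ from T)).integral_comp_comm hint).symm
    have h2 : ∀ k, 0 < T (f k) := by
      intro k
      set g := ((k⁻¹ : K) : GL ι ℂ)
      have h3 : T (f k) = (dag 1 ((g : Matrix ι ι ℂ) * x) * ((g : Matrix ι ι ℂ) * x)).trace.re := by
        change (dag 1 x * (((g : Matrix ι ι ℂ)ᴴ * (g : Matrix ι ι ℂ)) * x)).trace.re = _
        rw [hdag1, hdag1, Matrix.conjTranspose_mul]
        simp only [Matrix.mul_assoc]
      rw [h3]
      refine trace_dag_mul_self_re_pos 1 fun h0 => hx ?_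
      rw [← Units.inv_mul_cancel_left g x, h0, Matrix.mul_zero]
    rw [h1]
    exact Continuous.integral_pos_of_hasCompactSupport_nonneg_nonzero (x := 1)
      ((LinearMap.continuous_of_finiteDimensional
        (show (ι → ι → ℂ) →ₗ[ℝ] ℝ from T)).comp hF) (HasCompactSupport.of_compactSpace _)
      (fun k => (h2 k).le) (h2 1).ne'
  obtain ⟨Q, hQd, hQ4, -⟩ := exists_fourth_root (R := 1) (T := M) (by rw [hdag1, hherm]) hpos
  let R : (Matrix ι ι ℂ)ˣ := Q * Q
  have hR : M = (R : Matrix ι ι ℂ)ᴴ * R := by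
    rw [hdag1] at hQd
    rw [← hQ4]
    simp only [R]
    rw [Units.val_mul, Matrix.conjTranspose_mul, hQd]
  refine ⟨R, fun k hk => ?_⟩
  have h1 := hinv (⟨k, hk⟩⁻¹)
  rw [inv_inv, hR] at h1
  simp only at h1
  have h2 : dag R (k : Matrix ι ι ℂ) * k = 1 := by
    rw [dag_def, Matrix.conjTranspose_mul, Matrix.conjTranspose_mul]
    have h3 : (↑R⁻¹ : Matrix ι ι ℂ)ᴴ * (R : Matrix ι ι ℂ)ᴴ = 1 := by
      rw [← Matrix.conjTranspose_mul, Units.mul_inv, Matrix.conjTranspose_one]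
    calc _ = (↑R⁻¹ : Matrix ι ι ℂ) * ((↑R⁻¹ : Matrix ι ι ℂ)ᴴ *
          ((k : Matrix ι ι ℂ)ᴴ * ((R : Matrix ι ι ℂ)ᴴ * R) * k)) := by simp only [Matrix.mul_assoc]
      _ = (↑R⁻¹ : Matrix ι ι ℂ) * (((↑R⁻¹ : Matrix ι ι ℂ)ᴴ * (R : Matrix ι ι ℂ)ᴴ) * R) := by
          rw [← h1]; simp only [Matrix.mul_assoc]
      _ = 1 := by rw [h3, Matrix.one_mul, Units.inv_mul]
  rw [Matrix.coe_units_inv, Matrix.inv_eq_left_inv h2]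

/-- A compact group of isometries is unitary for some Hermitian inner product which is compatible
with the bilinear form. -/
theorem exists_isCompatible {S : Matrix ι ι ℂ} {ε : ℂ} (hS : IsFormMatrix S ε)
    {K : Subgroup (GL ι ℂ)} (hKS : K ≤ isoGroup S hS) (hK : IsCompact (K : Set (GL ι ℂ))) :
    ∃ R : (Matrix ι ι ℂ)ˣ, IsCompatible S R ∧
      ∀ k ∈ K, dag R (k : Matrix ι ι ℂ) = (↑k⁻¹ : Matrix ι ι ℂ) := by
  obtain ⟨R, hR⟩ := exists_dag_eq_inv_of_isCompact hK
  have hSt : (Sᵀ)ᴴ = S := by rw [← hS.conjTranspose_eq, conjTranspose_conjTranspose]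
  have hSS : Sᵀ * Sᵀ = ε • (1 : Matrix ι ι ℂ) := by
    conv_lhs => rw [hS.transpose_eq]
    rw [Matrix.smul_mul, ← hS.mul_transpose, hS.transpose_eq]
  have hSS' : S * S = ε • (1 : Matrix ι ι ℂ) := by
    rw [← hS.transpose_mul, hS.transpose_eq, Matrix.smul_mul, smul_smul, hS.sign_mul_self, one_smul]
  have hSeq : S = ε • Sᵀ := by rw [hS.transpose_eq, smul_smul, hS.sign_mul_self, one_smul]
  have hdet : IsUnit S.det := Matrix.isUnit_det_of_right_inverse hS.mul_transpose
  let V : Matrix ι ι ℂ := (↑R⁻¹ : Matrix ι ι ℂ) * ((↑R⁻¹ : Matrix ι ι ℂ)ᵀ * S)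
  set N : Matrix ι ι ℂ := (↑R⁻¹ : Matrix ι ι ℂ) * (↑R⁻¹ : Matrix ι ι ℂ)ᴴ with hN
  set N' : Matrix ι ι ℂ := (R : Matrix ι ι ℂ)ᴴ * R with hN'
  have hRi : (↑R⁻¹ : Matrix ι ι ℂ)ᴴ * (R : Matrix ι ι ℂ)ᴴ = 1 := by
    rw [← Matrix.conjTranspose_mul, Units.mul_inv, Matrix.conjTranspose_one]
  have hNN : N' * N = 1 := by
    calc N' * N = (R : Matrix ι ι ℂ)ᴴ * ((R : Matrix ι ι ℂ) * (↑R⁻¹ : Matrix ι ι ℂ)) *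
          (↑R⁻¹ : Matrix ι ι ℂ)ᴴ := by rw [hN, hN']; simp only [Matrix.mul_assoc]
      _ = 1 := by rw [Units.mul_inv, Matrix.mul_one, mul_eq_one_comm.1 hRi]
  have hdag : ∀ x, dag R x = N * xᴴ * N' := fun x => by
    rw [dag_def, Matrix.conjTranspose_mul, Matrix.conjTranspose_mul, hN, hN']
    simp only [Matrix.mul_assoc]
  -- The map x ↦ adj (dag (adj x)) is the adjoint for the inner product transported by S. The matrix
  -- T intertwines it with `dag R`, see `hkey`, and T is positive because it equals V† V.
  let T : Matrix ι ι ℂ := N * (Sᵀ * Nᵀ * S)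
  have hTV : T = dag R V * V := by
    have h1 : Nᵀ = ((↑R⁻¹ : Matrix ι ι ℂ)ᵀ)ᴴ * (↑R⁻¹ : Matrix ι ι ℂ)ᵀ := by
      rw [hN, Matrix.transpose_mul]; rfl
    have h2 : N' * (↑R⁻¹ : Matrix ι ι ℂ) = (R : Matrix ι ι ℂ)ᴴ := by
      rw [hN', Matrix.mul_assoc, Units.mul_inv, Matrix.mul_one]
    calc T = N * ((Sᵀ * ((↑R⁻¹ : Matrix ι ι ℂ)ᵀ)ᴴ) * ((↑R⁻¹ : Matrix ι ι ℂ)ᴴ * (R : Matrix ι ι ℂ)ᴴ) *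
          ((↑R⁻¹ : Matrix ι ι ℂ)ᵀ * S)) := by
          simp only [T]; rw [h1, hRi]; simp only [Matrix.mul_assoc, Matrix.one_mul]
      _ = dag R V * V := by
          rw [hdag, Matrix.mul_assoc _ N', ← h2]
          simp only [V]
          rw [Matrix.conjTranspose_mul, Matrix.conjTranspose_mul, hS.conjTranspose_eq]
          simp only [Matrix.mul_assoc]
  clear_value N N'
  have hTd : dag R T = T := by rw [hTV, dag_mul, dag_dag]
  have hTadj : adj S T = T := by
    simp only [T]
    rw [adj_def]
    simp only [Matrix.transpose_mul, Matrix.transpose_transpose]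
    calc _ = (Sᵀ * Sᵀ) * N * (S * Nᵀ * S) := by simp only [Matrix.mul_assoc]
      _ = N * (Sᵀ * Nᵀ * S) := by
        rw [hSS]
        conv_rhs => rw [hS.transpose_eq]
        simp only [Matrix.smul_mul, Matrix.mul_smul, Matrix.one_mul]
  have hkey : ∀ x, T * adj S (dag R (adj S x)) = dag R x * T := by
    intro x
    have h1 : ((Sᵀ * xᵀ * S)ᴴ)ᵀ = Sᵀ * xᴴ * S := by
      rw [Matrix.conjTranspose_mul, Matrix.conjTranspose_mul, hSt, hS.conjTranspose_eq,
        Matrix.transpose_mul, Matrix.transpose_mul, Matrix.transpose_transpose,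
        show ((xᵀ)ᴴ)ᵀ = xᴴ from rfl, Matrix.mul_assoc]
    have h2 : Nᵀ * N'ᵀ = 1 := by rw [← Matrix.transpose_mul, hNN, Matrix.transpose_one]
    rw [hdag, hdag, adj_def, adj_def, Matrix.transpose_mul, Matrix.transpose_mul, h1]
    calc T * (Sᵀ * (N'ᵀ * (Sᵀ * xᴴ * S * Nᵀ)) * S)
        = N * (Sᵀ * (Nᵀ * (S * Sᵀ * N'ᵀ)) * (Sᵀ * xᴴ * S * Nᵀ * S)) := by
          simp only [T, Matrix.mul_assoc]
      _ = N * ((Sᵀ * Sᵀ) * (xᴴ * (S * Nᵀ * S))) := by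
          rw [hS.mul_transpose, Matrix.one_mul, h2, Matrix.mul_one]; simp only [Matrix.mul_assoc]
      _ = N * (xᴴ * (Sᵀ * Nᵀ * S)) := by
          rw [hSS]
          conv_rhs => rw [hS.transpose_eq]
          simp only [Matrix.smul_mul, Matrix.mul_smul, Matrix.one_mul]
      _ = N * (xᴴ * ((N' * N) * (Sᵀ * Nᵀ * S))) := by rw [hNN, Matrix.one_mul]
      _ = N * xᴴ * N' * T := by simp only [T, Matrix.mul_assoc]
  have hVinj : ∀ x, V * x = 0 → x = 0 := by
    intro x hx
    have h1 : (↑R : Matrix ι ι ℂ)ᵀ * (↑R⁻¹ : Matrix ι ι ℂ)ᵀ = 1 := by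
      rw [← Matrix.transpose_mul, Units.inv_mul, Matrix.transpose_one]
    have h2 : (Sᵀ * ((R : Matrix ι ι ℂ)ᵀ * R)) * V = 1 := by
      simp only [V]
      calc _ = Sᵀ * ((R : Matrix ι ι ℂ)ᵀ * ((R : Matrix ι ι ℂ) * (↑R⁻¹ : Matrix ι ι ℂ)) *
            (↑R⁻¹ : Matrix ι ι ℂ)ᵀ) * S := by simp only [Matrix.mul_assoc]
        _ = 1 := by rw [Units.mul_inv, Matrix.mul_one, h1, Matrix.mul_one, hS.transpose_mul]
    rw [← Matrix.one_mul x, ← h2, Matrix.mul_assoc, hx, Matrix.mul_zero]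
  -- Replacing R by RQ with Q⁴ = T changes x† to T^(-1/2) x† T^(1/2). This is the midpoint between
  -- the two adjoints, hence fixed by the symmetry that exchanges them. Elements of K commute with
  -- T, so they stay unitary.
  obtain ⟨Q, hQd, hQ4, hQc, hQa⟩ := exists_fourth_root hTd fun x hx => by
    have : dag R x * (T * x) = dag R (V * x) * (V * x) := by
      rw [hTV, dag_mul R V x]; simp only [Matrix.mul_assoc]
    rw [this]
    exact trace_dag_mul_self_re_pos R fun h0 => hx (hVinj x h0)
  have hQa' := hQa hS hTadj
  set q : Matrix ι ι ℂ := (Q : Matrix ι ι ℂ) with hq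
  set r : Matrix ι ι ℂ := (↑Q⁻¹ : Matrix ι ι ℂ) with hr
  have hrq : r * q = 1 := Units.inv_mul Q
  have hqr : q * r = 1 := Units.mul_inv Q
  have hrd : dag R r = r := by
    have h1 : dag R r * q = 1 := by rw [← hQd, ← dag_mul, hqr, dag_one]
    rw [← Matrix.mul_one (dag R r), ← hqr, ← Matrix.mul_assoc, h1, Matrix.one_mul]
  have hra : adj S r = r := by
    have h1 : adj S r * q = 1 := by rw [← hQa', ← hS.adj_mul, hqr, hS.adj_one]
    rw [← Matrix.mul_one (adj S r), ← hqr, ← Matrix.mul_assoc, h1, Matrix.one_mul]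
  have hRQ : ∀ x, dag (R * Q) x = r * r * dag R x * (q * q) := by
    intro x
    have h1 : dag (R * Q) x = r * dag R (q * x * r) * q := by
      rw [dag_def, dag_def, _root_.mul_inv_rev, Units.val_mul, Units.val_mul, ← hq, ← hr]
      simp only [Matrix.mul_assoc]
    rw [h1, dag_mul, dag_mul, hrd, hQd]
    simp only [Matrix.mul_assoc]
  refine ⟨R * Q, fun x => ?_, fun k hk => ?_⟩
  · have h1 := hkey (adj S x)
    rw [hS.adj_adj, ← hQ4] at h1
    have h2 : r * r * (q * q) = 1 := by
      rw [Matrix.mul_assoc, ← Matrix.mul_assoc r q, hrq, Matrix.one_mul, hrq]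
    have h3 : q * q * (r * r) = 1 := mul_eq_one_comm.1 h2
    rw [hRQ, hRQ, hS.adj_mul, hS.adj_mul, hS.adj_mul, hS.adj_mul, hQa', hra]
    calc q * q * (adj S (dag R x) * (r * r))
        = (r * r * (q * q)) * (q * q) * (adj S (dag R x) * (r * r)) := by rw [h2, Matrix.one_mul]
      _ = r * r * (q * q * (q * q) * adj S (dag R x)) * (r * r) := by simp only [Matrix.mul_assoc]
      _ = r * r * dag R (adj S x) * ((q * q) * (q * q * (r * r))) := by
          rw [h1]; simp only [Matrix.mul_assoc]
      _ = _ := by rw [h3, Matrix.mul_one]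
  · have h1 := hkey (↑k⁻¹ : Matrix ι ι ℂ)
    have h2 := hR _ (inv_mem hk)
    rw [inv_inv] at h2
    have h3 : adj S (↑k⁻¹ : Matrix ι ι ℂ) = k := by
      have := inv_eq_adj (inv_mem (hKS hk))
      rw [inv_inv] at this
      exact this.symm
    rw [h3, hR k hk, h2, h3] at h1
    have h4 : q * (↑k⁻¹ : Matrix ι ι ℂ) = (↑k⁻¹ : Matrix ι ι ℂ) * q :=
      (show Commute q (k : Matrix ι ι ℂ) from hQc _ h1).units_inv_right
    rw [hRQ, hR k hk]
    calc r * r * (↑k⁻¹ : Matrix ι ι ℂ) * (q * q)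
        = r * r * (((↑k⁻¹ : Matrix ι ι ℂ) * q) * q) := by simp only [Matrix.mul_assoc]
      _ = r * r * (q * ((↑k⁻¹ : Matrix ι ι ℂ) * q)) := by
          conv_lhs => rw [← h4]
          simp only [Matrix.mul_assoc]
      _ = r * (r * q) * q * (↑k⁻¹ : Matrix ι ι ℂ) := by rw [← h4]; simp only [Matrix.mul_assoc]
      _ = _ := by rw [hrq, Matrix.mul_one, hrq, Matrix.one_mul]

end CompatibleForms

/-! ### The connected center of the Levi group -/

section Center

open scoped Matrix.Norms.Operator

theorem Z_le_centerOf (L : Subgroup (GL ι ℂ)) : Z L ≤ centerOf L := by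
  rintro _ ⟨z, -, rfl⟩
  exact z.2

theorem expGL_mem_Z {L : Subgroup (GL ι ℂ)} {X : Matrix ι ι ℂ}
    (hX : ∀ t : ℝ, expGL (t • X) ∈ centerOf L) : expGL X ∈ Z L := by
  let γ : ℝ → centerOf L := fun t => ⟨expGL (t • X), hX t⟩
  have hγ : Continuous γ := (continuous_expGL_smul X).subtype_mk _
  have h0 : γ 0 = 1 := Subtype.ext (Units.ext (by
    change NormedSpace.exp ((0 : ℝ) • X) = 1
    rw [zero_smul, NormedSpace.exp_zero]))
  refine ⟨γ 1, ?_, ?_⟩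
  · exact (isPreconnected_range hγ).subset_connectedComponent ⟨0, h0⟩ ⟨1, rfl⟩
  · change expGL ((1 : ℝ) • X) = expGL X
    rw [one_smul]

/-- A continuous function with natural values on the center vanishes on the identity component if
it vanishes at the identity. -/
theorem eq_zero_on_Z {L : Subgroup (GL ι ℂ)} {f : GL ι ℂ → ℝ} (hf : Continuous f)
    (hnat : ∀ z ∈ centerOf L, ∃ n : ℕ, f z = n) (h1 : f 1 = 0) {z : GL ι ℂ} (hz : z ∈ Z L) :
    f z = 0 := by
  obtain ⟨w, hw, rfl⟩ := hz
  obtain ⟨n, hn⟩ := hnat _ w.2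
  change f w = n at hn
  change f w = 0
  rcases Nat.eq_zero_or_pos n with rfl | hpos
  · simpa using hn
  · exfalso
    have hc : ContinuousOn (fun w : centerOf L => f w) (connectedComponent (1 : centerOf L)) :=
      (hf.comp continuous_subtype_val).continuousOn
    have h2 := isPreconnected_connectedComponent.intermediate_value
      (mem_connectedComponent (x := (1 : centerOf L))) hw hc
    have h3 : (1 / 2 : ℝ) ∈ Set.Icc (f ((1 : centerOf L) : GL ι ℂ)) (f w) := by
      rw [hn, Subgroup.coe_one, h1]
      have : (1 : ℝ) ≤ n := by exact_mod_cast hpos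
      constructor <;> linarith
    obtain ⟨v, -, hv⟩ := h2 h3
    obtain ⟨m, hm⟩ := hnat _ v.2
    simp only at hv
    rw [hm] at hv
    have h4 : (2 * m : ℝ) = 1 := by rw [hv]; norm_num
    have h5 : 2 * m = 1 := by exact_mod_cast h4
    omega

theorem exists_trace_eq_natCast {e : Matrix ι ι ℂ} (he : e * e = e) : ∃ n : ℕ, e.trace = n := by
  have h1 : IsIdempotentElem (Matrix.toLin' e) := by
    rw [IsIdempotentElem, Module.End.mul_eq_comp, ← Matrix.toLin'_mul, he]
  refine ⟨Module.finrank ℂ (LinearMap.range (Matrix.toLin' e)), ?_⟩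
  rw [← Matrix.trace_toLin'_eq]
  exact (LinearMap.IsIdempotentElem.isProj_range _ h1).trace

theorem eq_zero_of_idempotent_of_trace {e : Matrix ι ι ℂ} (he : e * e = e) (h0 : e.trace = 0) :
    e = 0 := by
  have h2 : IsIdempotentElem (Matrix.toLin' e) := by
    rw [IsIdempotentElem, Module.End.mul_eq_comp, ← Matrix.toLin'_mul, he]
  have h3 := LinearMap.IsIdempotentElem.eq_zero_of_trace_eq_zero h2
    (by rw [Matrix.trace_toLin'_eq, h0])
  simpa using h3

/-- The center of a corner of a matrix algebra consists of scalars. -/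
theorem exists_eq_smul_of_forall_commute {q w : Matrix ι ι ℂ} (hq : q ≠ 0)
    (h : ∀ A, w * A * q = q * A * w) : ∃ ζ : ℂ, w = ζ • q := by
  obtain ⟨j, b, hjb⟩ : ∃ j b, q j b ≠ 0 := by
    by_contra! hcon
    exact hq (Matrix.ext hcon)
  have hs : ∀ (u v : Matrix ι ι ℂ) (i j a b : ι), (u * Matrix.single i j (1 : ℂ) * v : Matrix ι ι ℂ) a b =
      u a i * v j b := by
    intro u v i j a b
    rw [Matrix.mul_assoc, Matrix.mul_apply, Finset.sum_eq_single i]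
    · rw [Matrix.single_mul_apply_same, one_mul]
    · intro k _ hk
      rw [Matrix.single_mul_apply_of_ne _ _ _ _ _ hk, mul_zero]
    · simp
  refine ⟨w j b / q j b, ?_⟩
  ext a i
  have h1 := congrFun (congrFun (h (Matrix.single i j 1)) a) b
  rw [hs, hs] at h1
  rw [Matrix.smul_apply, smul_eq_mul, div_mul_eq_mul_div, eq_div_iff hjb]
  linear_combination h1

namespace IsGradedParabolic

variable {S : Matrix ι ι ℂ} {ε : ℂ} {hS : IsFormMatrix S ε} {R : (Matrix ι ι ℂ)ˣ}
  {𝔭 : Submodule ℂ (Matrix ι ι ℂ)} {H : Matrix ι ι ℂ} {s : Finset ℝ} {p : ℝ → Matrix ι ι ℂ}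
  (h : IsGradedParabolic hS R 𝔭 H s p)
include h

/-- For c ≠ 0 and y supported on V_c, the matrix y - adj y belongs to the Levi algebra and restricts
to y on V_c. Thus z commutes with all of gl(V_c) and is a scalar there. -/
theorem exists_scalar_of_mem_centerOf {z : GL ι ℂ} (hz : z ∈ centerOf (leviGroup hS H)) {c : ℝ}
    (hc : c ≠ 0) (hcs : c ∈ s) : ∃ ζ : ℂ, (z : Matrix ι ι ℂ) * p c = ζ • p c := by
  have hzp := h.spectral.commute_proj hz.1.2
  have hcc : c ≠ -c := fun h' => hc (by linarith)
  refine exists_eq_smul_of_forall_commute ((h.spectral.mem_iff c).1 hcs) fun A => ?_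
  set y := p c * A * p c with hy
  have h1 : y - adj S y ∈ skew S := by
    rw [mem_skew, map_sub, hS.adj_adj, neg_sub]
  have h2 : H * (y - adj S y) = (y - adj S y) * H := by
    rw [h.spectral.commute_iff]
    intro a b hab
    rw [mul_sub, sub_mul, hy, h.spectral.adj_block hS h.grading.mem_skew, h.spectral.block_block,
      h.spectral.block_block, if_neg, if_neg, sub_zero]
    · rintro ⟨rfl, rfl⟩; exact hab rfl
    · rintro ⟨rfl, rfl⟩; exact hab rfl
  have h3 : (z : Matrix ι ι ℂ) * (y - adj S y) = (y - adj S y) * z := commute_of_exp_smul fun t => by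
    have := (Subgroup.mem_centralizer_iff.1 hz.2) _
      (mem_lieAlg_iff.1 (mem_lieAlg_leviGroup.2 ⟨h1, h2⟩) t)
    exact (congrArg Units.val this).symm
  have h4 : p c * (y - adj S y) = y := by
    rw [mul_sub, hy, h.spectral.adj_block hS h.grading.mem_skew, ← Matrix.mul_assoc,
      ← Matrix.mul_assoc, h.spectral.idem, ← Matrix.mul_assoc, ← Matrix.mul_assoc,
      h.spectral.ortho _ _ hcc]
    simp
  calc (z : Matrix ι ι ℂ) * p c * A * p c = z * y := by rw [hy]; simp only [Matrix.mul_assoc]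
    _ = z * (p c * (y - adj S y)) := by rw [h4]
    _ = p c * (z * (y - adj S y)) := by rw [← Matrix.mul_assoc, ← hzp, Matrix.mul_assoc]
    _ = y * z := by rw [h3, ← Matrix.mul_assoc, h4]
    _ = p c * A * (z * p c) := by rw [hy, ← hzp, ← Matrix.mul_assoc]

/-- For central z, the matrix (z - z⁻¹) p 0 is a skew matrix commuting with the Levi group, so
genericity of H makes it zero and z² = 1 on V_0. The trace of the projection to the (-1)-eigenspace
is a natural number depending continuously on z, so it is zero on the identity component. -/
theorem mul_proj_zero_of_mem_Z
    (hgen : ∀ D ∈ skew S, dag R D = D →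
      (∀ g ∈ leviGroup hS H, D * (g : Matrix ι ι ℂ) = g * D) → D * p 0 = 0)
    {z : GL ι ℂ} (hz : z ∈ Z (leviGroup hS H)) : (z : Matrix ι ι ℂ) * p 0 = p 0 := by
  have hinv : ∀ z ∈ centerOf (leviGroup hS H),
      (z : Matrix ι ι ℂ) * p 0 * ((z : Matrix ι ι ℂ) * p 0) = p 0 := by
    intro z hz
    have hzp := h.spectral.commute_proj hz.1.2 0
    have hzi := h.spectral.commute_proj (inv_mem hz).1.2 0
    set D := (z : Matrix ι ι ℂ) * p 0 - (↑z⁻¹ : Matrix ι ι ℂ) * p 0 with hD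
    have hp0 : adj S (p 0) = p 0 := by rw [h.spectral.adj_eq hS h.grading.mem_skew, neg_zero]
    have hDs : D ∈ skew S := by
      rw [mem_skew, hD, map_sub, hS.adj_mul, hS.adj_mul, hp0, inv_eq_adj hz.1.1, hS.adj_adj,
        ← inv_eq_adj hz.1.1, hzp, hzi, neg_sub]
    have hDg : ∀ g ∈ leviGroup hS H, D * (g : Matrix ι ι ℂ) = g * D := by
      intro g hg
      have hgp := h.spectral.commute_proj hg.2 0
      have e1 := congrArg Units.val ((Subgroup.mem_centralizer_iff.1 hz.2) g hg)
      have e2 := congrArg Units.val ((Subgroup.mem_centralizer_iff.1 (inv_mem hz).2) g hg)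
      rw [Units.val_mul, Units.val_mul] at e1 e2
      rw [hD, sub_mul, mul_sub, Matrix.mul_assoc, Matrix.mul_assoc, hgp, ← Matrix.mul_assoc,
        ← Matrix.mul_assoc, ← e1, ← e2, Matrix.mul_assoc, Matrix.mul_assoc]
    have hdDg : ∀ g ∈ leviGroup hS H, dag R D * (g : Matrix ι ι ℂ) = g * dag R D := by
      intro g hg
      obtain ⟨g', hg', e⟩ := h.dag_mem_leviGroup hg
      have := congrArg (dag R) (hDg g' hg')
      rw [dag_mul, dag_mul, e, dag_dag] at this
      exact this.symm
    have hdDs := h.compat.dag_mem_skew hDs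
    -- Genericity is a statement about self-adjoint matrices, so it is applied to D + D† and to i(D
    -- - D†).
    have e1 := hgen (D + dag R D) (add_mem hDs hdDs) (by rw [map_add, dag_dag, add_comm])
      fun g hg => by rw [add_mul, mul_add, hDg g hg, hdDg g hg]
    have e2 := hgen (Complex.I • (D - dag R D)) (Submodule.smul_mem _ _ (sub_mem hDs hdDs))
      (by
        rw [map_smulₛₗ, map_sub, dag_dag, Complex.conj_I, neg_smul, ← smul_neg, neg_sub])
      fun g hg => by rw [Matrix.smul_mul, Matrix.mul_smul, sub_mul, mul_sub, hDg g hg, hdDg g hg]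
    rw [Matrix.smul_mul, smul_eq_zero, or_iff_right Complex.I_ne_zero, sub_mul, sub_eq_zero] at e2
    rw [add_mul, ← e2, ← two_smul ℂ, smul_eq_zero, or_iff_right two_ne_zero, hD, sub_mul,
      Matrix.mul_assoc, Matrix.mul_assoc, h.spectral.idem, sub_eq_zero] at e1
    calc (z : Matrix ι ι ℂ) * p 0 * ((z : Matrix ι ι ℂ) * p 0)
        = (z : Matrix ι ι ℂ) * (p 0 * (z : Matrix ι ι ℂ)) * p 0 := by simp only [Matrix.mul_assoc]
      _ = (z : Matrix ι ι ℂ) * ((z : Matrix ι ι ℂ) * p 0) := by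
        rw [hzp, Matrix.mul_assoc, Matrix.mul_assoc, h.spectral.idem]
      _ = p 0 := by rw [e1, Units.mul_inv_cancel_left]
  let e : GL ι ℂ → Matrix ι ι ℂ := fun z => (1 / 2 : ℂ) • (p 0 - (z : Matrix ι ι ℂ) * p 0)
  have he : ∀ z ∈ centerOf (leviGroup hS H), e z * e z = e z := by
    intro z hz
    have e1 := hinv z hz
    have hzp := h.spectral.commute_proj hz.1.2 0
    have e2 : p 0 * ((z : Matrix ι ι ℂ) * p 0) = (z : Matrix ι ι ℂ) * p 0 := by
      rw [← Matrix.mul_assoc, hzp, Matrix.mul_assoc, h.spectral.idem]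
    have e3 : (z : Matrix ι ι ℂ) * p 0 * p 0 = (z : Matrix ι ι ℂ) * p 0 := by
      rw [Matrix.mul_assoc, h.spectral.idem]
    simp only [e]
    rw [Matrix.smul_mul, Matrix.mul_smul, smul_smul, sub_mul, mul_sub, mul_sub, h.spectral.idem, e2,
      e3, e1]
    have : p 0 - (z : Matrix ι ι ℂ) * p 0 - ((z : Matrix ι ι ℂ) * p 0 - p 0) =
        (2 : ℂ) • (p 0 - (z : Matrix ι ι ℂ) * p 0) := by rw [two_smul]; abel
    rw [this, smul_smul]
    norm_num
  have hnat : ∀ z ∈ centerOf (leviGroup hS H), ∃ n : ℕ, (e z).trace.re = n := fun z hz => by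
    obtain ⟨n, hn⟩ := exists_trace_eq_natCast (he z hz)
    exact ⟨n, by rw [hn]; simp⟩
  have hcont : Continuous fun z : GL ι ℂ => (e z).trace.re := by
    have h1 : Continuous fun z : GL ι ℂ => (z : Matrix ι ι ℂ) := Units.continuous_val
    have h2 : Continuous e :=
      (continuous_const.sub (h1.matrix_mul continuous_const)).const_smul (1 / 2 : ℂ)
    exact Complex.continuous_re.comp h2.matrix_trace
  have h0 := eq_zero_on_Z hcont hnat (by simp [e]) hz
  obtain ⟨n, hn⟩ := exists_trace_eq_natCast (he z (Z_le_centerOf _ hz))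
  have h1 : e z = 0 := eq_zero_of_idempotent_of_trace (he z (Z_le_centerOf _ hz)) (by
    rw [hn] at h0 ⊢
    simp only [Complex.natCast_re] at h0
    exact_mod_cast h0)
  simp only [e] at h1
  rw [smul_eq_zero, or_iff_right (by norm_num), sub_eq_zero] at h1
  exact h1.symm

theorem exists_characters
    (hgen : ∀ D ∈ skew S, dag R D = D →
      (∀ g ∈ leviGroup hS H, D * (g : Matrix ι ι ℂ) = g * D) → D * p 0 = 0) :
    ∃ ζ : ℝ → (Z (leviGroup hS H) →* ℂˣ),
      (∀ c (z : Z (leviGroup hS H)), ((z : GL ι ℂ) : Matrix ι ι ℂ) * p c = ((ζ c z : ℂˣ) : ℂ) • p c) ∧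
      ∀ c, ζ (-c) = (ζ c)⁻¹ := by
  have hex : ∀ c ∈ s, ∀ z : Z (leviGroup hS H), ∃ a : ℂˣ,
      ((z : GL ι ℂ) : Matrix ι ι ℂ) * p c = (a : ℂ) • p c := by
    intro c hc z
    have hz := Z_le_centerOf _ z.2
    by_cases h0 : c = 0
    · subst h0
      exact ⟨1, by rw [h.mul_proj_zero_of_mem_Z hgen z.2, Units.val_one, one_smul]⟩
    · obtain ⟨a, ha⟩ := h.exists_scalar_of_mem_centerOf hz h0 hc
      have ha0 : a ≠ 0 := by
        rintro rfl
        apply (h.spectral.mem_iff c).1 hc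
        rw [← Units.inv_mul_cancel_left (z : GL ι ℂ) (p c), ha, zero_smul, Matrix.mul_zero]
      exact ⟨Units.mk0 a ha0, ha⟩
  have huniq : ∀ c ∈ s, ∀ a b : ℂˣ, (a : ℂ) • p c = (b : ℂ) • p c → a = b := by
    intro c hc a b hab
    exact Units.ext (smul_left_injective ℂ ((h.spectral.mem_iff c).1 hc) hab)
  have hhom : ∀ c, ∃ ζ : Z (leviGroup hS H) →* ℂˣ, (∀ z : Z (leviGroup hS H),
      ((z : GL ι ℂ) : Matrix ι ι ℂ) * p c = ((ζ z : ℂˣ) : ℂ) • p c) ∧ (c ∉ s → ζ = 1) := by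
    intro c
    by_cases hc : c ∈ s
    · choose f hf using hex c hc
      refine ⟨MonoidHom.mk' f fun z w => huniq c hc _ _ ?_, hf, fun h' => absurd hc h'⟩
      rw [← hf, Subgroup.coe_mul, Units.val_mul, Matrix.mul_assoc, hf w, Matrix.mul_smul, hf z,
        smul_smul, mul_comm, Units.val_mul]
    -- Outside the spectrum any character would do; the choice 1 makes ζ (-c) = (ζ c)⁻¹ valid for
    -- every real c.
    · exact ⟨1, fun z => by rw [h.spectral.eq_zero hc]; simp, fun _ => rfl⟩
  choose ζ hζ hζ1 using hhom
  refine ⟨ζ, hζ, fun c => ?_⟩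
  by_cases hc : c ∈ s
  · have hc' := h.spectral.neg_mem hS h.grading.mem_skew hc
    ext1 z
    refine huniq (-c) hc' _ _ ?_
    have hz := Z_le_centerOf _ z.2
    have h1 := congrArg (adj S) (hζ c z⁻¹)
    rw [hS.adj_mul, map_smul, h.spectral.adj_eq hS h.grading.mem_skew, Subgroup.coe_inv,
      inv_eq_adj hz.1.1, hS.adj_adj, h.spectral.commute_proj hz.1.2, hζ, map_inv] at h1
    exact h1
  · have hc' : -c ∉ s := fun h' => hc (by
      have := h.spectral.neg_mem hS h.grading.mem_skew h'
      rwa [neg_neg] at this)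
    rw [hζ1 c hc, hζ1 _ hc']
    ext z
    simp

theorem expGL_mem_Z_of_commute {X : Matrix ι ι ℂ} (hX : X ∈ skew S)
    (hXg : ∀ g ∈ leviGroup hS H, X * (g : Matrix ι ι ℂ) = g * X) :
    expGL X ∈ Z (leviGroup hS H) := by
  have hXH : X * H = H * X := h.commute_of_forall_leviGroup hXg h.grading.mem_skew rfl
  refine expGL_mem_Z fun t => ⟨mem_lieAlg_iff.1 (mem_lieAlg_leviGroup.2 ⟨hX, hXH.symm⟩) t,
    Subgroup.mem_centralizer_iff.2 fun g hg => ?_⟩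
  apply Units.ext
  rw [Units.val_mul, Units.val_mul, coe_expGL]
  refine commute_exp ?_
  rw [Matrix.mul_smul, Matrix.smul_mul, hXg g hg]

/-- Both H and H³ are skew and commute with the Levi group, so their exponentials lie in Z.
Evaluating the characters there gives a - b = a' - b' and a³ - b³ = a'³ - b'³, whence (a - b)(b -
b')(b + a') = 0. -/
theorem characters_injective {ζ : ℝ → (Z (leviGroup hS H) →* ℂˣ)}
    (hζ : ∀ c (z : Z (leviGroup hS H)), ((z : GL ι ℂ) : Matrix ι ι ℂ) * p c = ((ζ c z : ℂˣ) : ℂ) • p c)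
    {a b a' b' : ℝ} (ha : a ∈ s) (hb : b ∈ s) (ha' : a' ∈ s) (hb' : b' ∈ s) (hab : a ≠ b)
    (heq : ζ a / ζ b = ζ a' / ζ b') : (a' = a ∧ b' = b) ∨ (a' = -b ∧ b' = -a) := by
  have key : ∀ (X : Matrix ι ι ℂ) (φ : ℝ → ℝ), X ∈ skew S →
      (∀ g ∈ leviGroup hS H, X * (g : Matrix ι ι ℂ) = g * X) →
      (∀ c, X * p c = ((φ c : ℝ) : ℂ) • p c) → φ a - φ b = φ a' - φ b' := by
    intro X φ hX hXg hφ
    have h1 : ∀ c ∈ s, ((ζ c ⟨_, h.expGL_mem_Z_of_commute hX hXg⟩ : ℂˣ) : ℂ) = Real.exp (φ c) := by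
      intro c hc
      have h2 := hζ c ⟨_, h.expGL_mem_Z_of_commute hX hXg⟩
      simp only at h2
      rw [coe_expGL, exp_mul_of_mul_eq (hφ c)] at h2
      exact (smul_left_injective ℂ ((h.spectral.mem_iff c).1 hc) h2).symm
    have h3 := congrArg Units.val (DFunLike.congr_fun heq ⟨_, h.expGL_mem_Z_of_commute hX hXg⟩)
    rw [MonoidHom.div_apply, MonoidHom.div_apply, Units.val_div_eq_div_val,
      Units.val_div_eq_div_val, h1 a ha, h1 b hb, h1 a' ha', h1 b' hb'] at h3
    have h4 : Real.exp (φ a) / Real.exp (φ b) = Real.exp (φ a') / Real.exp (φ b') := by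
      exact_mod_cast h3
    rw [← Real.exp_sub, ← Real.exp_sub] at h4
    exact Real.exp_injective h4
  have hH := mem_skew.1 h.grading.mem_skew
  have e1 := key H id h.grading.mem_skew (fun g hg => hg.2) h.spectral.left
  have e3 := key (H * H * H) (fun c => c ^ 3)
    (by rw [mem_skew, hS.adj_mul, hS.adj_mul, hH]; simp [Matrix.mul_assoc])
    (fun g hg => by
      simp only [Matrix.mul_assoc, hg.2]
      rw [← Matrix.mul_assoc H (g : Matrix ι ι ℂ), hg.2, Matrix.mul_assoc, ← Matrix.mul_assoc H (g : Matrix ι ι ℂ), hg.2, Matrix.mul_assoc])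
    (fun c => by
      rw [Matrix.mul_assoc, Matrix.mul_assoc, h.spectral.left, Matrix.mul_smul, Matrix.mul_smul,
        h.spectral.left, Matrix.mul_smul, h.spectral.left, smul_smul, smul_smul]
      push_cast
      ring_nf)
  simp only [id] at e1 e3
  have e4 : (a - b) * ((b - b') * (b + a')) = 0 := by
    have ha2 : a' = a - b + b' := by linarith
    subst ha2
    linear_combination (1 / 3) * e3
  rcases mul_eq_zero.1 e4 with h1 | h1
  · exact absurd (sub_eq_zero.1 h1) hab
  · rcases mul_eq_zero.1 h1 with h2 | h2
    · left; constructor <;> linarith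
    · right; constructor <;> linarith

end IsGradedParabolic

end Center

/-! ### Weight spaces as pairs of blocks -/

section Weights

/-- A family of characters describing the action of the connected center of the Levi subgroup on
the eigenspaces of the grading element. -/
structure IsWeightFamily {S : Matrix ι ι ℂ} {ε : ℂ} (hS : IsFormMatrix S ε) (H : Matrix ι ι ℂ)
    (p : ℝ → Matrix ι ι ℂ) (ζ : ℝ → (Z (leviGroup hS H) →* ℂˣ)) : Prop where
  smul_eq : ∀ c (z : Z (leviGroup hS H)),
    ((z : GL ι ℂ) : Matrix ι ι ℂ) * p c = ((ζ c z : ℂˣ) : ℂ) • p c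
  neg : ∀ c, ζ (-c) = (ζ c)⁻¹

variable {S : Matrix ι ι ℂ} {ε : ℂ} {hS : IsFormMatrix S ε} {R : (Matrix ι ι ℂ)ˣ}
  {𝔭 : Submodule ℂ (Matrix ι ι ℂ)} {H : Matrix ι ι ℂ} {s : Finset ℝ} {p : ℝ → Matrix ι ι ℂ}
  {ζ : ℝ → (Z (leviGroup hS H) →* ℂˣ)}

theorem IsWeightFamily.div_neg (hζ : IsWeightFamily hS H p ζ) (a b : ℝ) :
    ζ (-b) / ζ (-a) = ζ a / ζ b := by
  rw [hζ.neg, hζ.neg]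
  ext z
  simp [div_eq_mul_inv, mul_comm]

theorem IsWeightFamily.div_inv (a b : ℝ) : (ζ a / ζ b)⁻¹ = ζ b / ζ a := by
  ext z
  simp [div_eq_mul_inv, mul_comm]

namespace IsGradedParabolic

variable (h : IsGradedParabolic hS R 𝔭 H s p) (hζ : IsWeightFamily hS H p ζ)
include h hζ

theorem block_Ad (z : Z (leviGroup hS H)) (X : Matrix ι ι ℂ) (a b : ℝ) :
    p a * Ad (z : GL ι ℂ) X * p b = (((ζ a / ζ b) z : ℂˣ) : ℂ) • (p a * X * p b) := by
  have hz := h.spectral.commute_proj (Z_le_centerOf _ z.2).1.2 a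
  have hi := hζ.smul_eq b z⁻¹
  rw [Subgroup.coe_inv, map_inv] at hi
  calc p a * Ad (z : GL ι ℂ) X * p b
      = (p a * ((z : GL ι ℂ) : Matrix ι ι ℂ)) * X * (((z : GL ι ℂ)⁻¹ : GL ι ℂ) * p b) := by
        rw [Ad]; simp only [Matrix.mul_assoc]
    _ = _ := by
        rw [hz, hζ.smul_eq, hi, Matrix.smul_mul, Matrix.smul_mul, Matrix.mul_smul, smul_smul,
          MonoidHom.div_apply, div_eq_mul_inv, Units.val_mul]

theorem mem_weightSpace_iff {χ : Z (leviGroup hS H) →* ℂˣ} {X : Matrix ι ι ℂ} :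
    X ∈ weightSpace (isoGroup S hS) (leviGroup hS H) χ ↔
      X ∈ skew S ∧ ∀ a ∈ s, ∀ b ∈ s, χ ≠ ζ a / ζ b → p a * X * p b = 0 := by
  constructor
  · rintro ⟨h1, h2⟩
    refine ⟨mem_lieAlg_isoGroup.1 h1, fun a _ b _ hab => ?_⟩
    by_contra h0
    apply hab
    ext z
    have h3 := h.block_Ad hζ z X a b
    rw [h2 z, Matrix.mul_smul, Matrix.smul_mul] at h3
    exact smul_left_injective ℂ h0 h3
  · rintro ⟨h1, h2⟩
    refine ⟨mem_lieAlg_isoGroup.2 h1, fun z => h.spectral.ext_blocks fun a ha b hb => ?_⟩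
    rw [h.block_Ad hζ, Matrix.mul_smul, Matrix.smul_mul]
    by_cases hab : χ = ζ a / ζ b
    · rw [hab]
    · rw [h2 a ha b hb hab, smul_zero, smul_zero]

/-- The weight space as a subspace. -/
theorem exists_weightSubmodule (χ : Z (leviGroup hS H) →* ℂˣ) :
    ∃ N : Submodule ℂ (Matrix ι ι ℂ),
      (N : Set (Matrix ι ι ℂ)) = weightSpace (isoGroup S hS) (leviGroup hS H) χ := by
  refine ⟨{ carrier := weightSpace (isoGroup S hS) (leviGroup hS H) χ
            add_mem' := fun {x y} hx hy => ?_
            zero_mem' := ?_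
            smul_mem' := fun c x hx => ?_ }, rfl⟩
  · rw [h.mem_weightSpace_iff hζ] at *
    exact ⟨add_mem hx.1 hy.1, fun a ha b hb hab => by
      rw [mul_add, add_mul, hx.2 a ha b hb hab, hy.2 a ha b hb hab, add_zero]⟩
  · rw [h.mem_weightSpace_iff hζ]
    exact ⟨zero_mem _, fun a ha b hb hab => by simp⟩
  · rw [h.mem_weightSpace_iff hζ] at *
    exact ⟨Submodule.smul_mem _ _ hx.1, fun a ha b hb hab => by
      rw [Matrix.mul_smul, Matrix.smul_mul, hx.2 a ha b hb hab, smul_zero]⟩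

theorem sub_adj_mem_weightSpace (x : Matrix ι ι ℂ) (a b : ℝ) :
    p a * x * p b - adj S (p a * x * p b) ∈
      weightSpace (isoGroup S hS) (leviGroup hS H) (ζ a / ζ b) := by
  rw [h.mem_weightSpace_iff hζ]
  refine ⟨by rw [mem_skew, map_sub, hS.adj_adj, neg_sub], fun a' _ b' _ hab => ?_⟩
  rw [mul_sub, sub_mul, h.spectral.adj_block hS h.grading.mem_skew, h.spectral.block_block,
    h.spectral.block_block, if_neg, if_neg, sub_zero]
  · rintro ⟨rfl, rfl⟩
    exact hab (hζ.div_neg a b).symm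
  · rintro ⟨rfl, rfl⟩
    exact hab rfl

theorem injective_of_ne {a b a' b' : ℝ} (ha : a ∈ s) (hb : b ∈ s) (ha' : a' ∈ s) (hb' : b' ∈ s)
    (hab : a ≠ b) (heq : ζ a / ζ b = ζ a' / ζ b') : (a' = a ∧ b' = b) ∨ (a' = -b ∧ b' = -a) :=
  h.characters_injective hζ.smul_eq ha hb ha' hb' hab heq

/-- A vector of weight `ζ a / ζ b` has at most two non-zero blocks. -/
theorem block_eq_zero_of_mem_weightSpace {a b : ℝ} (ha : a ∈ s) (hb : b ∈ s) (hab : a ≠ b)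
    {X : Matrix ι ι ℂ} (hX : X ∈ weightSpace (isoGroup S hS) (leviGroup hS H) (ζ a / ζ b))
    {a' b' : ℝ} (h1 : ¬(a' = a ∧ b' = b)) (h2 : ¬(a' = -b ∧ b' = -a)) : p a' * X * p b' = 0 := by
  by_cases ha' : a' ∈ s
  · by_cases hb' : b' ∈ s
    · refine ((h.mem_weightSpace_iff hζ).1 hX).2 a' ha' b' hb' fun heq => ?_
      rcases h.injective_of_ne hζ ha hb ha' hb' hab heq with h3 | h3
      · exact h1 h3
      · exact h2 h3
    · rw [h.spectral.eq_zero hb', Matrix.mul_zero]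
  · rw [h.spectral.eq_zero ha', Matrix.zero_mul, Matrix.zero_mul]

/-- The weight determines (a, b) up to replacement by (-b, -a); the case distinction avoids counting
the same block twice when a = -b. -/
theorem eq_of_mem_weightSpace {a b : ℝ} (ha : a ∈ s) (hb : b ∈ s) (hab : a ≠ b)
    {X : Matrix ι ι ℂ} (hX : X ∈ weightSpace (isoGroup S hS) (leviGroup hS H) (ζ a / ζ b)) :
    X = p a * X * p b + if a = -b then 0 else p (-b) * X * p (-a) := by
  refine h.spectral.ext_blocks fun c _ d _ => ?_
  rw [mul_add, add_mul, h.spectral.block_block]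
  by_cases h1 : c = a ∧ d = b
  · rw [h1.1, h1.2, if_pos ⟨rfl, rfl⟩]
    split_ifs with h2
    · simp
    · rw [h.spectral.block_block, if_neg fun h3 => h2 h3.1, add_zero]
  · rw [if_neg fun h3 => h1 ⟨h3.1, h3.2.symm⟩, zero_add]
    split_ifs with h2
    · rw [h.block_eq_zero_of_mem_weightSpace hζ ha hb hab hX h1, Matrix.mul_zero, Matrix.zero_mul]
      rintro ⟨rfl, rfl⟩
      exact h1 ⟨h2.symm, by linarith⟩
    · rw [h.spectral.block_block]
      split_ifs with h3
      · rw [h3.1, h3.2]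
      · exact h.block_eq_zero_of_mem_weightSpace hζ ha hb hab hX h1
          fun h4 => h3 ⟨h4.1, h4.2.symm⟩

section Positive

variable {P : Subgroup (GL ι ℂ)} (hP : IsNormalizer hS 𝔭 P)
include hP

theorem mem_lieAlg_unipotentRadical_iff {X : Matrix ι ι ℂ} :
    X ∈ lieAlg (unipotentRadical P) ↔ X ∈ skew S ∧ IsStrict p X := by
  rw [h.unipotentRadical_eq hP, h.mem_lieAlg_uniGroup, h.mem_nilrad_iff]

theorem weightSpace_subset {a b : ℝ} (ha : a ∈ s) (hb : b ∈ s) (hab : b < a) :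
    weightSpace (isoGroup S hS) (leviGroup hS H) (ζ a / ζ b) ⊆ lieAlg (unipotentRadical P) := by
  intro X hX
  refine (h.mem_lieAlg_unipotentRadical_iff hζ hP).2
    ⟨((h.mem_weightSpace_iff hζ).1 hX).1, fun c d hcd => ?_⟩
  refine h.block_eq_zero_of_mem_weightSpace hζ ha hb hab.ne' hX ?_ ?_
  · rintro ⟨rfl, rfl⟩
    exact absurd hcd (not_le.2 hab)
  · rintro ⟨rfl, rfl⟩
    linarith

theorem exists_eq_of_posWeight (χ : PosWeight (isoGroup S hS) P (leviGroup hS H)) :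
    ∃ a ∈ s, ∃ b ∈ s, b < a ∧ χ.1 = ζ a / ζ b := by
  obtain ⟨⟨X, hX, hX0⟩, hsub⟩ := χ.2
  by_contra! hcon
  apply hX0
  refine h.spectral.ext_blocks fun a ha b hb => ?_
  rw [Matrix.mul_zero, Matrix.zero_mul]
  rcases lt_or_ge b a with hab | hab
  · exact ((h.mem_weightSpace_iff hζ).1 hX).2 a ha b hb (hcon a ha b hb hab)
  · exact ((h.mem_lieAlg_unipotentRadical_iff hζ hP).1 (hsub hX)).2 a b hab

open Classical in
/-- The weight decomposition of the Lie algebra of the unipotent radical. -/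
theorem exists_weight_components {e : Matrix ι ι ℂ} (he : e ∈ lieAlg (unipotentRadical P)) :
    ∃ c : PosWeight (isoGroup S hS) P (leviGroup hS H) →₀ Matrix ι ι ℂ,
      (∀ χ, c χ ∈ weightSpace (isoGroup S hS) (leviGroup hS H) χ.1) ∧ e = c.sum fun _ x => x := by
  rw [h.mem_lieAlg_unipotentRadical_iff hζ hP] at he
  obtain ⟨hes, hest⟩ := he
  let N : PosWeight (isoGroup S hS) P (leviGroup hS H) → Submodule ℂ (Matrix ι ι ℂ) :=
    fun χ => (h.exists_weightSubmodule hζ χ.1).choose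
  have hN : ∀ χ, (N χ : Set (Matrix ι ι ℂ)) = weightSpace (isoGroup S hS) (leviGroup hS H) χ.1 :=
    fun χ => (h.exists_weightSubmodule hζ χ.1).choose_spec
  -- For skew e, block (-b, -a) is minus the adjoint of block (a, b). Antisymmetrizing every block
  -- of e produces e twice, which explains the factor 1/2.
  let m : ℝ → ℝ → Matrix ι ι ℂ := fun a b =>
    p a * ((1 / 2 : ℂ) • e) * p b - adj S (p a * ((1 / 2 : ℂ) • e) * p b)
  have hmw : ∀ a b, m a b ∈ weightSpace (isoGroup S hS) (leviGroup hS H) (ζ a / ζ b) :=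
    fun a b => h.sub_adj_mem_weightSpace hζ _ a b
  have hm0 : ∀ a b, a ≤ b → m a b = 0 := by
    intro a b hab
    simp only [m]
    rw [Matrix.mul_smul, Matrix.smul_mul, hest a b hab, smul_zero, map_zero, sub_zero]
  have hex : ∀ a ∈ s, ∀ b ∈ s, ∃ c : PosWeight (isoGroup S hS) P (leviGroup hS H) →₀ Matrix ι ι ℂ,
      (∀ χ, c χ ∈ N χ) ∧ (c.sum fun _ x => x) = m a b := by
    intro a ha b hb
    by_cases h0 : m a b = 0
    · exact ⟨0, fun χ => by simp, by rw [h0, Finsupp.sum_zero_index]⟩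
    · have hab : b < a := by
        by_contra hcon
        exact h0 (hm0 a b (not_lt.1 hcon))
      let χ0 : PosWeight (isoGroup S hS) P (leviGroup hS H) :=
        ⟨ζ a / ζ b, ⟨m a b, hmw a b, h0⟩, h.weightSpace_subset hζ hP ha hb hab⟩
      refine ⟨Finsupp.single χ0 (m a b), fun χ => ?_, Finsupp.sum_single_index rfl⟩
      by_cases hχ : χ = χ0
      · rw [hχ, Finsupp.single_eq_same, ← SetLike.mem_coe, hN]
        exact hmw a b
      · rw [Finsupp.single_eq_of_ne hχ]
        exact zero_mem _
  choose! f hfN hfs using hex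
  refine ⟨∑ a ∈ s, ∑ b ∈ s, f a b, fun χ => ?_, ?_⟩
  · rw [← hN, SetLike.mem_coe, Finsupp.finsetSum_apply]
    refine Submodule.sum_mem _ fun a ha => ?_
    rw [Finsupp.finsetSum_apply]
    exact Submodule.sum_mem _ fun b hb => hfN a ha b hb χ
  · have hsum : ((∑ a ∈ s, ∑ b ∈ s, f a b).sum fun _ x => x) = ∑ a ∈ s, ∑ b ∈ s, m a b := by
      rw [← Finsupp.sum_finsetSum_index (fun _ => rfl) (fun _ _ _ => rfl)]
      refine Finset.sum_congr rfl fun a ha => ?_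
      rw [← Finsupp.sum_finsetSum_index (fun _ => rfl) (fun _ _ _ => rfl)]
      exact Finset.sum_congr rfl fun b hb => hfs a ha b hb
    rw [hsum]
    simp only [m, Finset.sum_sub_distrib, ← map_sum]
    rw [← h.spectral.expand, map_smul, mem_skew.1 hes, smul_neg, sub_neg_eq_add, ← add_smul]
    norm_num

theorem block_component {c : PosWeight (isoGroup S hS) P (leviGroup hS H) →₀ Matrix ι ι ℂ}
    (hc : ∀ χ, c χ ∈ weightSpace (isoGroup S hS) (leviGroup hS H) χ.1)
    (χ : PosWeight (isoGroup S hS) P (leviGroup hS H)) {a b : ℝ} (ha : a ∈ s) (hb : b ∈ s)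
    (hχ : χ.1 = ζ a / ζ b) : p a * c χ * p b = p a * (c.sum fun _ x => x) * p b := by
  rw [Finsupp.sum, Matrix.mul_sum, Matrix.sum_mul, Finset.sum_eq_single χ]
  · intro χ' _ hne
    refine ((h.mem_weightSpace_iff hζ).1 (hc χ')).2 a ha b hb fun heq => hne ?_
    exact Subtype.ext (heq.trans hχ.symm)
  · intro hns
    rw [Finsupp.notMem_support_iff.1 hns, Matrix.mul_zero, Matrix.zero_mul]

end Positive

end IsGradedParabolic

end Weights

/-! ### Triples for homogeneous elements -/

theorem IsMoorePenrose.add {R : (Matrix ι ι ℂ)ˣ} {a a' b b' : Matrix ι ι ℂ}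
    (ha : IsMoorePenrose R a a') (hb : IsMoorePenrose R b b') (h1 : a * b' = 0) (h2 : b * a' = 0)
    (h3 : a' * b = 0) (h4 : b' * a = 0) : IsMoorePenrose R (a + b) (a' + b') := by
  obtain ⟨a1, a2, a3, a4⟩ := ha
  obtain ⟨b1, b2, b3, b4⟩ := hb
  have e1 : (a + b) * (a' + b') = a * a' + b * b' := by
    rw [add_mul, mul_add, mul_add, h1, h2, add_zero, zero_add]
  have e2 : (a' + b') * (a + b) = a' * a + b' * b := by
    rw [add_mul, mul_add, mul_add, h3, h4, add_zero, zero_add]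
  refine ⟨?_, ?_, by rw [e1, map_add, a3, b3], by rw [e2, map_add, a4, b4]⟩
  · rw [e1, add_mul, mul_add, mul_add, a1, b1, Matrix.mul_assoc a, h3, Matrix.mul_assoc b, h4]
    simp
  · rw [e2, add_mul, mul_add, mul_add, a2, b2, Matrix.mul_assoc a', h1, Matrix.mul_assoc b', h2]
    simp

theorem IsMoorePenrose.adj {S : Matrix ι ι ℂ} {ε : ℂ} (hS : IsFormMatrix S ε)
    {R : (Matrix ι ι ℂ)ˣ} (hc : IsCompatible S R) {x y : Matrix ι ι ℂ}
    (h : IsMoorePenrose R x y) : IsMoorePenrose R (adj S x) (adj S y) := by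
  obtain ⟨h1, h2, h3, h4⟩ := h
  refine ⟨?_, ?_, ?_, ?_⟩
  · rw [← hS.adj_mul, ← hS.adj_mul, ← Matrix.mul_assoc, h1]
  · rw [← hS.adj_mul, ← hS.adj_mul, ← Matrix.mul_assoc, h2]
  · rw [← hS.adj_mul, ← hc, h4]
  · rw [← hS.adj_mul, ← hc, h3]

theorem IsMoorePenrose.neg {R : (Matrix ι ι ℂ)ˣ} {x y : Matrix ι ι ℂ}
    (h : IsMoorePenrose R x y) : IsMoorePenrose R (-x) (-y) := by
  obtain ⟨h1, h2, h3, h4⟩ := h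
  refine ⟨?_, ?_, ?_, ?_⟩ <;> simp [h1, h2, h3, h4]

/-- The Moore–Penrose inverse of a block is supported in the transposed block. -/
theorem IsMoorePenrose.block {R : (Matrix ι ι ℂ)ˣ} {x y q r : Matrix ι ι ℂ}
    (h : IsMoorePenrose R x y) (hq : dag R q = q) (hr : dag R r = r) (hqx : q * x = x)
    (hxr : x * r = x) : r * y = y ∧ y * q = y := by
  obtain ⟨h1, h2⟩ := h.factor_dag
  have e1 : r * dag R x = dag R x := by
    have := congrArg (dag R) hxr
    rwa [dag_mul, hr] at this
  have e2 : dag R x * q = dag R x := by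
    have := congrArg (dag R) hqx
    rwa [dag_mul, hq] at this
  constructor
  · rw [h1, ← Matrix.mul_assoc, e1]
  · rw [h2, Matrix.mul_assoc, e2]

namespace IsGradedParabolic

variable {S : Matrix ι ι ℂ} {ε : ℂ} {hS : IsFormMatrix S ε} {R : (Matrix ι ι ℂ)ˣ}
  {𝔭 : Submodule ℂ (Matrix ι ι ℂ)} {H : Matrix ι ι ℂ} {s : Finset ℝ} {p : ℝ → Matrix ι ι ℂ}
  {ζ : ℝ → (Z (leviGroup hS H) →* ℂˣ)}
  (h : IsGradedParabolic hS R 𝔭 H s p) (hζ : IsWeightFamily hS H p ζ)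
include h hζ

theorem mem_weightSpace_of_skew {f : Matrix ι ι ℂ} (hf : f ∈ skew S) {a b : ℝ}
    (hfb : p a * f * p b = f) : f ∈ weightSpace (isoGroup S hS) (leviGroup hS H) (ζ a / ζ b) := by
  obtain ⟨N, hN⟩ := h.exists_weightSubmodule hζ (ζ a / ζ b)
  have h1 := h.sub_adj_mem_weightSpace hζ f a b
  rw [hfb, mem_skew.1 hf, sub_neg_eq_add, ← two_smul ℂ] at h1
  rw [← hN] at h1 ⊢
  exact (Submodule.smul_mem_iff _ two_ne_zero).1 h1

/-- A block V_{-c} → V_c squares to zero. Its Moore–Penrose inverse is skew by uniqueness, because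
compatibility lets `adj S` commute with the construction. -/
theorem exists_triple_of_block {c : ℝ} (hc : 0 < c) {y : Matrix ι ι ℂ} (hy : y ∈ skew S)
    (hyb : p c * y * p (-c) = y) : ∃ h0 f, IsSl2 y h0 f ∧
      f ∈ weightSpace (isoGroup S hS) (leviGroup hS H) (ζ (-c) / ζ c) ∧ dag R h0 = h0 := by
  obtain ⟨f, hf⟩ := exists_isMoorePenrose R y
  have hy1 : p c * y = y := by
    conv_rhs => rw [← hyb]
    conv_lhs => rw [← hyb]
    rw [← Matrix.mul_assoc, ← Matrix.mul_assoc, h.spectral.idem]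
  have hy2 : y * p (-c) = y := by
    conv_rhs => rw [← hyb]
    conv_lhs => rw [← hyb]
    rw [Matrix.mul_assoc, h.spectral.idem]
  obtain ⟨e1, e2⟩ := hf.block (h.spectral.dag_eq c) (h.spectral.dag_eq (-c)) hy1 hy2
  have hyy : y * y = 0 := by
    calc y * y = y * (p (-c) * p c) * y := by
          rw [← Matrix.mul_assoc, hy2, Matrix.mul_assoc, hy1]
      _ = 0 := by rw [h.spectral.ortho _ _ (by linarith)]; simp
  have hfs : f ∈ skew S := by
    have := hf.adj hS h.compat
    rw [mem_skew.1 hy] at this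
    exact mem_skew.2 (this.unique hf.neg)
  obtain ⟨h3, h4⟩ := hf.isSl2 hyy
  exact ⟨_, f, h3, h.mem_weightSpace_of_skew hζ hfs (by rw [e1, e2]), h4⟩

/-- The blocks a and -adj a have mutually orthogonal supports since c ≠ -d, so their Moore–Penrose
inverses add; the conditions on c and d also make the square of the sum zero. -/
theorem exists_triple_of_two_blocks {c d : ℝ} (hc : c ≠ 0) (hd : d ≠ 0) (hdc : d < c)
    (hcd : c ≠ -d) {y : Matrix ι ι ℂ} (hy : y ∈ skew S)
    (hyb : y = p c * y * p d + p (-d) * y * p (-c)) : ∃ h0 f, IsSl2 y h0 f ∧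
      f ∈ weightSpace (isoGroup S hS) (leviGroup hS H) (ζ d / ζ c) ∧ dag R h0 = h0 := by
  have hort := h.spectral.ortho
  obtain ⟨a, ha⟩ : ∃ a, a = p c * y * p d := ⟨_, rfl⟩
  have hb : p (-d) * y * p (-c) = -adj S a := by
    rw [ha, h.spectral.adj_block hS h.grading.mem_skew, mem_skew.1 hy]
    simp
  rw [← ha, hb] at hyb
  obtain ⟨f, hf⟩ := exists_isMoorePenrose R a
  have ha1 : p c * a = a := by
    rw [ha, ← Matrix.mul_assoc, ← Matrix.mul_assoc, h.spectral.idem]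
  have ha2 : a * p d = a := by rw [ha, Matrix.mul_assoc, h.spectral.idem]
  obtain ⟨e1, e2⟩ := hf.block (h.spectral.dag_eq c) (h.spectral.dag_eq d) ha1 ha2
  have hadj := fun x => h.spectral.adj_eq hS h.grading.mem_skew x
  have hb1 : p (-d) * adj S a = adj S a := by rw [← hadj, ← hS.adj_mul, ha2]
  have hb2 : adj S a * p (-c) = adj S a := by rw [← hadj, ← hS.adj_mul, ha1]
  have hf1 : p (-c) * adj S f = adj S f := by rw [← hadj, ← hS.adj_mul, e2]
  have hf2 : adj S f * p (-d) = adj S f := by rw [← hadj, ← hS.adj_mul, e1]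
  have hz : ∀ {u v : Matrix ι ι ℂ} {i j : ℝ}, u * p i = u → p j * v = v → i ≠ j → u * v = 0 := by
    intro u v i j hu hv hij
    calc u * v = u * (p i * p j) * v := by rw [← Matrix.mul_assoc, hu, Matrix.mul_assoc, hv]
      _ = 0 := by rw [hort _ _ hij]; simp
  have hmp := hf.add (hf.adj hS h.compat).neg
    (by rw [mul_neg, hz ha2 hf1 (fun h' => hcd (by linarith)), neg_zero])
    (by rw [neg_mul, hz hb2 e1 (fun h' => hcd (by linarith)), neg_zero])
    (by rw [mul_neg, hz e2 hb1 hcd, neg_zero])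
    (by rw [neg_mul, hz hf2 ha1 (fun h' => hcd h'.symm), neg_zero])
  rw [← hyb] at hmp
  have hyy : y * y = 0 := by
    rw [hyb, add_mul, mul_add, mul_add, hz ha2 ha1 hdc.ne, mul_neg, neg_mul, neg_mul_neg,
      hz ha2 hb1 (fun h' => hd (by linarith)), hz hb2 ha1 (fun h' => hc (by linarith)),
      hz hb2 hb1 (fun h' => hdc.ne (by linarith))]
    simp
  obtain ⟨h3, h4⟩ := hmp.isSl2 hyy
  refine ⟨_, _, h3, ?_, h4⟩
  have := h.sub_adj_mem_weightSpace hζ f d c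
  rwa [e1, e2, sub_eq_add_neg] at this

/-- The chain V_{-c} → V_0 → V_c need not square to zero, so the string formula replaces the
Moore–Penrose inverse. Up to sign `adj S` exchanges the two maps, and it fixes the inverse w of
their product; hence f has the form g - adj g and is skew of the right weight. -/
theorem exists_triple_of_partial_isometry {c : ℝ} (hc : 0 < c) {y : Matrix ι ι ℂ} (hy : y ∈ skew S)
    (hyb : y = p c * y * p 0 + p 0 * y * p (-c))
    (hpi : p c * y * p 0 * dag R (p c * y * p 0) * (p c * y * p 0) = p c * y * p 0) :
    ∃ h0 f, IsSl2 y h0 f ∧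
      f ∈ weightSpace (isoGroup S hS) (leviGroup hS H) (ζ 0 / ζ c) ∧ dag R h0 = h0 := by
  have hort := h.spectral.ortho
  obtain ⟨a, ha⟩ : ∃ a, a = p c * y * p 0 := ⟨_, rfl⟩
  obtain ⟨b, hb'⟩ : ∃ b, b = p 0 * y * p (-c) := ⟨_, rfl⟩
  have hba : adj S a = -b := by
    rw [ha, hb', h.spectral.adj_block hS h.grading.mem_skew, mem_skew.1 hy]
    simp
  have hab : adj S b = -a := by rw [← hS.adj_adj a, hba, map_neg, neg_neg]
  rw [← ha, ← hb'] at hyb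
  rw [← ha] at hpi
  have hdag : ∀ x, adj S (dag R x) = dag R (adj S x) := h.compat
  have hpb : b * dag R b * b = b := by
    have := congrArg (adj S) hpi
    rw [hS.adj_mul, hS.adj_mul, hdag, hba, map_neg, neg_mul_neg, neg_mul, neg_inj,
      ← Matrix.mul_assoc] at this
    exact this
  have ha1 : p c * a = a := by
    rw [ha, ← Matrix.mul_assoc, ← Matrix.mul_assoc, h.spectral.idem]
  have ha2 : a * p 0 = a := by rw [ha, Matrix.mul_assoc, h.spectral.idem]
  have hb1 : p 0 * b = b := by
    rw [hb', ← Matrix.mul_assoc, ← Matrix.mul_assoc, h.spectral.idem]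
  have hb2 : b * p (-c) = b := by rw [hb', Matrix.mul_assoc, h.spectral.idem]
  obtain ⟨w, h0, f, hw, hf, hsl, hh, -, hw1, hw2⟩ :=
    exists_isSl2_of_partial_isometry (h.spectral.dag_eq c) (h.spectral.dag_eq 0)
      (h.spectral.dag_eq (-c)) (hort c 0 hc.ne') (hort c (-c) (by linarith)) (hort 0 c hc.ne)
      (hort 0 (-c) (by linarith)) (hort (-c) c (by linarith)) (hort (-c) 0 (by linarith))
      ha1 ha2 hb1 hb2 hpi hpb
  have hws : adj S w = w := by
    have h1 := hw.adj hS h.compat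
    rw [hS.adj_mul, hba, hab, neg_mul_neg] at h1
    exact h1.unique hw
  have hda : adj S (dag R a) = -dag R b := by rw [hdag, hba, map_neg]
  have hdb : adj S (dag R b) = -dag R a := by rw [hdag, hab, map_neg]
  have hd1 : dag R a * p c = dag R a := by
    have := congrArg (dag R) ha1
    rwa [dag_mul, h.spectral.dag_eq] at this
  have hd2 : p 0 * dag R a = dag R a := by
    have := congrArg (dag R) ha2
    rwa [dag_mul, h.spectral.dag_eq] at this
  obtain ⟨g, hg⟩ : ∃ g, g = dag R a - dag R a * a * b * w + (b * w + b * w) := ⟨_, rfl⟩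
  have hg1 : p 0 * g * p c = g := by
    rw [hg]
    simp only [mul_add, add_mul, mul_sub, sub_mul]
    simp only [Matrix.mul_assoc, hw2, hd1]
    simp only [← Matrix.mul_assoc, hd2, hb1]
  have hga : adj S g = -(dag R b - w * a * b * dag R b + (w * a + w * a)) := by
    rw [hg]
    simp only [map_add, map_sub, hS.adj_mul, hda, hba, hab, hws]
    simp only [Matrix.mul_assoc, mul_neg, neg_mul, neg_neg]
    abel
  have hfg : f = g - adj S g := by
    rw [hf, hga, hg]
    abel
  refine ⟨h0, f, by rw [hyb]; exact hsl, ?_, hh⟩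
  have := h.sub_adj_mem_weightSpace hζ g 0 c
  rwa [hg1, ← hfg] at this

/-- Homogeneous elements of positive weight lie in homogeneous triples with self-adjoint neutral
element, provided that their blocks on the null space of the grading are partial isometries. -/
theorem exists_triple {a b : ℝ} (ha : a ∈ s) (hb : b ∈ s) (hab : b < a) {y : Matrix ι ι ℂ}
    (hy : y ∈ weightSpace (isoGroup S hS) (leviGroup hS H) (ζ a / ζ b))
    (hpi : ∀ c, 0 < c → ζ a / ζ b = ζ c / ζ 0 →
      p c * y * p 0 * dag R (p c * y * p 0) * (p c * y * p 0) = p c * y * p 0) :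
    ∃ h0 f, IsSl2 y h0 f ∧
      f ∈ weightSpace (isoGroup S hS) (leviGroup hS H) (ζ a / ζ b)⁻¹ ∧ dag R h0 = h0 := by
  have hys := ((h.mem_weightSpace_iff hζ).1 hy).1
  have hyb := h.eq_of_mem_weightSpace hζ ha hb hab.ne' hy
  rw [IsWeightFamily.div_inv]
  by_cases h1 : a = -b
  · rw [if_pos h1, add_zero] at hyb
    have h2 : b = -a := by linarith
    have := h.exists_triple_of_block hζ (c := a) (by linarith) hys (by rw [← h2, ← hyb])
    rwa [← h2] at this
  rw [if_neg h1] at hyb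
  by_cases hb0 : b = 0
  · subst hb0
    rw [neg_zero] at hyb
    exact h.exists_triple_of_partial_isometry hζ hab hys hyb (hpi a hab rfl)
  by_cases ha0 : a = 0
  · subst ha0
    -- The pair (0, b) gives the same weight as (-b, 0), which is the preceding case with c = -b.
    have e := hζ.div_neg 0 b
    rw [neg_zero] at hyb e
    rw [← hζ.div_neg b 0, neg_zero]
    refine h.exists_triple_of_partial_isometry hζ (c := -b) (by linarith) hys ?_
      (hpi _ (by linarith) e.symm)
    rw [neg_neg, add_comm]
    exact hyb
  · exact h.exists_triple_of_two_blocks hζ ha0 hb0 hab h1 hys hyb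

/-- An off-diagonal block carries a non-trivial character, by comparison with ζ b / ζ b. So the
neutral elements, which have trivial weight, are block diagonal. -/
theorem commute_of_mem_weightSpace_one {X : Matrix ι ι ℂ}
    (hX : X ∈ weightSpace (isoGroup S hS) (leviGroup hS H) 1) : H * X = X * H := by
  rw [h.spectral.commute_iff]
  intro a b hab
  by_cases ha : a ∈ s
  · by_cases hb : b ∈ s
    · refine ((h.mem_weightSpace_iff hζ).1 hX).2 a ha b hb fun heq => ?_
      have h1 : ζ a / ζ b = ζ b / ζ b := by
        rw [← heq]
        ext z
        simp
      rcases h.injective_of_ne hζ ha hb hb hb hab h1 with h2 | h2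
      · exact hab h2.1.symm
      · exact hab (by linarith)
    · rw [h.spectral.eq_zero hb, Matrix.mul_zero]
  · rw [h.spectral.eq_zero ha, Matrix.zero_mul, Matrix.zero_mul]

theorem lie_mem_weightSpace_one {χ : Z (leviGroup hS H) →* ℂˣ} {x y : Matrix ι ι ℂ}
    (hx : x ∈ weightSpace (isoGroup S hS) (leviGroup hS H) χ)
    (hy : y ∈ weightSpace (isoGroup S hS) (leviGroup hS H) χ⁻¹) :
    x * y - y * x ∈ weightSpace (isoGroup S hS) (leviGroup hS H) 1 := by
  refine ⟨mem_lieAlg_isoGroup.2 (hS.lie_mem_skew (mem_lieAlg_isoGroup.1 hx.1)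
    (mem_lieAlg_isoGroup.1 hy.1)), fun z => ?_⟩
  rw [Ad_sub, Ad_mul_mul, Ad_mul_mul, hx.2, hy.2]
  simp [smul_smul]

end IsGradedParabolic

/-! ### Simultaneous polar decomposition -/

/-- The coefficient of a positive spectral projection of `a a†` is positive. -/
theorem IsSpectral.pos_or_mul_eq_zero {R : (Matrix ι ι ℂ)ˣ} {A : Matrix ι ι ℂ} {t : Finset ℝ}
    {q : ℝ → Matrix ι ι ℂ} (hq : IsSpectral R A t q) {P a : Matrix ι ι ℂ} (hP : P * P = P)
    (hPd : dag R P = P) (hA : A * P = a * dag R a)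
    (hqP : ∀ ν, q ν * P = P * q ν) (ν : ℝ) : 0 < ν ∨ q ν * a = 0 := by
  by_contra! hcon
  obtain ⟨hν, hne⟩ := hcon
  apply hne
  have h1 : dag R (dag R (q ν * a)) * dag R (q ν * a) = (ν : ℂ) • (q ν * P) := by
    rw [dag_dag, dag_mul, hq.dag_eq, Matrix.mul_assoc, ← Matrix.mul_assoc a, ← hA,
      ← Matrix.mul_assoc, ← Matrix.mul_assoc, hq.right, Matrix.smul_mul, Matrix.smul_mul,
      Matrix.mul_assoc, ← hqP, ← Matrix.mul_assoc, hq.idem]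
  have h2 : dag R (q ν * P) * (q ν * P) = q ν * P := by
    rw [dag_mul, hPd, hq.dag_eq, hqP, Matrix.mul_assoc, ← Matrix.mul_assoc (q ν), hqP,
      Matrix.mul_assoc, hq.idem, ← Matrix.mul_assoc, hP]
  have h3 := trace_dag_mul_self_re_nonneg R (dag R (q ν * a))
  have h4 := trace_dag_mul_self_re_nonneg R (q ν * P)
  rw [h1, Matrix.trace_smul, smul_eq_mul, Complex.re_ofReal_mul] at h3
  rw [h2] at h4
  have h5 : dag R (q ν * a) = 0 := by
    apply eq_zero_of_trace_dag_mul_self_re R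
    rw [h1, Matrix.trace_smul, smul_eq_mul, Complex.re_ofReal_mul]
    exact le_antisymm (mul_nonpos_of_nonpos_of_nonneg hν h4) h3
  rw [← dag_dag R (q ν * a), h5, map_zero]

namespace IsGradedParabolic

variable {S : Matrix ι ι ℂ} {ε : ℂ} {hS : IsFormMatrix S ε} {R : (Matrix ι ι ℂ)ˣ}
  {𝔭 : Submodule ℂ (Matrix ι ι ℂ)} {H : Matrix ι ι ℂ} {s : Finset ℝ} {p : ℝ → Matrix ι ι ℂ}
  (h : IsGradedParabolic hS R 𝔭 H s p)
include h

/-- Polar decomposition: all blocks on the null space of the grading can be made partial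
isometries simultaneously. -/
theorem exists_partial_isometry (e : Matrix ι ι ℂ) : ∃ g ∈ leviGroup hS H, ∀ c, 0 < c →
    p c * Ad g e * p 0 * dag R (p c * Ad g e * p 0) * (p c * Ad g e * p 0) =
      p c * Ad g e * p 0 := by
  have hort := h.spectral.ortho
  obtain ⟨a, ha⟩ : ∃ a : ℝ → Matrix ι ι ℂ, ∀ c, a c = p c * e * p 0 := ⟨_, fun _ => rfl⟩
  have hpa : ∀ c, p c * a c = a c := fun c => by
    rw [ha, ← Matrix.mul_assoc, ← Matrix.mul_assoc, h.spectral.idem]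
  have hda : ∀ c, dag R (a c) * p c = dag R (a c) := fun c => by
    have := congrArg (dag R) (hpa c)
    rwa [dag_mul, h.spectral.dag_eq] at this
  -- On each V_c with c > 0 this acts as a_c a_c†, and it vanishes on the other V_c. Multiplying a_c
  -- by A^(-1/2), taken on the image of A, yields a partial isometry.
  obtain ⟨A, hA⟩ : ∃ A, A = ∑ d ∈ s.filter (0 < ·), a d * dag R (a d) := ⟨_, rfl⟩
  have hA1 : ∀ c, 0 < c → A * p c = a c * dag R (a c) := by
    intro c hc
    rw [hA, Matrix.sum_mul, Finset.sum_eq_single c]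
    · rw [Matrix.mul_assoc, hda]
    · intro d _ hd
      rw [← hda, Matrix.mul_assoc, Matrix.mul_assoc, hort _ _ hd]
      simp
    · intro hcs
      have : c ∉ s := fun h' => hcs (Finset.mem_filter.2 ⟨h', hc⟩)
      rw [h.spectral.eq_zero this, ha, h.spectral.eq_zero this]
      simp
  have hA0 : ∀ c, c ≤ 0 → A * p c = 0 := by
    intro c hc
    rw [hA, Matrix.sum_mul]
    refine Finset.sum_eq_zero fun d hd => ?_
    have hd0 := (Finset.mem_filter.1 hd).2
    rw [← hda, Matrix.mul_assoc, Matrix.mul_assoc, hort d c (by linarith)]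
    simp
  have hAd : dag R A = A := by
    rw [hA, map_sum]
    exact Finset.sum_congr rfl fun c _ => by rw [dag_mul, dag_dag]
  have hAp : ∀ c, A * p c = p c * A := by
    intro c
    have h1 : dag R (A * p c) = A * p c := by
      rcases lt_or_ge 0 c with hc | hc
      · rw [hA1 c hc, dag_mul, dag_dag]
      · rw [hA0 c hc, map_zero]
    rw [← h1, dag_mul, h.spectral.dag_eq, hAd]
  obtain ⟨t, q, hq⟩ := exists_isSpectral R hAd
  have hqp : ∀ μ c, q μ * p c = p c * q μ := fun μ c => hq.commute_proj (hAp c) μ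
  -- For μ > 0 the exponential of φ μ is μ^(-1/2). As `Real.log 0 = 0`, the kernel of A is left
  -- fixed.
  obtain ⟨φ, hφ⟩ : ∃ φ : ℝ → ℝ, ∀ μ, φ μ = -(1 / 2) * Real.log μ := ⟨_, fun _ => rfl⟩
  have hφ0 : φ 0 = 0 := by simp [hφ]
  have hφp : ∀ μ, 0 < μ → Real.exp (φ μ) * Real.exp (φ μ) * μ = 1 := by
    intro μ hμ
    nth_rw 3 [← Real.exp_log hμ]
    rw [← Real.exp_add, ← Real.exp_add, hφ, Real.exp_eq_one_iff]
    ring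
  obtain ⟨B, hB⟩ : ∃ B, B = ∑ μ ∈ t, (φ μ : ℂ) • q μ := ⟨_, rfl⟩
  have hqB : ∀ ν, q ν * B = (φ ν : ℂ) • q ν := by
    intro ν
    rw [hB, Matrix.mul_sum, Finset.sum_eq_single ν]
    · rw [Matrix.mul_smul, hq.idem]
    · intro d _ hd
      rw [Matrix.mul_smul, hq.ortho _ _ hd.symm, smul_zero]
    · intro hν
      rw [hq.eq_zero hν]
      simp
  have hBd : dag R B = B := by
    rw [hB, map_sum]
    exact Finset.sum_congr rfl fun c _ => by rw [map_smulₛₗ, hq.dag_eq, Complex.conj_ofReal]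
  have hBp : ∀ c, B * p c = p c * B := by
    intro c
    rw [hB, Matrix.mul_sum, Matrix.sum_mul]
    exact Finset.sum_congr rfl fun μ _ => by rw [Matrix.mul_smul, Matrix.smul_mul, hqp]
  have hB0 : ∀ c, c ≤ 0 → B * p c = 0 := by
    intro c hc
    rw [hB, Matrix.sum_mul]
    refine Finset.sum_eq_zero fun μ _ => ?_
    by_cases hμ : μ = 0
    · rw [hμ, hφ0]
      simp
    · have h1 : (μ : ℂ) • (q μ * p c) = 0 := by
        rw [← Matrix.smul_mul, ← hq.right, Matrix.mul_assoc, hA0 c hc, Matrix.mul_zero]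
      rw [Matrix.smul_mul, (smul_eq_zero.1 h1).resolve_left (by exact_mod_cast hμ), smul_zero]
  have hadj := fun x => h.spectral.adj_eq hS h.grading.mem_skew x
  have hBa : ∀ c, adj S B * p c = adj S (B * p (-c)) := by
    intro c
    rw [hBp, hS.adj_mul, hadj, neg_neg]
  have hBa' : ∀ c, adj S B * p c = p c * adj S B := by
    intro c
    rw [hBa, hS.adj_mul, hadj, neg_neg]
  -- Subtracting `adj S B` makes the exponent skew. Since B lives on the V_c with c > 0 and its
  -- bilinear adjoint on those with c < 0, X still agrees with B on V_c for c > 0 and is zero on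
  -- V_0.
  obtain ⟨X, hX⟩ : ∃ X, X = B - adj S B := ⟨_, rfl⟩
  have hXs : X ∈ skew S := by rw [mem_skew, hX, map_sub, hS.adj_adj, neg_sub]
  have hXd : dag R X = X := by rw [hX, map_sub, ← h.compat, hBd]
  have hXp : ∀ c, X * p c = p c * X := by
    intro c
    rw [hX, sub_mul, mul_sub, hBp, hBa']
  have hX0 : X * p 0 = 0 := by
    rw [hX, sub_mul, hBa, neg_zero, hB0 0 le_rfl, map_zero, sub_zero]
  have hX1 : ∀ c, 0 < c → X * p c = B * p c := by
    intro c hc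
    rw [hX, sub_mul, hBa, hB0 (-c) (by linarith), map_zero, sub_zero]
  have hXH : H * X = X * H := by
    rw [h.spectral.commute_iff]
    intro c d hcd
    rw [← hXp, Matrix.mul_assoc, hort _ _ hcd, Matrix.mul_zero]
  have hg : expGL X ∈ leviGroup hS H := ⟨expGL_mem_isoGroup hXs, by
    rw [coe_expGL]
    exact commute_exp hXH⟩
  have hgp : ∀ g ∈ leviGroup hS H, ∀ c, p c * (g : Matrix ι ι ℂ) = g * p c :=
    fun g hg c => h.spectral.commute_proj hg.2 c
  have hg0 : ((expGL X)⁻¹ : GL ι ℂ) * p 0 = p 0 := by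
    have h1 : (expGL X : Matrix ι ι ℂ) * p 0 = p 0 := by
      have h2 : X * p 0 = ((0 : ℝ) : ℂ) • p 0 := by rw [hX0]; simp
      rw [coe_expGL, exp_mul_of_mul_eq h2, Real.exp_zero, Complex.ofReal_one, one_smul]
    conv_lhs => rw [← h1, Units.inv_mul_cancel_left]
  have hgd : dag R (expGL X : Matrix ι ι ℂ) = expGL X := by rw [coe_expGL, dag_exp, hXd]
  refine ⟨expGL X, hg, fun c hc => ?_⟩
  have hcX : ∀ ν, q ν * p c * X = (φ ν : ℂ) • (q ν * p c) := by
    intro ν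
    rw [Matrix.mul_assoc, ← hXp, hX1 c hc, ← Matrix.mul_assoc, hqB, Matrix.smul_mul]
  have hqg : ∀ ν, q ν * p c * (expGL X : Matrix ι ι ℂ) =
      (Real.exp (φ ν) : ℂ) • (q ν * p c) := fun ν => by
    rw [coe_expGL, mul_exp_of_mul_eq (hcX ν)]
  have hb : p c * Ad (expGL X) e * p 0 = (expGL X : Matrix ι ι ℂ) * a c := by
    rw [Ad, Matrix.mul_assoc, Matrix.mul_assoc, Matrix.mul_assoc, hg0, ← Matrix.mul_assoc, hgp _ hg,
      ha]
    simp only [Matrix.mul_assoc]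
  have hqb : ∀ ν, q ν * ((expGL X : Matrix ι ι ℂ) * a c) = (Real.exp (φ ν) : ℂ) • (q ν * a c) := by
    intro ν
    conv_lhs => rw [← hpa c, ← Matrix.mul_assoc (expGL X : Matrix ι ι ℂ), ← hgp _ hg,
      ← Matrix.mul_assoc, ← Matrix.mul_assoc, hqg, Matrix.smul_mul, Matrix.mul_assoc, hpa]
  rw [hb]
  conv_lhs => rw [hq.expand_left (_ * _)]
  conv_rhs => rw [hq.expand_left (_ * _)]
  refine Finset.sum_congr rfl fun ν _ => ?_
  rw [hqb, dag_mul, hgd]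
  rcases hq.pos_or_mul_eq_zero (h.spectral.idem c) (h.spectral.dag_eq c) (hA1 c hc)
    (fun ν => hqp ν c) ν with hν | hν
  · have e1 : q ν * (a c * dag R (a c)) = (ν : ℂ) • (q ν * p c) := by
      rw [← hA1 c hc, ← Matrix.mul_assoc, hq.right, Matrix.smul_mul]
    calc q ν * ((expGL X : Matrix ι ι ℂ) * a c * (dag R (a c) * (expGL X : Matrix ι ι ℂ)) *
          ((expGL X : Matrix ι ι ℂ) * a c))
        = q ν * ((expGL X : Matrix ι ι ℂ) * a c) * dag R (a c) * (expGL X : Matrix ι ι ℂ) *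
          ((expGL X : Matrix ι ι ℂ) * a c) := by simp only [Matrix.mul_assoc]
      _ = (Real.exp (φ ν) : ℂ) • ((q ν * (a c * dag R (a c))) * (expGL X : Matrix ι ι ℂ) *
          ((expGL X : Matrix ι ι ℂ) * a c)) := by
          rw [hqb]; simp only [Matrix.smul_mul, Matrix.mul_assoc]
      _ = (Real.exp (φ ν) * Real.exp (φ ν) * ν : ℂ) • (q ν * p c * (expGL X * a c)) := by
          rw [e1, Matrix.smul_mul, hqg]
          simp only [Matrix.smul_mul, smul_smul]
          ring_nf
      _ = (Real.exp (φ ν) : ℂ) • (q ν * a c) := by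
          have := hφp ν hν
          rw [show (Real.exp (φ ν) * Real.exp (φ ν) * ν : ℂ) = 1 by exact_mod_cast this, one_smul,
            ← Matrix.mul_assoc, hqg, Matrix.smul_mul, Matrix.mul_assoc, hpa]
  · simp only [← Matrix.mul_assoc]
    rw [Matrix.mul_assoc (q ν), hqb, hν]
    simp

end IsGradedParabolic

/-! ### The coadjoint and adjoint cases -/

namespace IsGradedParabolic

variable {S : Matrix ι ι ℂ} {ε : ℂ} {hS : IsFormMatrix S ε} {R : (Matrix ι ι ℂ)ˣ}
  {𝔭 : Submodule ℂ (Matrix ι ι ℂ)} {H : Matrix ι ι ℂ} {s : Finset ℝ} {p : ℝ → Matrix ι ι ℂ}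
  (h : IsGradedParabolic hS R 𝔭 H s p)
include h

theorem isStrict_Ad {g : GL ι ℂ} (hg : g ∈ leviGroup hS H) {e : Matrix ι ι ℂ}
    (he : IsStrict p e) : IsStrict p (Ad g e) := by
  intro c d hcd
  have h1 := h.spectral.commute_proj hg.2 c
  have h2 := h.spectral.commute_proj (inv_mem hg).2 d
  calc p c * Ad g e * p d = (p c * (g : Matrix ι ι ℂ)) * e * ((↑g⁻¹ : Matrix ι ι ℂ) * p d) := by
        rw [Ad]; simp only [Matrix.mul_assoc]
    _ = (g : Matrix ι ι ℂ) * (p c * e * p d) * (↑g⁻¹ : Matrix ι ι ℂ) := by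
        rw [h1, ← h2]; simp only [Matrix.mul_assoc]
    _ = 0 := by rw [he c d hcd]; simp

/-- Self-adjoint elements of the Levi algebra lie in the imaginary part for the compact form. -/
theorem exists_mem_lieAlg_of_dag_eq {L K : Subgroup (GL ι ℂ)} (hK : IsCompactRealForm L K)
    (hKR : ∀ k ∈ K, dag R (k : Matrix ι ι ℂ) = (↑k⁻¹ : Matrix ι ι ℂ)) {X : Matrix ι ι ℂ}
    (hX : X ∈ lieAlg L) (hXd : dag R X = X) : ∃ Y ∈ lieAlg K, X = Complex.I • Y := by
  obtain ⟨⟨Y, Y'⟩, ⟨hY, hY', hXY⟩, -⟩ := hK.2.2 X hX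
  have h1 := h.dag_eq_neg_of_mem_lieAlg hKR hY
  have h2 := h.dag_eq_neg_of_mem_lieAlg hKR hY'
  simp only at h1 h2 hXY
  refine ⟨Y', hY', ?_⟩
  rw [hXY, map_add, map_smulₛₗ, h1, h2, Complex.conj_I, smul_neg, neg_smul, neg_neg,
    add_left_inj, eq_comm, eq_neg_iff_add_eq_zero, ← two_smul ℂ, smul_eq_zero,
    or_iff_right two_ne_zero] at hXd
  rw [hXY, hXd, zero_add]

/-- Polar decomposition acts on the whole of e, but block (c, 0) of e is the block of the single
component of weight ζ c / ζ 0, so every component meets the hypothesis of `exists_triple`. The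
neutral elements commute with H, hence lie in 𝔩, and being self-adjoint they lie in i𝔨. -/
theorem coadjointCase {P K : Subgroup (GL ι ℂ)} (hP : IsNormalizer hS 𝔭 P)
    (hK : IsCompactRealForm (leviGroup hS H) K)
    (hKR : ∀ k ∈ K, dag R (k : Matrix ι ι ℂ) = (↑k⁻¹ : Matrix ι ι ℂ))
    (hgen : ∀ D ∈ skew S, dag R D = D →
      (∀ g ∈ leviGroup hS H, D * (g : Matrix ι ι ℂ) = g * D) → D * p 0 = 0) :
    CoadjointCase (isoGroup S hS) P (leviGroup hS H) K := by
  intro e he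
  obtain ⟨ζ, hζ1, hζ2⟩ := h.exists_characters hgen
  have hζ : IsWeightFamily hS H p ζ := ⟨hζ1, hζ2⟩
  obtain ⟨g, hg, hpi⟩ := h.exists_partial_isometry e
  rw [h.mem_lieAlg_unipotentRadical_iff hζ hP] at he
  obtain ⟨c, hc, hec⟩ := h.exists_weight_components hζ hP
    ((h.mem_lieAlg_unipotentRadical_iff hζ hP).2
      ⟨Ad_mem_skew hg.1 he.1, h.isStrict_Ad hg he.2⟩)
  refine ⟨g, hg, c, hc, hec, ?_⟩
  have hex : ∀ χ : PosWeight (isoGroup S hS) P (leviGroup hS H), ∃ h0 f, IsSl2 (c χ) h0 f ∧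
      f ∈ weightSpace (isoGroup S hS) (leviGroup hS H) χ.1⁻¹ ∧ dag R h0 = h0 := by
    intro χ
    obtain ⟨a, ha, b, hb, hab, hχ⟩ := h.exists_eq_of_posWeight hζ hP χ
    have hcχ := hc χ
    rw [hχ] at hcχ ⊢
    refine h.exists_triple hζ ha hb hab hcχ fun d hd hdχ => ?_
    by_cases hds : d ∈ s
    · by_cases h0s : (0 : ℝ) ∈ s
      · rw [h.block_component hζ hP hc χ hds h0s (hχ.trans hdχ), ← hec]
        exact hpi d hd
      · rw [h.spectral.eq_zero h0s]
        simp
    · rw [h.spectral.eq_zero hds]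
      simp
  choose h0 f hsl hf hh using hex
  refine ⟨h0, f, fun χ => ?_⟩
  have h1 := h.lie_mem_weightSpace_one hζ (hc χ) (hf χ)
  rw [(hsl χ).1] at h1
  have h2 : h0 χ ∈ lieAlg (leviGroup hS H) :=
    mem_lieAlg_leviGroup.2 ⟨mem_lieAlg_isoGroup.1 h1.1, h.commute_of_mem_weightSpace_one hζ h1⟩
  exact ⟨hsl χ, hf χ, h2, h.exists_mem_lieAlg_of_dag_eq hK hKR h2 (hh χ)⟩

/-- An element trace-orthogonal to 𝔫 + 𝔮 lies in 𝔮, by the parabolic property of 𝔮. As 𝔩 ⊆ 𝔮, it is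
orthogonal to 𝔭 = 𝔫 + 𝔩, so it lies in 𝔫 too. But P ∩ Q = L makes 𝔫 ∩ 𝔮 zero. -/
theorem mem_nilrad_sup_opposite {P Q : Subgroup (GL ι ℂ)} (hP : IsNormalizer hS 𝔭 P)
    {𝔮 : Submodule ℂ (Matrix ι ι ℂ)} (hq : IsParabolicSpace S 𝔮) (hQ : IsNormalizer hS 𝔮 Q)
    (hPQ : P ⊓ Q = leviGroup hS H) {x : Matrix ι ι ℂ} (hx : x ∈ skew S) :
    x ∈ nilrad S 𝔭 ⊔ 𝔮 := by
  obtain ⟨_, _, _, hq', -⟩ := exists_generic hS h.compat hq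
  have hle : ∀ y ∈ skew S, H * y = y * H → y ∈ 𝔮 := by
    intro y hy hHy
    rw [← hq'.mem_lieAlg_of_isNormalizer hQ]
    exact lieAlg_mono (hPQ ▸ inf_le_right)
      ((mem_lieAlg_leviGroup (hS := hS)).2 ⟨hy, hHy⟩)
  have hdisj : ∀ u ∈ nilrad S 𝔭, u ∈ 𝔮 → u = 0 := by
    intro u hu huq
    have h1 : u ∈ lieAlg (leviGroup hS H) := by
      rw [mem_lieAlg_iff, ← hPQ]
      exact fun t => ⟨mem_lieAlg_iff.1 ((h.mem_lieAlg_of_isNormalizer hP).2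
        (h.parabolic.nilrad_le hu)) t,
        mem_lieAlg_iff.1 ((hq'.mem_lieAlg_of_isNormalizer hQ).2 huq) t⟩
    have h2 := h.spectral.commute_iff.1 (mem_lieAlg_leviGroup.1 h1).2
    have h3 := (h.mem_nilrad_iff.1 hu).2
    refine h.spectral.ext_blocks fun c _ d _ => ?_
    rw [Matrix.mul_zero, Matrix.zero_mul]
    by_cases hcd : c = d
    · exact h3 c d hcd.le
    · exact h2 c d hcd
  obtain ⟨y, hy, hxy⟩ := exists_orthogonal_projection R (nilrad S 𝔭 ⊔ 𝔮) x
  have hys : y ∈ skew S := (sup_le (h.parabolic.nilrad_le.trans h.parabolic.le_skew) hq.le_skew) hy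
  have hus : dag R (x - y) ∈ skew S := h.compat.dag_mem_skew (sub_mem hx hys)
  have huw : ∀ w ∈ nilrad S 𝔭 ⊔ 𝔮, (dag R (x - y) * w).trace = 0 := fun w hw => by
    rw [trace_dag_mul_comm, hxy w hw, star_zero]
  have huq : dag R (x - y) ∈ 𝔮 :=
    (hq.orthogonal _ hus fun w hw => huw w (Submodule.mem_sup_right hw)).1
  have hun : dag R (x - y) ∈ nilrad S 𝔭 := by
    refine ⟨hus, fun w hw => huw w ?_⟩
    obtain ⟨u, v, z, hu, hv, hv', -, hw', hz⟩ :=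
      h.parabolic.exists_decomposition h.compat (h.parabolic.le_skew hw)
    rw [hw', hz hw, add_zero]
    exact add_mem (Submodule.mem_sup_left hu) (Submodule.mem_sup_right
      (hle v (h.parabolic.le_skew hv) (h.grading.comm v hv hv')))
  have h0 := hdisj _ hun huq
  have h1 : x - y = 0 := by rw [← dag_dag R (x - y), h0, map_zero]
  rw [sub_eq_zero.1 h1]
  exact hy

/-- Write x as e + y with e in 𝔫 and y in 𝔮. The element of L found for e keeps y inside 𝔮, because
L is contained in Q. -/
theorem adjointCase {P Q K : Subgroup (GL ι ℂ)} (hP : IsNormalizer hS 𝔭 P)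
    {𝔮 : Submodule ℂ (Matrix ι ι ℂ)} (hq : IsParabolicSpace S 𝔮) (hQ : IsNormalizer hS 𝔮 Q)
    (hPQ : P ⊓ Q = leviGroup hS H)
    (hco : CoadjointCase (isoGroup S hS) P (leviGroup hS H) K) :
    AdjointCase (isoGroup S hS) P Q (leviGroup hS H) K := by
  intro x hx
  obtain ⟨_, _, _, hq', -⟩ := exists_generic hS h.compat hq
  obtain ⟨e, he, y, hy, rfl⟩ := Submodule.mem_sup.1
    (h.mem_nilrad_sup_opposite hP hq hQ hPQ (mem_lieAlg_isoGroup.1 hx))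
  obtain ⟨g, hg, c, hc, hec, hmc⟩ := hco e (by
    rw [h.unipotentRadical_eq hP, h.mem_lieAlg_uniGroup]
    exact he)
  refine ⟨g, hg, c, hc, ?_, hmc⟩
  rw [Ad_add, ← hec, add_sub_cancel_left, hq'.mem_lieAlg_of_isNormalizer hQ]
  rw [← hPQ] at hg
  exact ((hQ g).1 hg.2).2 y hy

end IsGradedParabolic

/-! ### Conclusion for the orthogonal and symplectic groups -/

section Parabolic

variable {S : Matrix ι ι ℂ} {ε : ℂ} {hS : IsFormMatrix S ε}

/-- What is orthogonal to 𝔭 is orthogonal to the Borel subalgebra inside it, so the property of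
Borel subalgebras passes to 𝔭 unchanged. -/
theorem IsParabolic.exists_isParabolicSpace {P : Subgroup (GL ι ℂ)}
    (hP : IsParabolic (isoGroup S hS) P) :
    ∃ 𝔭 : Submodule ℂ (Matrix ι ι ℂ), IsParabolicSpace S 𝔭 ∧ IsNormalizer hS 𝔭 P := by
  obtain ⟨𝔭, ⟨hle, 𝔟, hb, hbp⟩, hn⟩ := hP
  have hlie : lieAlg (isoGroup S hS) = (skew S : Set (Matrix ι ι ℂ)) :=
    Set.ext fun _ => mem_lieAlg_isoGroup
  rw [hlie] at hle
  rw [IsBorelSubalgebra, hlie] at hb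
  refine ⟨𝔭.toSubmodule, ⟨hle, fun x hx y hy => 𝔭.lie_mem hx hy, fun x hx hxp => ?_⟩, hn⟩
  obtain ⟨h1, h2⟩ := mem_and_isNilpotent_of_orthogonal hS hb hx fun y hy => hxp y (hbp hy)
  exact ⟨hbp h1, h2⟩

/-- Parabolic subgroups of the isometry group of a non-degenerate symmetric or alternating form
are weakly ample. -/
theorem IsParabolic.isWeaklyAmple {P : Subgroup (GL ι ℂ)} (hP : IsParabolic (isoGroup S hS) P) :
    IsWeaklyAmple (isoGroup S hS) P := by
  intro L K hL hK
  obtain ⟨𝔭, hp, hn⟩ := hP.exists_isParabolicSpace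
  obtain ⟨R, hc, hKR⟩ := exists_isCompatible hS
    (fun k hk => ((hn k).1 (hL.1 (hK.1 hk))).1 : K ≤ isoGroup S hS) hK.2.1
  obtain ⟨H, s, p, h, hgen⟩ := IsGradedParabolic.exists_generic hS hc hp
  -- Since the inner product was adapted to K, the given Levi subgroup coincides with the
  -- centralizer of H and can be replaced by it.
  obtain rfl := h.eq_leviGroup hn hL hK hKR
  have hco := h.coadjointCase hn hK hKR hgen
  refine ⟨hco, fun Q hQ hPQ => ?_⟩
  obtain ⟨𝔮, hq, hnq⟩ := hQ.exists_isParabolicSpace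
  exact h.adjointCase hn hq hnq hPQ hco

end Parabolic

theorem isFormMatrix_one : IsFormMatrix (1 : Matrix ι ι ℂ) 1 :=
  ⟨by simp, by simp, by simp, by simp⟩

theorem isFormMatrix_J (l : Type) [Fintype l] [DecidableEq l] :
    IsFormMatrix (J l ℂ) (-1) := by
  refine ⟨?_, ?_, by norm_num, ?_⟩
  · rw [J_transpose, mul_neg, J_squared, neg_neg]
  · rw [J_transpose, neg_one_smul]
  · rw [J, Matrix.fromBlocks_conjTranspose, Matrix.fromBlocks_transpose]
    simp

theorem SO_eq_isoGroup (n : ℕ) : SO n = isoGroup 1 isFormMatrix_one := by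
  ext g
  rw [mem_isoGroup, adj_def]
  change (g : Matrix (Fin n) (Fin n) ℂ) ∈ Matrix.specialOrthogonalGroup (Fin n) ℂ ↔ _
  rw [mem_specialOrthogonalGroup_iff, mem_orthogonalGroup_iff']
  simp

theorem Sp_eq_isoGroup (m : ℕ) : Sp m = isoGroup (J (Fin m) ℂ) (isFormMatrix_J (Fin m)) := by
  ext g
  rw [mem_isoGroup, adj_def]
  change (g : Matrix (Fin m ⊕ Fin m) (Fin m ⊕ Fin m) ℂ) ∈ Matrix.symplecticGroup (Fin m) ℂ ↔ _
  constructor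
  · intro hg
    refine ⟨?_, SymplecticGroup.det_eq_one hg⟩
    rw [Matrix.mul_assoc, Matrix.mul_assoc, ← Matrix.mul_assoc _ (J (Fin m) ℂ),
      SymplecticGroup.mem_iff'.1 hg, J_transpose, neg_mul, J_squared, neg_neg]
  · rintro ⟨hg, -⟩
    rw [SymplecticGroup.mem_iff']
    have h1 := congrArg (J (Fin m) ℂ * ·) hg
    simp only [J_transpose, ← Matrix.mul_assoc, mul_neg, J_squared, neg_neg, Matrix.mul_one,
      Matrix.one_mul] at h1
    exact h1


end General

end HermChar

theorem theorem4 :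
    (∀ (n : ℕ) (P : Subgroup (Matrix.GeneralLinearGroup (Fin n) ℂ)),
      HermChar.IsParabolic (HermChar.SO n) P → HermChar.IsWeaklyAmple (HermChar.SO n) P) ∧
    (∀ (m : ℕ) (P : Subgroup (Matrix.GeneralLinearGroup (Fin m ⊕ Fin m) ℂ)),
      HermChar.IsParabolic (HermChar.Sp m) P → HermChar.IsWeaklyAmple (HermChar.Sp m) P) := by
  refine ⟨fun n P hP => ?_, fun m P hP => ?_⟩
  · rw [HermChar.SO_eq_isoGroup] at hP ⊢
    exact hP.isWeaklyAmple
  · rw [HermChar.Sp_eq_isoGroup] at hP ⊢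
    exact hP.isWeaklyAmple
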